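/- Let $Z=(Z_t)_{t\ge 0}$ be a Lévy process in $\mathbf R^n$ (that is, $Z_0=0$ a.s., independent and stationary increments, stochastic continuity) which is symmetric ($Z_t$ and $-Z_t$ have the same law for every $t$) and purely jumping, i.e. its Lévy–Khintchine generating triplet is $(0,\ell,\gamma)$ with vanishing Gaussian matrix: $\ell$ is a Lévy measure, $\ell(\{0\})=0$, $\int(1\wedge|y|^2)\,\ell(dy)<\infty$, $\gamma\in\mathbf R^n$, and $$\mathbb E\,e^{iu\cdot Z_1}=\exp\Big(i\gamma\cdot u+\int_{y\neq0}\big[e^{iu\cdot y}-1-i(u\cdot y)\mathbf 1_{B_1}(y)\big]\ell(dy)\Big),\qquad u\in\mathbf R^n,$$ where $B_1=\{|y|\le 1\}$. Let $(L_0,D(L_0))$ be the infinitesimal generator of $Z$ in the real space $L^2(\mathbf R^n,dx)$: $\varphi\in D(L_0)$ with $L_0\varphi=g$ if and only if $\varphi,g\in L^2$ and $t^{-1}(T_t\varphi-\varphi)\to g$ in $L^2$ as $t\downarrow0$, where $(T_t\varphi)(x)=\mathbb E\,\varphi(x+Z_t)$. Write $[\delta_yf](x)=f(x+y)-f(x)$,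 and let $C_0^\infty(\mathbf R^n)$ be the real $C^\infty$ functions with compact support. Let $\varphi\in D(L_0)$. (1) For every $f\in C_0^\infty(\mathbf R^n)$ we have $f\in D(L_0)$ and $\varphi f\in D(L_0)$; for almost every $x$ the function $y\mapsto[\delta_y\varphi](x)[\delta_yf](x)$ is $\ell$-integrable; and, almost everywhere, $$L_0(\varphi f)=f\,L_0\varphi+\varphi\,L_0f+\int_{y\ne0}\delta_y\varphi\,\delta_yf\;\ell(dy).$$ (2) Suppose moreover that $\varphi>0$ almost everywhere, and put $\mu(dx)=\varphi^2(x)\,dx$ and $$Lf:=\frac{L_0(\varphi f)-f\,L_0\varphi}{\varphi},\qquad f\in D(L):=C_0^\infty(\mathbf R^n).$$ Then $Lf\in L^2(\mathbf R^n,d\mu)$ for every $f\in C_0^\infty(\mathbf R^n)$, and, with $$\gamma(x,y)=\frac{\varphi(x)}{\varphi(x+y)}\mathbf 1_{B_1}(y),\qquad \lambda(x;dy)=\frac{\varphi(x+y)}{\varphi(x)}\,\ell(dy),$$ for almost every $x$ the following integral converges absolutely and $$[Lf](x)=\int_{y\neq0}\big[f(x+y)-f(x)-\gamma(x,y)\,y\cdot\nabla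 f(x)\big]\lambda(x;dy).$$ Moreover $L$ is a Lévy-type operator with zero diffusion part and state-dependent jump kernel $\lambda(x;dy)$: $x\mapsto\lambda(x;B)$ is Lebesgue measurable for every Borel set $B$, $\lambda(x;\cdot)$ is a Lévy measure for almost every $x$, and there is a Lebesgue measurable $b:\mathbf R^n\to\mathbf R^n$ such that for every $f\in C_0^\infty(\mathbf R^n)$ and almost every $x$ $$[Lf](x)=b(x)\cdot\nabla f(x)+\int_{y\neq0}\big[f(x+y)-f(x)-\mathbf 1_{B_1}(y)\,y\cdot\nabla f(x)\big]\lambda(x;dy).$$ -/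

import Mathlib

open MeasureTheory ProbabilityTheory Filter Topology
open scoped NNReal ENNReal

noncomputable section

/-- A Lévy measure on `ℝⁿ`: no mass at the origin, and `∫ min(1, |y|²) ℓ(dy) < ∞`. In particular
integrals against `ℓ` are integrals over `y ≠ 0`. -/
structure IsLevyMeasure {n : ℕ} (ℓ : Measure (EuclideanSpace ℝ (Fin n))) : Prop where
  zero : ℓ {0} = 0
  lintegral_lt_top : ∫⁻ y, ENNReal.ofReal (min 1 (‖y‖ ^ 2)) ∂ℓ < ∞

/-- A Lévy process in `ℝⁿ`: starts at `0`, has independent and stationary increments, and is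
stochastically continuous. -/
structure IsLevyProcess {n : ℕ} {Ω : Type*} [MeasurableSpace Ω] (P : Measure Ω)
    (Z : ℝ≥0 → Ω → EuclideanSpace ℝ (Fin n)) : Prop where
  measurable : ∀ t, Measurable (Z t)
  zero : ∀ᵐ ω ∂P, Z 0 ω = 0
  indepIncrements : HasIndepIncrements Z P
  stationaryIncrements : ∀ s t : ℝ≥0, IdentDistrib (fun ω => Z (s + t) ω - Z s ω) (Z t) P P
  continuousInProbability : ∀ t, TendstoInMeasure P Z (𝓝 t) (Z t)

/-- The process is symmetric: `P(Z_t ∈ B) = P(Z_t ∈ -B)` for all `t` and all Borel sets `B`. -/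
def IsSymmetricProcess {n : ℕ} {Ω : Type*} [MeasurableSpace Ω] (P : Measure Ω)
    (Z : ℝ≥0 → Ω → EuclideanSpace ℝ (Fin n)) : Prop :=
  ∀ (t : ℝ≥0) (B : Set (EuclideanSpace ℝ (Fin n))), MeasurableSet B →
    P (Z t ⁻¹' B) = P ((fun ω => -Z t ω) ⁻¹' B)

/-- `(A, ℓ, γ)` is the generating triplet of `Z` in the Lévy-Khintchine formula (with the cutoff
given by the closed unit ball): `E[exp(i u⬝Z₁)]` is the exponential of
`-(1/2) u⬝Au + i γ⬝u + ∫ (exp(i u⬝y) - 1 - i (u⬝y) 1_{|y| ≤ 1}) ℓ(dy)`. -/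
structure HasGeneratingTriplet {n : ℕ} {Ω : Type*} [MeasurableSpace Ω] (P : Measure Ω)
    (Z : ℝ≥0 → Ω → EuclideanSpace ℝ (Fin n)) (A : Matrix (Fin n) (Fin n) ℝ)
    (ℓ : Measure (EuclideanSpace ℝ (Fin n))) (γ : EuclideanSpace ℝ (Fin n)) : Prop where
  posSemidef : A.PosSemidef
  isLevyMeasure : IsLevyMeasure ℓ
  charFun_eq : ∀ u : EuclideanSpace ℝ (Fin n),
    charFun (P.map (Z 1)) u = Complex.exp
      (-(1 / 2 : ℂ) * ((inner ℝ u (Matrix.toEuclideanLin A u) : ℝ) : ℂ)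
        + Complex.I * ((inner ℝ γ u : ℝ) : ℂ)
        + ∫ y, (Complex.exp (Complex.I * ((inner ℝ u y : ℝ) : ℂ)) - 1
            - (Metric.closedBall (0 : EuclideanSpace ℝ (Fin n)) 1).indicator
                (fun y => Complex.I * ((inner ℝ u y : ℝ) : ℂ)) y) ∂ℓ)

/-- The transition semigroup `(T_t φ)(x) = E[φ(x + Z_t)]`. -/
def transitionOp {n : ℕ} {Ω : Type*} [MeasurableSpace Ω] (P : Measure Ω)
    (Z : ℝ≥0 → Ω → EuclideanSpace ℝ (Fin n)) (t : ℝ≥0) (φ : EuclideanSpace ℝ (Fin n) → ℝ) :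
    EuclideanSpace ℝ (Fin n) → ℝ :=
  fun x => ∫ ω, φ (x + Z t ω) ∂P

/-- `φ` and `g` are in the real space `L²(ℝⁿ, dx)` and `(T_t φ - φ) / t → g` in `L²` as `t ↓ 0`. -/
def IsGeneratorPair {n : ℕ} {Ω : Type*} [MeasurableSpace Ω] (P : Measure Ω)
    (Z : ℝ≥0 → Ω → EuclideanSpace ℝ (Fin n)) (φ g : EuclideanSpace ℝ (Fin n) → ℝ) : Prop :=
  MemLp φ 2 volume ∧ MemLp g 2 volume ∧
    Tendsto
      (fun t : ℝ≥0 =>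
        eLpNorm (fun x => (t : ℝ)⁻¹ * (transitionOp P Z t φ x - φ x) - g x) 2 volume)
      (𝓝[>] 0) (𝓝 0)

/-- The domain `D(L₀)` of the infinitesimal generator of `Z` in `L²(ℝⁿ, dx)`. Its elements are
square integrable functions; membership only depends on the class modulo null sets. -/
def generatorDomain {n : ℕ} {Ω : Type*} [MeasurableSpace Ω] (P : Measure Ω)
    (Z : ℝ≥0 → Ω → EuclideanSpace ℝ (Fin n)) : Set (EuclideanSpace ℝ (Fin n) → ℝ) :=
  {φ | ∃ g, IsGeneratorPair P Z φ g}

open Classical in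
/-- The infinitesimal generator `L₀` of `Z` in `L²(ℝⁿ, dx)`: for `φ ∈ D(L₀)`, the `L²`-limit of
`(T_t φ - φ) / t`, which is determined up to null sets (and `0` outside of `D(L₀)`). -/
def generator {n : ℕ} {Ω : Type*} [MeasurableSpace Ω] (P : Measure Ω)
    (Z : ℝ≥0 → Ω → EuclideanSpace ℝ (Fin n)) (φ : EuclideanSpace ℝ (Fin n) → ℝ) :
    EuclideanSpace ℝ (Fin n) → ℝ :=
  if h : ∃ g, IsGeneratorPair P Z φ g then h.choose else 0

/-- The real functions of class `C^∞` with compact support on `ℝⁿ`. -/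
def testFunctions (n : ℕ) : Set (EuclideanSpace ℝ (Fin n) → ℝ) :=
  {f | ContDiff ℝ (⊤ : ℕ∞) f ∧ HasCompactSupport f}

/-- The increment `(δ_y f)(x) = f(x + y) - f(x)`. -/
def increment {n : ℕ} (f : EuclideanSpace ℝ (Fin n) → ℝ) (y x : EuclideanSpace ℝ (Fin n)) : ℝ :=
  f (x + y) - f x

/-- The Doob transform `L f = (L₀(φ f) - f L₀ φ) / φ` of the generator. -/
def doobOp {n : ℕ} {Ω : Type*} [MeasurableSpace Ω] (P : Measure Ω)
    (Z : ℝ≥0 → Ω → EuclideanSpace ℝ (Fin n)) (φ f : EuclideanSpace ℝ (Fin n) → ℝ) :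
    EuclideanSpace ℝ (Fin n) → ℝ :=
  fun x => (generator P Z (fun z => φ z * f z) x - f x * generator P Z φ x) / φ x

/-- The jump kernel `λ(x; dy) = (φ(x + y) / φ(x)) ℓ(dy)`. -/
def jumpKernel {n : ℕ} (φ : EuclideanSpace ℝ (Fin n) → ℝ)
    (ℓ : Measure (EuclideanSpace ℝ (Fin n))) (x : EuclideanSpace ℝ (Fin n)) :
    Measure (EuclideanSpace ℝ (Fin n)) :=
  ℓ.withDensity (fun y => ENNReal.ofReal (φ (x + y) / φ x))

/-- The cutoff `γ(x, y) = (φ(x) / φ(x + y)) 1_{|y| ≤ 1}`. -/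
def jumpCutoff {n : ℕ} (φ : EuclideanSpace ℝ (Fin n) → ℝ) (x y : EuclideanSpace ℝ (Fin n)) : ℝ :=
  (Metric.closedBall (0 : EuclideanSpace ℝ (Fin n)) 1).indicator (fun y => φ x / φ (x + y)) y

/-- `L`, acting on `C_0^∞(ℝⁿ)`, is the (conservative) Lévy-type operator with diffusion matrix
`Q(x)`, drift `b(x)` and Lévy kernel `N(x; dy)`, i.e. for almost every `x`
`(L f)(x) = (1/2) ∑ Q_ij(x) ∂_ij f(x) + b(x)⬝∇f(x)
  + ∫ (f(x + y) - f(x) - 1_{|y| ≤ 1} y⬝∇f(x)) N(x; dy)`. -/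
structure IsLevyTypeOperator {n : ℕ}
    (L : (EuclideanSpace ℝ (Fin n) → ℝ) → EuclideanSpace ℝ (Fin n) → ℝ)
    (Q : EuclideanSpace ℝ (Fin n) → Matrix (Fin n) (Fin n) ℝ)
    (b : EuclideanSpace ℝ (Fin n) → EuclideanSpace ℝ (Fin n))
    (N : EuclideanSpace ℝ (Fin n) → Measure (EuclideanSpace ℝ (Fin n))) : Prop where
  aemeasurable_diffusion : ∀ i j, AEMeasurable (fun x => Q x i j) volume
  aemeasurable_drift : AEMeasurable b volume
  aemeasurable_kernel : ∀ B : Set (EuclideanSpace ℝ (Fin n)), MeasurableSet B →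
    AEMeasurable (fun x => N x B) volume
  posSemidef : ∀ᵐ x, (Q x).PosSemidef
  isLevyMeasure : ∀ᵐ x, IsLevyMeasure (N x)
  apply_eq : ∀ f ∈ testFunctions n, ∀ᵐ x,
    L f x =
      (1 / 2) * ∑ i, ∑ j, Q x i j * iteratedFDeriv ℝ 2 f x
          ![EuclideanSpace.single i (1 : ℝ), EuclideanSpace.single j (1 : ℝ)]
        + fderiv ℝ f x (b x)
        + ∫ y, (f (x + y) - f x
            - (Metric.closedBall (0 : EuclideanSpace ℝ (Fin n)) 1).indicator
                (fun y => fderiv ℝ f x y) y) ∂(N x)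

end

/-! The heart of the matter is the small-time asymptotics `t⁻¹ E F(Z_t) → ∫ F dℓ`, combined with the
algebraic identity `δ(uf) = f δu + u δf + δu δf`.

Asymptotics. The triplet only describes `Z_1`. Symmetry and stochastic continuity make the
characteristic function of `Z_t` equal to `exp(tψ)` with `ψ` real. The weight `w(y) = 1 -
exp(-|y|²/2)` is comparable with `min(1, |y|²)` and is also the average of `1 - cos(h⬝y)` over a
standard Gaussian `h`. The Fourier transform of `w m` is therefore a Gaussian average of second
differences in frequency, and for `m = ℓ` these do not see the drift. Lévy's continuity theorem
gives weak convergence of `t⁻¹ w · law(Z_t)` to `w ℓ`, and a cutoff argument extends the limit to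
every continuous `F` with `F² ≤ w G`, where `G` is nonnegative, bounded, continuous and of bounded
energy `t⁻¹ E G(Z_t)`.

Operators. Translations `τ_z` are isometries of `L²`, so `t⁻¹ E ‖τ_{Z_t} u - u‖² = -2 ⟨t⁻¹(T_t u -
u), u⟩`, which stays bounded when `u` is in the domain. Hence `G(z) = ‖τ_z u - u‖²` is admissible,
and since `(δ_z f)²` is at most a constant times `w(z)`, the term `δu δf` converges weakly to its
`ℓ`-integral. The term `u δf` is only of first order in `z`, but averaging over `z` and `-z` makes
it of second order. The weak limit so obtained is a strong one because `T_t` is a symmetric,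
strongly continuous semigroup (`IsLevyProcess.tendsto_of_weak`). This yields
`IsLevyProcess.tendsto_l2Mul`, and `coeFn_integral_Lp` turns the Bochner integrals in `L²` into
pointwise ones.

Doob transform. Writing `φ(x+y)/φ(x) = 1 + δ_yφ(x)/φ(x)` absorbs the product term into the kernel.
Finite energy of `φ` makes `|y| |δ_yφ(x)|` integrable on the unit ball for almost every `x`, so the
change of cutoff only produces a drift. -/

noncomputable section

/-! ### The weight and Lévy measures -/

/-- The weight `1 - exp(-|y|²/2)`, comparable with `min(1, |y|²)`. -/
def gaussWeight {n : ℕ} (y : EuclideanSpace ℝ (Fin n)) : ℝ := 1 - Real.exp (-(‖y‖ ^ 2 / 2))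

section gaussWeight

variable {n : ℕ} (y : EuclideanSpace ℝ (Fin n))

lemma gaussWeight_nonneg : 0 ≤ gaussWeight y := by
  have : Real.exp (-(‖y‖ ^ 2 / 2)) ≤ 1 := Real.exp_le_one_iff.2 (by nlinarith [sq_nonneg ‖y‖])
  unfold gaussWeight; linarith

lemma gaussWeight_le_one : gaussWeight y ≤ 1 := by
  have := Real.exp_pos (-(‖y‖ ^ 2 / 2))
  unfold gaussWeight; linarith

lemma gaussWeight_pos {y : EuclideanSpace ℝ (Fin n)} (hy : y ≠ 0) : 0 < gaussWeight y := by
  have h : 0 < ‖y‖ := norm_pos_iff.2 hy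
  have : Real.exp (-(‖y‖ ^ 2 / 2)) < 1 := by
    rw [← Real.exp_zero]; exact Real.exp_lt_exp.2 (by nlinarith)
  unfold gaussWeight; linarith

@[simp] lemma gaussWeight_neg : gaussWeight (-y) = gaussWeight y := by
  simp [gaussWeight]

@[fun_prop] lemma continuous_gaussWeight :
    Continuous (gaussWeight : EuclideanSpace ℝ (Fin n) → ℝ) := by
  unfold gaussWeight; fun_prop

@[fun_prop] lemma measurable_gaussWeight :
    Measurable (gaussWeight : EuclideanSpace ℝ (Fin n) → ℝ) :=
  continuous_gaussWeight.measurable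

lemma gaussWeight_le : gaussWeight y ≤ min 1 (‖y‖ ^ 2) := by
  refine le_min (gaussWeight_le_one y) ?_
  have := Real.add_one_le_exp (-(‖y‖ ^ 2 / 2))
  unfold gaussWeight; nlinarith [sq_nonneg ‖y‖]

lemma min_one_sq_le_gaussWeight : min 1 (‖y‖ ^ 2) ≤ 3 * gaussWeight y := by
  set s := ‖y‖ ^ 2 with hs
  have hs0 : 0 ≤ s := sq_nonneg _
  have h1 := Real.add_one_le_exp (s / 2)
  -- Hence the weight is at least `s / (s + 2)`, which is at least `s / 3` for `s ≤ 1` and at least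
  -- `1 / 3` for `s ≥ 1`; this is the constant `3`.
  have h2 : Real.exp (-(s / 2)) * (s / 2 + 1) ≤ 1 := by
    calc _ ≤ Real.exp (-(s / 2)) * Real.exp (s / 2) := by gcongr
      _ = 1 := by rw [← Real.exp_add]; simp
  have h3 : gaussWeight y = 1 - Real.exp (-(s / 2)) := rfl
  set e := Real.exp (-(s / 2))
  rw [h3]
  have he : 0 < e := Real.exp_pos _
  rcases le_total s 1 with h | h
  · rw [min_eq_right h]; nlinarith
  · rw [min_eq_left h]; nlinarith

lemma sq_le_gaussWeight {y : EuclideanSpace ℝ (Fin n)} (hy : ‖y‖ ≤ 1) :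
    ‖y‖ ^ 2 ≤ 3 * gaussWeight y := by
  have := min_one_sq_le_gaussWeight y
  rwa [min_eq_right (by nlinarith [norm_nonneg y])] at this

lemma one_le_gaussWeight {y : EuclideanSpace ℝ (Fin n)} (hy : 1 ≤ ‖y‖) :
    1 ≤ 3 * gaussWeight y := by
  have := min_one_sq_le_gaussWeight y
  rwa [min_eq_left (by nlinarith [norm_nonneg y])] at this

end gaussWeight

namespace IsLevyMeasure

variable {n : ℕ} {ℓ : Measure (EuclideanSpace ℝ (Fin n))} 

lemma ae_ne_zero (hℓ : IsLevyMeasure ℓ) : ∀ᵐ y ∂ℓ, y ≠ 0 := by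
  rw [ae_iff]; simpa using hℓ.zero

lemma ae_gaussWeight_pos (hℓ : IsLevyMeasure ℓ) : ∀ᵐ y ∂ℓ, 0 < gaussWeight y :=
  hℓ.ae_ne_zero.mono fun _ => gaussWeight_pos

lemma integrable_gaussWeight (hℓ : IsLevyMeasure ℓ) : Integrable gaussWeight ℓ := by
  have h : Integrable (fun y : EuclideanSpace ℝ (Fin n) => min 1 (‖y‖ ^ 2)) ℓ := by
    refine ⟨by fun_prop, ?_⟩
    rw [hasFiniteIntegral_iff_ofReal (.of_forall fun y => by positivity)]
    exact hℓ.lintegral_lt_top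
  refine h.mono' (by fun_prop) (.of_forall fun y => ?_)
  rw [Real.norm_of_nonneg (gaussWeight_nonneg y)]
  exact gaussWeight_le y

lemma integrable_of_le (hℓ : IsLevyMeasure ℓ) {F : Type*} [NormedAddCommGroup F] {k : EuclideanSpace ℝ (Fin n) → F}
    (hk : AEStronglyMeasurable k ℓ) {C : ℝ} (h : ∀ y, ‖k y‖ ≤ C * gaussWeight y) :
    Integrable k ℓ :=
  (hℓ.integrable_gaussWeight.const_mul C).mono' hk (.of_forall h)

/-- `ℓ` is recovered from the finite measure `w ℓ` by the density `w⁻¹`, which is finite away from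
the origin. Fubini arguments with `ℓ` rest on this. -/
lemma sigmaFinite (hℓ : IsLevyMeasure ℓ) : SigmaFinite ℓ := by
  have hf : IsFiniteMeasure (ℓ.withDensity fun y => ENNReal.ofReal (gaussWeight y)) :=
    isFiniteMeasure_withDensity_ofReal hℓ.integrable_gaussWeight.2
  have h : ℓ = (ℓ.withDensity fun y => ENNReal.ofReal (gaussWeight y)).withDensity
      fun y => (ENNReal.ofReal (gaussWeight y))⁻¹ := by
    rw [withDensity_inv_same₀ (by fun_prop)]
    · filter_upwards [hℓ.ae_gaussWeight_pos] with y hy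
      simpa using hy
    · exact .of_forall fun y => ENNReal.ofReal_ne_top
  rw [h]
  refine SigmaFinite.withDensity_of_ne_top ?_
  refine (withDensity_absolutelyContinuous _ _).ae_le ?_
  filter_upwards [hℓ.ae_gaussWeight_pos] with y hy
  simpa using hy

end IsLevyMeasure

/-! ### The characteristic exponent -/

/-- The compensated integrand of the Lévy-Khintchine formula. -/
def levyIntegrand {n : ℕ} (u y : EuclideanSpace ℝ (Fin n)) : ℂ :=
  Complex.exp (Complex.I * ((inner ℝ u y : ℝ) : ℂ)) - 1
    - (Metric.closedBall (0 : EuclideanSpace ℝ (Fin n)) 1).indicator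
        (fun y => Complex.I * ((inner ℝ u y : ℝ) : ℂ)) y

/-- The characteristic exponent of the triplet `(0, ℓ, γ)`. -/
def levyExponent {n : ℕ} (ℓ : Measure (EuclideanSpace ℝ (Fin n)))
    (γ u : EuclideanSpace ℝ (Fin n)) : ℂ :=
  Complex.I * ((inner ℝ γ u : ℝ) : ℂ) + ∫ y, levyIntegrand u y ∂ℓ

section exponent

variable {n : ℕ}

lemma Complex.norm_exp_I_mul_sub_one_sub_le (s : ℝ) :
    ‖Complex.exp (Complex.I * s) - 1 - Complex.I * s‖ ≤ 3 * s ^ 2 := by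
  have hn : ‖Complex.I * (s : ℂ)‖ = |s| := by simp
  rcases le_total |s| 1 with h | h
  · have := Complex.norm_exp_sub_one_sub_id_le (x := Complex.I * s) (by rwa [hn])
    rw [hn, sq_abs] at this
    nlinarith [sq_nonneg s]
  · have h1 := Real.norm_exp_I_mul_ofReal_sub_one_le (x := s)
    rw [Real.norm_eq_abs] at h1
    have h2 := norm_sub_le (Complex.exp (Complex.I * s) - 1) (Complex.I * s)
    rw [hn] at h2
    nlinarith [sq_abs s]

lemma measurable_levyIntegrand (u : EuclideanSpace ℝ (Fin n)) : Measurable (levyIntegrand u) := by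
  unfold levyIntegrand
  exact (by fun_prop : Measurable _).sub
    ((by fun_prop : Measurable _).indicator Metric.isClosed_closedBall.measurableSet)

/-- Second-order Taylor bound inside the unit ball, trivial bound `2` outside; each is multiplied by
the `3` of the weight comparison. -/
lemma norm_levyIntegrand_le (u y : EuclideanSpace ℝ (Fin n)) :
    ‖levyIntegrand u y‖ ≤ (9 * ‖u‖ ^ 2 + 6) * gaussWeight y := by
  have h0 := gaussWeight_nonneg y
  unfold levyIntegrand
  by_cases hy : ‖y‖ ≤ 1
  · rw [Set.indicator_of_mem (by simpa using hy)]
    refine (Complex.norm_exp_I_mul_sub_one_sub_le _).trans ?_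
    have h1 : (inner ℝ u y) ^ 2 ≤ (‖u‖ * ‖y‖) ^ 2 :=
      sq_le_sq.2 ((abs_real_inner_le_norm u y).trans (le_abs_self _))
    have h2 := sq_le_gaussWeight hy
    have h3 : ‖u‖ ^ 2 * ‖y‖ ^ 2 ≤ ‖u‖ ^ 2 * (3 * gaussWeight y) := by gcongr
    nlinarith
  · rw [Set.indicator_of_notMem (by simpa using hy), sub_zero]
    have h2 := one_le_gaussWeight (not_le.1 hy).le
    have h3 : ‖Complex.exp (Complex.I * (inner ℝ u y : ℝ)) - 1‖ ≤ 2 := by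
      refine (norm_sub_le _ _).trans ?_
      rw [mul_comm, Complex.norm_exp_ofReal_mul_I]; norm_num
    have : 0 ≤ 9 * ‖u‖ ^ 2 * gaussWeight y := by positivity
    nlinarith

lemma IsLevyMeasure.integrable_levyIntegrand {ℓ : Measure (EuclideanSpace ℝ (Fin n))}
    (hℓ : IsLevyMeasure ℓ) (u : EuclideanSpace ℝ (Fin n)) : Integrable (levyIntegrand u) ℓ :=
  hℓ.integrable_of_le (measurable_levyIntegrand u).aestronglyMeasurable (norm_levyIntegrand_le u)

lemma continuous_levyIntegrand_left (y : EuclideanSpace ℝ (Fin n)) :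
    Continuous fun u => levyIntegrand u y := by
  unfold levyIntegrand
  by_cases hy : y ∈ Metric.closedBall (0 : EuclideanSpace ℝ (Fin n)) 1
  · simp only [Set.indicator_of_mem hy]; fun_prop
  · simp only [Set.indicator_of_notMem hy]; fun_prop

lemma IsLevyMeasure.continuous_levyExponent {ℓ : Measure (EuclideanSpace ℝ (Fin n))}
    (hℓ : IsLevyMeasure ℓ) (γ : EuclideanSpace ℝ (Fin n)) : Continuous (levyExponent ℓ γ) := by
  unfold levyExponent
  refine Continuous.add (by fun_prop) (continuous_iff_continuousAt.2 fun u => ?_)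
  refine continuousAt_of_dominated (bound := fun y => (9 * (‖u‖ + 1) ^ 2 + 6) * gaussWeight y)
    (.of_forall fun v => (measurable_levyIntegrand v).aestronglyMeasurable) ?_
    (hℓ.integrable_gaussWeight.const_mul _)
    (.of_forall fun y => (continuous_levyIntegrand_left y).continuousAt)
  filter_upwards [Metric.ball_mem_nhds u one_pos] with v hv
  refine .of_forall fun y => (norm_levyIntegrand_le v y).trans ?_
  have h1 : ‖v‖ ≤ ‖u‖ + 1 := by
    have := norm_le_norm_add_norm_sub' v u
    rw [Metric.mem_ball, dist_eq_norm] at hv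
    linarith
  have := gaussWeight_nonneg y
  gcongr

lemma levyExponent_zero (ℓ : Measure (EuclideanSpace ℝ (Fin n))) (γ : EuclideanSpace ℝ (Fin n)) :
    levyExponent ℓ γ 0 = 0 := by
  have : levyIntegrand (0 : EuclideanSpace ℝ (Fin n)) = 0 := by
    ext y; simp [levyIntegrand, Set.indicator]
  simp [levyExponent, this]

/-- Second differences of the exponent in the frequency variable. -/
lemma IsLevyMeasure.levyExponent_sub_half {ℓ : Measure (EuclideanSpace ℝ (Fin n))}
    (hℓ : IsLevyMeasure ℓ) (γ u h : EuclideanSpace ℝ (Fin n)) :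
    levyExponent ℓ γ u - (1 / 2) * (levyExponent ℓ γ (u + h) + levyExponent ℓ γ (u - h)) =
      ∫ y, Complex.exp (Complex.I * (inner ℝ u y : ℝ)) * (1 - Real.cos (inner ℝ h y)) ∂ℓ := by
  -- The compensator, like the drift below, is linear in the frequency and so drops out of a second
  -- difference.
  have e : ∀ y, Complex.exp (Complex.I * (inner ℝ u y : ℝ)) * (1 - Real.cos (inner ℝ h y)) =
      levyIntegrand u y - (1 / 2) * (levyIntegrand (u + h) y + levyIntegrand (u - h) y) := by
    intro y
    have h1 : (Real.cos (inner ℝ h y) : ℂ) = (Complex.exp (Complex.I * (inner ℝ h y : ℝ))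
        + Complex.exp (-(Complex.I * (inner ℝ h y : ℝ)))) / 2 := by
      rw [Complex.ofReal_cos, Complex.cos]
      ring_nf
    have h2 : Complex.exp (Complex.I * (inner ℝ (u + h) y : ℝ)) =
        Complex.exp (Complex.I * (inner ℝ u y : ℝ)) * Complex.exp (Complex.I * (inner ℝ h y : ℝ)) := by
      rw [← Complex.exp_add, inner_add_left]; push_cast; ring_nf
    have h3 : Complex.exp (Complex.I * (inner ℝ (u - h) y : ℝ)) =
        Complex.exp (Complex.I * (inner ℝ u y : ℝ)) *
          Complex.exp (-(Complex.I * (inner ℝ h y : ℝ))) := by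
      rw [← Complex.exp_add, inner_sub_left]; push_cast; ring_nf
    unfold levyIntegrand
    rw [h1, h2, h3]
    by_cases hy : y ∈ Metric.closedBall (0 : EuclideanSpace ℝ (Fin n)) 1
    · simp only [Set.indicator_of_mem hy, inner_add_left, inner_sub_left]; push_cast; ring
    · simp only [Set.indicator_of_notMem hy]; ring
  simp_rw [e]
  have i1 := hℓ.integrable_levyIntegrand u
  have i2 := hℓ.integrable_levyIntegrand (u + h)
  have i3 := hℓ.integrable_levyIntegrand (u - h)
  have i23 : Integrable (fun y => levyIntegrand (u + h) y + levyIntegrand (u - h) y) ℓ := i2.add i3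
  rw [integral_sub i1 (i23.const_mul _), integral_const_mul]
  have : ∫ y, (levyIntegrand (u + h) y + levyIntegrand (u - h) y) ∂ℓ
    = ∫ y, levyIntegrand (u + h) y ∂ℓ + ∫ y, levyIntegrand (u - h) y ∂ℓ := integral_add i2 i3
  rw [this]
  unfold levyExponent
  simp only [inner_add_right, inner_sub_right]
  push_cast
  ring

lemma HasGeneratingTriplet.charFun_eq_exp {Ω : Type*} [MeasurableSpace Ω] {P : Measure Ω}
    {Z : ℝ≥0 → Ω → EuclideanSpace ℝ (Fin n)} {ℓ : Measure (EuclideanSpace ℝ (Fin n))}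
    {γ : EuclideanSpace ℝ (Fin n)} (h : HasGeneratingTriplet P Z 0 ℓ γ)
    (u : EuclideanSpace ℝ (Fin n)) :
    charFun (P.map (Z 1)) u = Complex.exp (levyExponent ℓ γ u) := by
  rw [h.charFun_eq u]
  congr 1
  simp [levyExponent, levyIntegrand]

end exponent

/-! ### Laws and characteristic functions of a symmetric Lévy process -/

section process

variable {n : ℕ} {Ω : Type*} [MeasurableSpace Ω] {P : Measure Ω}
    {Z : ℝ≥0 → Ω → EuclideanSpace ℝ (Fin n)}

lemma IsLevyProcess.map_add [IsProbabilityMeasure P] (hZ : IsLevyProcess P Z) (s t : ℝ≥0) :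
    P.map (Z (s + t)) = P.map (Z s) ∗ P.map (Z t) := by
  have hind : IndepFun (Z s) (Z (s + t) - Z s) P :=
    hZ.indepIncrements.indepFun_eval_sub (zero_le) (le_self_add) hZ.zero
  have h := hind.map_add_eq_map_conv_map₀ (hZ.measurable s).aemeasurable
    ((hZ.measurable _).sub (hZ.measurable s)).aemeasurable
  have e : Z s + (Z (s + t) - Z s) = Z (s + t) := by abel
  rw [e] at h
  have h2 : P.map (Z (s + t) - Z s) = P.map (Z t) := (hZ.stationaryIncrements s t).map_eq
  rw [h, h2]

lemma IsLevyProcess.isProbabilityMeasure_map [IsProbabilityMeasure P] (hZ : IsLevyProcess P Z)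
    (t : ℝ≥0) : IsProbabilityMeasure (P.map (Z t)) :=
  Measure.isProbabilityMeasure_map (hZ.measurable t).aemeasurable

lemma IsLevyProcess.map_neg (hZ : IsLevyProcess P Z) (hs : IsSymmetricProcess P Z) (t : ℝ≥0) :
    (P.map (Z t)).map (fun z => -z) = P.map (Z t) := by
  ext B hB
  rw [Measure.map_map measurable_neg (hZ.measurable t),
    Measure.map_apply (measurable_neg.comp (hZ.measurable t)) hB,
    Measure.map_apply (hZ.measurable t) hB, hs t B hB]
  rfl

lemma IsLevyProcess.map_zero [IsProbabilityMeasure P] (hZ : IsLevyProcess P Z) :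
    P.map (Z 0) = Measure.dirac 0 := by
  rw [Measure.map_congr (g := fun _ => 0) hZ.zero]; simp

/-- The laws of a Lévy process depend continuously on time. -/
lemma IsLevyProcess.continuous_integral [IsProbabilityMeasure P] (hZ : IsLevyProcess P Z)
    {k : EuclideanSpace ℝ (Fin n) → ℝ} (hk : Continuous k) {C : ℝ} (hC : ∀ z, |k z| ≤ C) :
    Continuous fun t => ∫ z, k z ∂(P.map (Z t)) := by
  refine continuous_iff_continuousAt.2 fun t => ?_
  have h := (hZ.continuousInProbability t).tendstoInDistribution
    fun s => (hZ.measurable s).aemeasurable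
  have h2 := ProbabilityMeasure.tendsto_iff_forall_integral_tendsto.1 h.tendsto
    (BoundedContinuousFunction.ofNormedAddCommGroup k hk C hC)
  exact h2

/-- The characteristic function of a symmetric Lévy process is real. -/
lemma IsLevyProcess.charFun_im (hZ : IsLevyProcess P Z) (hs : IsSymmetricProcess P Z) (t : ℝ≥0)
    (u : EuclideanSpace ℝ (Fin n)) : (charFun (P.map (Z t)) u).im = 0 := by
  rw [← Complex.conj_eq_iff_im, ← charFun_neg]
  conv_rhs => rw [← hZ.map_neg hs t, charFun_apply,
    integral_map (by fun_prop) (by fun_prop)]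
  simp [charFun_apply]

lemma IsLevyProcess.charFun_add [IsProbabilityMeasure P] (hZ : IsLevyProcess P Z) (s t : ℝ≥0)
    (u : EuclideanSpace ℝ (Fin n)) :
    charFun (P.map (Z (s + t))) u = charFun (P.map (Z s)) u * charFun (P.map (Z t)) u := by
  have := hZ.isProbabilityMeasure_map s
  have := hZ.isProbabilityMeasure_map t
  rw [hZ.map_add, charFun_conv]

lemma IsLevyProcess.charFun_re_eq (u : EuclideanSpace ℝ (Fin n)) [IsProbabilityMeasure P]
    (hZ : IsLevyProcess P Z) (t : ℝ≥0) :
    (charFun (P.map (Z t)) u).re = ∫ z, Real.cos (inner ℝ z u) ∂(P.map (Z t)) := by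
  have := hZ.isProbabilityMeasure_map t
  rw [charFun_apply, ← Complex.reCLM_apply, ← ContinuousLinearMap.integral_comp_comm]
  · simp [Complex.exp_ofReal_mul_I_re]
  · refine Integrable.of_bound (by fun_prop) 1 (.of_forall fun z => ?_)
    rw [Complex.norm_exp_ofReal_mul_I]

/-- A continuous multiplicative function on `ℝ≥0` with values in `[0, ∞)` is a power function. -/
lemma NNReal.eq_rpow_of_continuous_of_mul {r : ℝ≥0 → ℝ} (hc : Continuous r) (h0 : ∀ t, 0 ≤ r t)
    (hr0 : r 0 = 1) (hr1 : 0 < r 1) (hm : ∀ s t, r (s + t) = r s * r t) (t : ℝ≥0) :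
    r t = r 1 ^ (t : ℝ) := by
  have hpow : ∀ (k : ℕ) (s : ℝ≥0), r (k * s) = r s ^ k := by
    intro k s
    induction k with
    | zero => simp [hr0]
    | succ k ih => push_cast; rw [add_mul, one_mul, hm, ih, pow_succ]
  have hrat : ∀ a b : ℕ, 0 < b → r (a / b) = r 1 ^ ((a / b : ℝ≥0) : ℝ) := by
    intro a b hb
    have h1 : r (a / b) ^ b = r 1 ^ a := by
      rw [← hpow, ← hpow]; congr 1; field_simp
    have h2 : ((a / b : ℝ≥0) : ℝ) = (a : ℝ) * (b : ℝ)⁻¹ := by push_cast; rw [div_eq_mul_inv]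
    rw [h2, Real.rpow_mul hr1.le, Real.rpow_natCast, ← h1,
      Real.pow_rpow_inv_natCast (h0 _) hb.ne']
  -- Rational times `⌊tk⌋ / k` approximate `t`, and both sides are continuous.
  have hl : Tendsto (fun k : ℕ => ((⌊(t : ℝ) * k⌋₊ : ℝ≥0) / (k : ℝ≥0))) atTop (𝓝 t) := by
    rw [← NNReal.tendsto_coe]
    push_cast
    exact (tendsto_nat_floor_mul_div_atTop t.2).comp (tendsto_natCast_atTop_atTop (R := ℝ))
  have hc2 : Continuous fun s : ℝ≥0 => r 1 ^ (s : ℝ) :=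
    continuous_const.rpow (by fun_prop) fun _ => Or.inl hr1.ne'
  refine tendsto_nhds_unique ((hc.tendsto t).comp hl)
    (((hc2.tendsto t).comp hl).congr' ?_)
  filter_upwards [eventually_gt_atTop 0] with k hk
  exact (hrat _ _ hk).symm

variable {ℓ : Measure (EuclideanSpace ℝ (Fin n))} {γ : EuclideanSpace ℝ (Fin n)}

/-- At fixed `u` the characteristic function is real by symmetry, multiplicative and continuous in
`t`, and nonnegative as the square of its value at `t / 2`. It is thus a power of its value at time
`1`, whose modulus the triplet gives. -/
lemma IsLevyProcess.charFun_eq_re [IsProbabilityMeasure P] (hZ : IsLevyProcess P Z)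
    (hs : IsSymmetricProcess P Z) (h : HasGeneratingTriplet P Z 0 ℓ γ) (t : ℝ≥0)
    (u : EuclideanSpace ℝ (Fin n)) :
    charFun (P.map (Z t)) u = (Real.exp (t * (levyExponent ℓ γ u).re) : ℝ) := by
  set r : ℝ≥0 → ℝ := fun t => (charFun (P.map (Z t)) u).re with hr
  have hcr : ∀ t, charFun (P.map (Z t)) u = (r t : ℂ) := fun t =>
    Complex.ext (by simp [hr]) (by simpa using hZ.charFun_im hs t u)
  have hm : ∀ s t, r (s + t) = r s * r t := by
    intro s t
    have := hZ.charFun_add s t u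
    rw [hcr, hcr, hcr] at this
    exact_mod_cast this
  have h0 : ∀ t, 0 ≤ r t := fun t => by
    rw [← add_halves t, hm]; exact mul_self_nonneg _
  have hc : Continuous r := by
    simp_rw [hr, hZ.charFun_re_eq u]
    exact hZ.continuous_integral (by fun_prop) (fun z => Real.abs_cos_le_one _)
  have hr0 : r 0 = 1 := by simp [hr, hZ.map_zero, charFun_dirac]
  have hr1 : r 1 = Real.exp (levyExponent ℓ γ u).re := by
    have h1 := congrArg norm (h.charFun_eq_exp u)
    rw [hcr, Complex.norm_exp, Complex.norm_real, Real.norm_of_nonneg (h0 1)] at h1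
    exact h1
  rw [hcr, NNReal.eq_rpow_of_continuous_of_mul hc h0 hr0 (hr1 ▸ Real.exp_pos _) hm t, hr1,
    ← Real.exp_mul, mul_comm]

/-- `exp ψ` is positive, so `Im ψ / (2π)` is integer-valued. It is also continuous on a connected
space and vanishes at `0`. -/
lemma IsLevyProcess.levyExponent_im [IsProbabilityMeasure P] (hZ : IsLevyProcess P Z)
    (hs : IsSymmetricProcess P Z) (h : HasGeneratingTriplet P Z 0 ℓ γ)
    (u : EuclideanSpace ℝ (Fin n)) : (levyExponent ℓ γ u).im = 0 := by
  have hint : ∀ v, ∃ k : ℤ, (levyExponent ℓ γ v).im / (2 * Real.pi) = k := by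
    intro v
    have h1 := h.charFun_eq_exp v
    rw [hZ.charFun_eq_re hs h 1 v] at h1
    simp only [NNReal.coe_one, one_mul, Complex.ofReal_exp] at h1
    obtain ⟨k, hk⟩ := Complex.exp_eq_exp_iff_exists_int.1 h1
    refine ⟨-k, ?_⟩
    have := congrArg Complex.im hk
    simp at this
    have hp := Real.pi_pos
    field_simp
    push_cast
    linarith
  have hc : Continuous fun v => (levyExponent ℓ γ v).im / (2 * Real.pi) :=
    (Complex.continuous_im.comp (h.isLevyMeasure.continuous_levyExponent γ)).div_const _
  choose k hk using hint
  have hkc : Continuous k := by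
    rw [Int.isClosedEmbedding_coe_real.isEmbedding.continuous_iff]
    exact hc.congr hk
  have h2 : k u = k 0 := PreconnectedSpace.constant inferInstance hkc
  have h3 := hk 0
  rw [levyExponent_zero] at h3
  have h4 := hk u
  rw [h2, ← h3] at h4
  simpa [Real.pi_ne_zero] using h4

lemma IsLevyProcess.charFun_eq [IsProbabilityMeasure P] (hZ : IsLevyProcess P Z)
    (hs : IsSymmetricProcess P Z) (h : HasGeneratingTriplet P Z 0 ℓ γ) (t : ℝ≥0)
    (u : EuclideanSpace ℝ (Fin n)) :
    charFun (P.map (Z t)) u = Complex.exp (t * levyExponent ℓ γ u) := by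
  rw [hZ.charFun_eq_re hs h, Complex.ofReal_exp]
  congr 1
  conv_rhs => rw [← Complex.re_add_im (levyExponent ℓ γ u), hZ.levyExponent_im hs h]
  simp

end process

/-! ### Continuity theorem without normalization -/

/-- Lévy's continuity theorem for finite measures. -/
lemma FiniteMeasure.tendsto_of_tendsto_charFun {E : Type*} [NormedAddCommGroup E]
    [InnerProductSpace ℝ E] [FiniteDimensional ℝ E] [MeasurableSpace E] [BorelSpace E]
    {μs : ℕ → FiniteMeasure E} {μ : FiniteMeasure E}
    (h : ∀ u, Tendsto (fun k => charFun (μs k : Measure E) u) atTop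
      (𝓝 (charFun (μ : Measure E) u))) :
    Tendsto μs atTop (𝓝 μ) := by
  have hmass : Tendsto (fun k => (μs k).mass) atTop (𝓝 μ.mass) := by
    have h0 := (Complex.continuous_re.tendsto _).comp (h 0)
    simp only [charFun_zero, Complex.ofReal_re, Function.comp_def] at h0
    rw [← NNReal.tendsto_coe]
    exact h0
  -- A zero limit cannot be normalized; there, convergence of the masses (the value at frequency
  -- `0`) is enough.
  by_cases hμ : μ = 0
  · subst hμ
    exact FiniteMeasure.tendsto_zero_of_tendsto_zero_mass (by simpa using hmass)
  refine FiniteMeasure.tendsto_of_tendsto_normalize_testAgainstNN_of_tendsto_mass ?_ hmass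
  refine ProbabilityMeasure.tendsto_of_tendsto_charFun fun u => ?_
  have hm0 : μ.mass ≠ 0 := by rwa [Ne, FiniteMeasure.mass_zero_iff]
  have key : ∀ ν : FiniteMeasure E, ν ≠ 0 →
      charFun (ν.normalize : Measure E) u = ((ν.mass : ℝ) : ℂ)⁻¹ * charFun (ν : Measure E) u := by
    intro ν hν
    rw [FiniteMeasure.toMeasure_normalize_eq_of_nonzero ν hν, charFun_apply, charFun_apply]
    rw [integral_smul_nnreal_measure, NNReal.smul_def, Complex.real_smul]
    simp
  rw [key μ hμ]
  have hc : Tendsto (fun k => (((μs k).mass : ℝ) : ℂ)⁻¹ * charFun (μs k : Measure E) u) atTop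
      (𝓝 (((μ.mass : ℝ) : ℂ)⁻¹ * charFun (μ : Measure E) u)) := by
    refine Tendsto.mul (Tendsto.inv₀ ?_ (by exact_mod_cast hm0)) (h u)
    exact (Complex.continuous_ofReal.tendsto _).comp (NNReal.tendsto_coe.2 hmass)
  refine hc.congr' ?_
  filter_upwards [hmass.eventually_ne hm0] with k hk
  rw [key _ (by rwa [Ne, ← FiniteMeasure.mass_zero_iff])]

/-! ### Fourier transform of weighted measures -/

section weighted

variable {n : ℕ}

/-- The measure `(1 - exp(-|y|²/2)) m(dy)`. -/
def weightedMeasure (m : Measure (EuclideanSpace ℝ (Fin n))) :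
    Measure (EuclideanSpace ℝ (Fin n)) :=
  m.withDensity fun y => ENNReal.ofReal (gaussWeight y)

lemma integral_weightedMeasure {F : Type*} [NormedAddCommGroup F] [NormedSpace ℝ F]
    (m : Measure (EuclideanSpace ℝ (Fin n))) (k : EuclideanSpace ℝ (Fin n) → F) :
    ∫ y, k y ∂(weightedMeasure m) = ∫ y, gaussWeight y • k y ∂m := by
  unfold weightedMeasure
  rw [integral_withDensity_eq_integral_toReal_smul (by fun_prop)
    (.of_forall fun _ => ENNReal.ofReal_lt_top)]
  simp_rw [ENNReal.toReal_ofReal (gaussWeight_nonneg _)]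

lemma isFiniteMeasure_weightedMeasure {m : Measure (EuclideanSpace ℝ (Fin n))}
    (h : Integrable gaussWeight m) : IsFiniteMeasure (weightedMeasure m) :=
  isFiniteMeasure_withDensity_ofReal h.2

lemma integrable_gaussWeight_of_isFiniteMeasure (m : Measure (EuclideanSpace ℝ (Fin n)))
    [IsFiniteMeasure m] : Integrable gaussWeight m :=
  Integrable.of_bound (by fun_prop) 1 (.of_forall fun y => by
    rw [Real.norm_of_nonneg (gaussWeight_nonneg y)]; exact gaussWeight_le_one y)

lemma one_sub_cos_le_gaussWeight (h y : EuclideanSpace ℝ (Fin n)) :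
    1 - Real.cos (inner ℝ h y) ≤ (3 * ‖h‖ ^ 2 + 6) * gaussWeight y := by
  have h0 := gaussWeight_nonneg y
  by_cases hy : ‖y‖ ≤ 1
  · have h1 : (inner ℝ h y) ^ 2 ≤ (‖h‖ * ‖y‖) ^ 2 :=
      sq_le_sq.2 ((abs_real_inner_le_norm h y).trans (le_abs_self _))
    have h2 := sq_le_gaussWeight hy
    have h3 : ‖h‖ ^ 2 * ‖y‖ ^ 2 ≤ ‖h‖ ^ 2 * (3 * gaussWeight y) := by gcongr
    have h4 := Real.one_sub_sq_div_two_le_cos (x := inner ℝ h y)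
    nlinarith
  · have h2 := one_le_gaussWeight (not_le.1 hy).le
    have h4 := Real.neg_one_le_cos (inner ℝ h y)
    have : 0 ≤ 3 * ‖h‖ ^ 2 * gaussWeight y := by positivity
    nlinarith

lemma integrable_sq_norm_stdGaussian :
    Integrable (fun h => ‖h‖ ^ 2) (stdGaussian (EuclideanSpace ℝ (Fin n))) :=
  (IsGaussian.memLp_two_id (μ := stdGaussian (EuclideanSpace ℝ (Fin n)))).integrable_norm_pow
    two_ne_zero

/-- This dictates the exact form of the weight: the Gaussian average of the cosine is the real part
of the Gaussian characteristic function. -/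
lemma integral_one_sub_cos_stdGaussian (y : EuclideanSpace ℝ (Fin n)) :
    ∫ h, (1 - Real.cos (inner ℝ h y)) ∂(stdGaussian (EuclideanSpace ℝ (Fin n))) =
      gaussWeight y := by
  have hc : Integrable (fun h => Real.cos (inner ℝ h y))
      (stdGaussian (EuclideanSpace ℝ (Fin n))) :=
    Integrable.of_bound (by fun_prop) 1 (.of_forall fun h => Real.abs_cos_le_one _)
  have h1 : ∫ h, Real.cos (inner ℝ h y) ∂(stdGaussian (EuclideanSpace ℝ (Fin n))) =
      Real.exp (-(‖y‖ ^ 2 / 2)) := by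
    have h2 := congrArg Complex.re (charFun_stdGaussian y)
    rw [charFun_apply, ← Complex.reCLM_apply, ← ContinuousLinearMap.integral_comp_comm] at h2
    · simp only [Complex.reCLM_apply, Complex.exp_ofReal_mul_I_re] at h2
      rw [h2, ← Complex.exp_ofReal_re]
      push_cast
      ring_nf
    · refine Integrable.of_bound (by fun_prop) 1 (.of_forall fun z => ?_)
      rw [Complex.norm_exp_ofReal_mul_I]
  rw [integral_sub (integrable_const _) hc, h1]
  simp [gaussWeight]

/-- The characteristic function of `weightedMeasure m` as a Gaussian average. -/
lemma charFun_weightedMeasure {m : Measure (EuclideanSpace ℝ (Fin n))} [SigmaFinite m]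
    (hm : Integrable gaussWeight m) (u : EuclideanSpace ℝ (Fin n)) :
    charFun (weightedMeasure m) u = ∫ h, ∫ y,
      Complex.exp (Complex.I * (inner ℝ u y : ℝ)) * (1 - Real.cos (inner ℝ h y)) ∂m
        ∂(stdGaussian (EuclideanSpace ℝ (Fin n))) := by
  -- Fubini is justified by the majorant `(3‖h‖² + 6) w(y)`, since the Gaussian has a second moment.
  rw [integral_integral_swap]
  · rw [charFun_apply, integral_weightedMeasure]
    congr 1
    ext y
    rw [integral_const_mul]
    have : ∫ h, (1 - (Real.cos (inner ℝ h y) : ℂ)) ∂(stdGaussian (EuclideanSpace ℝ (Fin n)))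
        = (gaussWeight y : ℂ) := by
      rw [← integral_one_sub_cos_stdGaussian, ← integral_complex_ofReal]
      congr 1; ext h; push_cast; rfl
    rw [this, Complex.real_smul, mul_comm, mul_comm Complex.I, real_inner_comm]
  · have hb : Integrable (fun p : EuclideanSpace ℝ (Fin n) × EuclideanSpace ℝ (Fin n) =>
        (3 * ‖p.1‖ ^ 2 + 6) * gaussWeight p.2)
        ((stdGaussian (EuclideanSpace ℝ (Fin n))).prod m) :=
      ((integrable_sq_norm_stdGaussian.const_mul 3).add (integrable_const 6)).mul_prod hm
    refine hb.mono' (by fun_prop) (.of_forall fun p => ?_)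
    simp only [Function.uncurry]
    have h1 : 0 ≤ 1 - Real.cos (inner ℝ p.1 p.2) := by linarith [Real.cos_le_one (inner ℝ p.1 p.2)]
    rw [norm_mul, mul_comm Complex.I, Complex.norm_exp_ofReal_mul_I, one_mul]
    have h2 : (1 - (Real.cos (inner ℝ p.1 p.2) : ℂ)) = ((1 - Real.cos (inner ℝ p.1 p.2) : ℝ) : ℂ) := by
      push_cast; rfl
    rw [h2, Complex.norm_real, Real.norm_of_nonneg h1]
    exact one_sub_cos_le_gaussWeight _ _

/-- Counterpart for finite measures of `IsLevyMeasure.levyExponent_sub_half`, with the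
characteristic function in place of the exponent. -/
lemma integral_exp_mul_one_sub_cos {m : Measure (EuclideanSpace ℝ (Fin n))} [IsFiniteMeasure m]
    (u h : EuclideanSpace ℝ (Fin n)) :
    ∫ y, Complex.exp (Complex.I * (inner ℝ u y : ℝ)) * (1 - Real.cos (inner ℝ h y)) ∂m =
      charFun m u - (1 / 2) * (charFun m (u + h) + charFun m (u - h)) := by
  have hi : ∀ v : EuclideanSpace ℝ (Fin n),
      Integrable (fun y => Complex.exp ((inner ℝ y v : ℝ) * Complex.I)) m := fun v =>
    Integrable.of_bound (by fun_prop) 1 (.of_forall fun z => by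
      rw [Complex.norm_exp_ofReal_mul_I])
  have i23 : Integrable (fun y => Complex.exp ((inner ℝ y (u + h) : ℝ) * Complex.I) +
    Complex.exp ((inner ℝ y (u - h) : ℝ) * Complex.I)) m := (hi _).add (hi _)
  simp_rw [charFun_apply]
  rw [← integral_add (hi _) (hi _), ← integral_const_mul, ← integral_sub (hi u) (i23.const_mul _)]
  congr 1
  ext y
  have h1 : (Real.cos (inner ℝ h y) : ℂ) = (Complex.exp (Complex.I * (inner ℝ h y : ℝ))
      + Complex.exp (-(Complex.I * (inner ℝ h y : ℝ)))) / 2 := by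
    rw [Complex.ofReal_cos, Complex.cos]
    ring_nf
  have h2 : Complex.exp ((inner ℝ y (u + h) : ℝ) * Complex.I) =
      Complex.exp (Complex.I * (inner ℝ u y : ℝ)) * Complex.exp (Complex.I * (inner ℝ h y : ℝ)) := by
    rw [← Complex.exp_add, inner_add_right, real_inner_comm u, real_inner_comm h]
    push_cast; ring_nf
  have h3 : Complex.exp ((inner ℝ y (u - h) : ℝ) * Complex.I) =
      Complex.exp (Complex.I * (inner ℝ u y : ℝ)) *
        Complex.exp (-(Complex.I * (inner ℝ h y : ℝ))) := by
    rw [← Complex.exp_add, inner_sub_right, real_inner_comm u, real_inner_comm h]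
    push_cast; ring_nf
  rw [h1, h2, h3, real_inner_comm, mul_comm (_ : ℂ) Complex.I]
  ring

end weighted

/-! ### Small-time convergence of the weighted laws -/

section smallTime

variable {n : ℕ} {Ω : Type*} [MeasurableSpace Ω] {P : Measure Ω} [IsProbabilityMeasure P]
    {Z : ℝ≥0 → Ω → EuclideanSpace ℝ (Fin n)}
    {ℓ : Measure (EuclideanSpace ℝ (Fin n))} {γ : EuclideanSpace ℝ (Fin n)}

/-- Quadratic growth is integrable against a Gaussian, which is what dominated convergence in the
frequency shift needs. -/
lemma IsLevyMeasure.norm_levyExponent_le (hℓ : IsLevyMeasure ℓ)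
    (γ : EuclideanSpace ℝ (Fin n)) :
    ∃ A : ℝ, 0 ≤ A ∧ ∀ u, ‖levyExponent ℓ γ u‖ ≤ A * (1 + ‖u‖ ^ 2) := by
  have hI : 0 ≤ ∫ y, gaussWeight y ∂ℓ := integral_nonneg gaussWeight_nonneg
  refine ⟨‖γ‖ + 9 * ∫ y, gaussWeight y ∂ℓ, by positivity, fun u => ?_⟩
  have h1 : ‖∫ y, levyIntegrand u y ∂ℓ‖ ≤ (9 * ‖u‖ ^ 2 + 6) * ∫ y, gaussWeight y ∂ℓ := by
    rw [← integral_const_mul]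
    exact norm_integral_le_of_norm_le (hℓ.integrable_gaussWeight.const_mul _)
      (.of_forall (norm_levyIntegrand_le u))
  have h2 : ‖Complex.I * ((inner ℝ γ u : ℝ) : ℂ)‖ ≤ ‖γ‖ * ‖u‖ := by
    simpa using abs_real_inner_le_norm γ u
  have h3 := norm_add_le (Complex.I * ((inner ℝ γ u : ℝ) : ℂ)) (∫ y, levyIntegrand u y ∂ℓ)
  have h4 : ‖γ‖ * ‖u‖ ≤ ‖γ‖ * (1 + ‖u‖ ^ 2) := by
    gcongr; nlinarith [sq_nonneg (‖u‖ - 1)]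
  unfold levyExponent
  nlinarith

/-- A characteristic function is bounded by `1`, so the real number `x = tψ` is nonpositive, and
then `1 - exp x ≤ -x`. -/
lemma IsLevyProcess.norm_charFun_sub_one_le (hZ : IsLevyProcess P Z)
    (hs : IsSymmetricProcess P Z) (h : HasGeneratingTriplet P Z 0 ℓ γ) (t : ℝ≥0)
    (u : EuclideanSpace ℝ (Fin n)) :
    ‖charFun (P.map (Z t)) u - 1‖ ≤ t * ‖levyExponent ℓ γ u‖ := by
  have := hZ.isProbabilityMeasure_map t
  have h1 := norm_charFun_le_one (μ := P.map (Z t)) u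
  rw [hZ.charFun_eq_re hs h] at h1 ⊢
  set x := (t : ℝ) * (levyExponent ℓ γ u).re with hx
  rw [Complex.norm_real, Real.norm_of_nonneg (Real.exp_pos _).le] at h1
  have h2 : ((Real.exp x : ℝ) : ℂ) - 1 = ((Real.exp x - 1 : ℝ) : ℂ) := by push_cast; rfl
  rw [h2, Complex.norm_real, Real.norm_of_nonpos (by linarith)]
  have h3 := Real.add_one_le_exp x
  have h4 : -(levyExponent ℓ γ u).re ≤ ‖levyExponent ℓ γ u‖ :=
    (neg_le_abs _).trans (Complex.abs_re_le_norm _)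
  have h5 : (t : ℝ) * -(levyExponent ℓ γ u).re ≤ t * ‖levyExponent ℓ γ u‖ := by gcongr
  linarith

lemma IsLevyProcess.tendsto_charFun_sub_one (hZ : IsLevyProcess P Z)
    (hs : IsSymmetricProcess P Z) (h : HasGeneratingTriplet P Z 0 ℓ γ)
    (u : EuclideanSpace ℝ (Fin n)) :
    Tendsto (fun t : ℝ≥0 => ((t : ℝ) : ℂ)⁻¹ * (charFun (P.map (Z t)) u - 1)) (𝓝[>] 0)
      (𝓝 (levyExponent ℓ γ u)) := by
  have hd : HasDerivAt (fun s : ℝ => Complex.exp (s * levyExponent ℓ γ u))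
      (levyExponent ℓ γ u) 0 := by
    have h1 : HasDerivAt (fun s : ℝ => (s : ℂ) * levyExponent ℓ γ u) (levyExponent ℓ γ u) 0 := by
      simpa using (Complex.ofRealCLM.hasDerivAt (x := (0 : ℝ))).mul_const (levyExponent ℓ γ u)
    simpa using h1.cexp
  have h2 := hd.tendsto_slope_zero_right
  have h3 : Tendsto (fun t : ℝ≥0 => (t : ℝ)) (𝓝[>] 0) (𝓝[>] 0) := by
    refine tendsto_nhdsWithin_iff.2 ⟨?_, ?_⟩
    · exact (NNReal.continuous_coe.tendsto' 0 0 rfl).mono_left nhdsWithin_le_nhds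
    · filter_upwards [self_mem_nhdsWithin] with t ht
      exact NNReal.coe_pos.2 ht
  refine (h2.comp h3).congr fun t => ?_
  simp [hZ.charFun_eq hs h t u]

/-- The rescaled laws converge weakly to the Lévy measure, after weighting. -/
lemma IsLevyProcess.tendsto_charFun_weightedMeasure (hZ : IsLevyProcess P Z)
    (hs : IsSymmetricProcess P Z) (h : HasGeneratingTriplet P Z 0 ℓ γ)
    (u : EuclideanSpace ℝ (Fin n)) :
    Tendsto (fun t : ℝ≥0 => ((t : ℝ) : ℂ)⁻¹ * charFun (weightedMeasure (P.map (Z t))) u) (𝓝[>] 0)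
      (𝓝 (charFun (weightedMeasure ℓ) u)) := by
  have hℓ := h.isLevyMeasure
  have := hℓ.sigmaFinite
  have e1 : ∀ t : ℝ≥0, ((t : ℝ) : ℂ)⁻¹ * charFun (weightedMeasure (P.map (Z t))) u =
      ∫ w, ((t : ℝ) : ℂ)⁻¹ * (charFun (P.map (Z t)) u - (1 / 2) * (charFun (P.map (Z t)) (u + w)
        + charFun (P.map (Z t)) (u - w))) ∂(stdGaussian (EuclideanSpace ℝ (Fin n))) := by
    intro t
    have := hZ.isProbabilityMeasure_map t
    rw [charFun_weightedMeasure (integrable_gaussWeight_of_isFiniteMeasure _), integral_const_mul]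
    simp_rw [integral_exp_mul_one_sub_cos]
  simp_rw [e1]
  rw [charFun_weightedMeasure hℓ.integrable_gaussWeight]
  simp_rw [← hℓ.levyExponent_sub_half γ u]
  obtain ⟨A, hA, hΨ⟩ := hℓ.norm_levyExponent_le γ
  refine tendsto_integral_filter_of_dominated_convergence
    (fun w => A * (2 + 3 * ‖u‖ ^ 2 + 2 * ‖w‖ ^ 2)) ?_ ?_ ?_ ?_
  · refine .of_forall fun t => Measurable.aestronglyMeasurable ?_
    have := hZ.isProbabilityMeasure_map t
    fun_prop
  · filter_upwards [self_mem_nhdsWithin] with t ht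
    refine .of_forall fun w => ?_
    have ht' : (0 : ℝ) < t := NNReal.coe_pos.2 ht
    have b : ∀ v, ‖((t : ℝ) : ℂ)⁻¹ * (charFun (P.map (Z t)) v - 1)‖ ≤ A * (1 + ‖v‖ ^ 2) := by
      intro v
      rw [norm_mul, norm_inv, Complex.norm_real, Real.norm_of_nonneg ht'.le]
      refine le_trans ?_ (hΨ v)
      rw [inv_mul_le_iff₀ ht']
      exact hZ.norm_charFun_sub_one_le hs h t v
    -- The constants cancel because `1 - (1 + 1) / 2 = 0`; each difference quotient is then bounded
    -- uniformly in `t`.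
    have e2 : ((t : ℝ) : ℂ)⁻¹ * (charFun (P.map (Z t)) u - (1 / 2) * (charFun (P.map (Z t)) (u + w)
        + charFun (P.map (Z t)) (u - w))) =
        ((t : ℝ) : ℂ)⁻¹ * (charFun (P.map (Z t)) u - 1) -
        (1 / 2) * (((t : ℝ) : ℂ)⁻¹ * (charFun (P.map (Z t)) (u + w) - 1) +
          ((t : ℝ) : ℂ)⁻¹ * (charFun (P.map (Z t)) (u - w) - 1)) := by ring
    rw [e2]
    refine (norm_sub_le _ _).trans ?_
    rw [norm_mul (1 / 2 : ℂ)]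
    have n1 := b u
    have n2 := b (u + w)
    have n3 := b (u - w)
    have n4 := norm_add_le (((t : ℝ) : ℂ)⁻¹ * (charFun (P.map (Z t)) (u + w) - 1))
      (((t : ℝ) : ℂ)⁻¹ * (charFun (P.map (Z t)) (u - w) - 1))
    have n5 : ‖(1 / 2 : ℂ)‖ = 1 / 2 := by norm_num
    -- The parallelogram law bounds the two shifted terms together.
    have n6 : ‖u + w‖ ^ 2 + ‖u - w‖ ^ 2 = 2 * (‖u‖ ^ 2 + ‖w‖ ^ 2) := by
      have := parallelogram_law_with_norm ℝ u w
      nlinarith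
    have n7 : ‖u + w‖ ^ 2 + ‖u - w‖ ^ 2 ≤ 4 * ‖u‖ ^ 2 + 4 * ‖w‖ ^ 2 := by
      nlinarith [sq_nonneg ‖u‖, sq_nonneg ‖w‖]
    have n8 := mul_le_mul_of_nonneg_left n7 hA
    rw [n5]
    nlinarith
  · exact ((integrable_const _).add (integrable_sq_norm_stdGaussian.const_mul 2)).const_mul A
  · refine .of_forall fun w => ?_
    have e2 : ∀ t : ℝ≥0, ((t : ℝ) : ℂ)⁻¹ * (charFun (P.map (Z t)) u - (1 / 2) *
        (charFun (P.map (Z t)) (u + w) + charFun (P.map (Z t)) (u - w))) =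
        ((t : ℝ) : ℂ)⁻¹ * (charFun (P.map (Z t)) u - 1) -
        (1 / 2) * (((t : ℝ) : ℂ)⁻¹ * (charFun (P.map (Z t)) (u + w) - 1) +
          ((t : ℝ) : ℂ)⁻¹ * (charFun (P.map (Z t)) (u - w) - 1)) := fun t => by ring
    simp_rw [e2]
    exact (hZ.tendsto_charFun_sub_one hs h u).sub
      (((hZ.tendsto_charFun_sub_one hs h _).add (hZ.tendsto_charFun_sub_one hs h _)).const_mul _)

/-- Weak convergence of the finite measures `t⁻¹ w · law(Z_t)`, read off from their Fourier
transforms. It is taken along sequences, the form of the continuity theorem used here. -/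
lemma IsLevyProcess.tendsto_integral_gaussWeight_mul (hZ : IsLevyProcess P Z)
    (hs : IsSymmetricProcess P Z) (h : HasGeneratingTriplet P Z 0 ℓ γ)
    {k : EuclideanSpace ℝ (Fin n) → ℝ} (hk : Continuous k) {C : ℝ} (hC : ∀ y, |k y| ≤ C) :
    Tendsto (fun t : ℝ≥0 => (t : ℝ)⁻¹ * ∫ z, gaussWeight z * k z ∂(P.map (Z t))) (𝓝[>] 0)
      (𝓝 (∫ y, gaussWeight y * k y ∂ℓ)) := by
  have hℓ := h.isLevyMeasure
  have hfin := isFiniteMeasure_weightedMeasure hℓ.integrable_gaussWeight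
  refine tendsto_of_seq_tendsto fun x hx => ?_
  have hfin' : ∀ t, IsFiniteMeasure (weightedMeasure (P.map (Z t))) := fun t => by
    have := hZ.isProbabilityMeasure_map t
    exact isFiniteMeasure_weightedMeasure (integrable_gaussWeight_of_isFiniteMeasure _)
  let ν : ℝ≥0 → FiniteMeasure (EuclideanSpace ℝ (Fin n)) := fun t =>
    ⟨weightedMeasure (P.map (Z t)), hfin' t⟩
  let μs : ℕ → FiniteMeasure (EuclideanSpace ℝ (Fin n)) := fun j => (x j)⁻¹ • ν (x j)
  have hμs : ∀ j, (μs j : Measure (EuclideanSpace ℝ (Fin n))) =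
      (x j)⁻¹ • weightedMeasure (P.map (Z (x j))) := fun j => rfl
  let μ : FiniteMeasure (EuclideanSpace ℝ (Fin n)) := ⟨weightedMeasure ℓ, hfin⟩
  have hconv : Tendsto μs atTop (𝓝 μ) := by
    refine FiniteMeasure.tendsto_of_tendsto_charFun fun u => ?_
    refine ((hZ.tendsto_charFun_weightedMeasure hs h u).comp hx).congr fun j => ?_
    simp only [Function.comp_apply, charFun_apply]
    rw [hμs, integral_smul_nnreal_measure, NNReal.smul_def, Complex.real_smul]
    simp
  have h2 := FiniteMeasure.tendsto_iff_forall_integral_tendsto.1 hconv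
    (BoundedContinuousFunction.ofNormedAddCommGroup k hk C hC)
  simp only [BoundedContinuousFunction.coe_ofNormedAddCommGroup] at h2
  have h3 : ∫ y, k y ∂(μ : Measure _) = ∫ y, gaussWeight y * k y ∂ℓ :=
    integral_weightedMeasure ℓ k
  rw [h3] at h2
  refine h2.congr fun j => ?_
  rw [hμs, integral_smul_nnreal_measure, integral_weightedMeasure]
  rfl

end smallTime

/-! ### Symmetry of the Lévy measure -/

section symmetric

variable {n : ℕ} {Ω : Type*} [MeasurableSpace Ω] {P : Measure Ω} [IsProbabilityMeasure P]
    {Z : ℝ≥0 → Ω → EuclideanSpace ℝ (Fin n)}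
    {ℓ : Measure (EuclideanSpace ℝ (Fin n))} {γ : EuclideanSpace ℝ (Fin n)}

/-- The Fourier transform of `w ℓ` is an average of second differences of a real exponent, hence
real, and a finite measure with real Fourier transform is even. -/
lemma IsLevyProcess.map_neg_weightedMeasure (hZ : IsLevyProcess P Z)
    (hs : IsSymmetricProcess P Z) (h : HasGeneratingTriplet P Z 0 ℓ γ) :
    (weightedMeasure ℓ).map (fun y => -y) = weightedMeasure ℓ := by
  have hℓ := h.isLevyMeasure
  have := hℓ.sigmaFinite
  have hfin := isFiniteMeasure_weightedMeasure hℓ.integrable_gaussWeight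
  refine Measure.ext_of_charFun (funext fun u => ?_)
  have h1 : charFun ((weightedMeasure ℓ).map (fun y => -y)) u = charFun (weightedMeasure ℓ) (-u) := by
    rw [charFun_apply, integral_map (by fun_prop) (by fun_prop)]
    simp [charFun_apply]
  rw [h1, charFun_neg, Complex.conj_eq_iff_im]
  have hr : ∀ v, levyExponent ℓ γ v = ((levyExponent ℓ γ v).re : ℂ) := fun v =>
    Complex.ext rfl (by simpa using hZ.levyExponent_im hs h v)
  rw [charFun_weightedMeasure hℓ.integrable_gaussWeight]
  simp_rw [← hℓ.levyExponent_sub_half γ u]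
  have : ∀ w, levyExponent ℓ γ u - 1 / 2 * (levyExponent ℓ γ (u + w) + levyExponent ℓ γ (u - w)) =
      (((levyExponent ℓ γ u).re - 1 / 2 * ((levyExponent ℓ γ (u + w)).re +
        (levyExponent ℓ γ (u - w)).re) : ℝ) : ℂ) := by
    intro w
    rw [hr u, hr (u + w), hr (u - w)]; push_cast; simp
  simp_rw [this]
  rw [integral_complex_ofReal, Complex.ofReal_im]

lemma IsLevyMeasure.withDensity_inv_weightedMeasure (hℓ : IsLevyMeasure ℓ) :
    (weightedMeasure ℓ).withDensity (fun y => (ENNReal.ofReal (gaussWeight y))⁻¹) = ℓ := by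
  unfold weightedMeasure
  rw [withDensity_inv_same₀ (by fun_prop)]
  · filter_upwards [hℓ.ae_gaussWeight_pos] with y hy
    simpa using hy
  · exact .of_forall fun y => ENNReal.ofReal_ne_top

/-- The Lévy measure of a symmetric process is symmetric. -/
lemma IsLevyProcess.measurePreserving_neg (hZ : IsLevyProcess P Z)
    (hs : IsSymmetricProcess P Z) (h : HasGeneratingTriplet P Z 0 ℓ γ) :
    MeasurePreserving (fun y => -y) ℓ ℓ := by
  refine ⟨measurable_neg, ?_⟩
  have hℓ := h.isLevyMeasure
  have hw := hZ.map_neg_weightedMeasure hs h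
  ext B hB
  rw [Measure.map_apply measurable_neg hB]
  -- Dividing by the even weight transfers the symmetry from `w ℓ` to `ℓ`.
  conv_lhs => rw [← hℓ.withDensity_inv_weightedMeasure]
  conv_rhs => rw [← hℓ.withDensity_inv_weightedMeasure]
  rw [withDensity_apply _ (measurable_neg hB), withDensity_apply _ hB]
  conv_rhs => rw [← hw]
  rw [setLIntegral_map hB (by fun_prop) measurable_neg]
  simp

end symmetric

/-! ### From weighted weak convergence to energy-controlled integrands -/

section vague

variable {n : ℕ}

/-- `|F| ≤ √(w G) ≤ w + G`. -/
lemma integrable_of_sq_le_gaussWeight_mul {m : Measure (EuclideanSpace ℝ (Fin n))}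
    (hW : Integrable gaussWeight m) {F G : EuclideanSpace ℝ (Fin n) → ℝ}
    (hF : AEStronglyMeasurable F m) (hG : Integrable G m) (hG0 : ∀ y, 0 ≤ G y)
    (h : ∀ y, F y ^ 2 ≤ gaussWeight y * G y) : Integrable F m := by
  refine (hW.add hG).mono' hF (.of_forall fun y => ?_)
  have h0 := gaussWeight_nonneg y
  have h1 := h y
  simp only [Pi.add_apply]
  have h2 : 0 ≤ gaussWeight y + G y := by linarith [hG0 y]
  exact abs_le_of_sq_le_sq (by nlinarith [hG0 y, mul_nonneg h0 (hG0 y)]) h2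

/-- Removing the vicinity of the origin changes the integral of `F` little. -/
lemma abs_integral_sub_cutoff_le {m : Measure (EuclideanSpace ℝ (Fin n))}
    (hW : Integrable gaussWeight m) {F G : EuclideanSpace ℝ (Fin n) → ℝ}
    (hF : Continuous F) (hG : Integrable G m) (hG0 : ∀ y, 0 ≤ G y)
    (h : ∀ y, F y ^ 2 ≤ gaussWeight y * G y) {ε κ : ℝ} (hε : 0 < ε) (hκ : 0 < κ) :
    |∫ y, F y ∂m - ∫ y, gaussWeight y * (F y / (gaussWeight y + ε)) ∂m| ≤
      κ * ∫ y, G y ∂m + κ⁻¹ * ∫ y, gaussWeight y * (ε / (gaussWeight y + ε)) ∂m := by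
  have hpos : ∀ y : EuclideanSpace ℝ (Fin n), 0 < gaussWeight y + ε := fun y => by
    have := gaussWeight_nonneg y; linarith
  have hFi := integrable_of_sq_le_gaussWeight_mul hW hF.aestronglyMeasurable hG hG0 h
  have hcont : Continuous fun y : EuclideanSpace ℝ (Fin n) => gaussWeight y / (gaussWeight y + ε) :=
    (by fun_prop : Continuous _).div (by fun_prop) fun y => (hpos y).ne'
  have hcont2 : Continuous fun y : EuclideanSpace ℝ (Fin n) => ε / (gaussWeight y + ε) :=
    (by fun_prop : Continuous _).div (by fun_prop) fun y => (hpos y).ne'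
  have hi1 : Integrable (fun y => gaussWeight y * (F y / (gaussWeight y + ε))) m := by
    refine hFi.norm.mono' ?_ (.of_forall fun y => ?_)
    · have : Continuous fun y => gaussWeight y / (gaussWeight y + ε) * F y := hcont.mul hF
      refine this.aestronglyMeasurable.congr (.of_forall fun y => ?_)
      simp only; ring
    · have h1 : gaussWeight y * (F y / (gaussWeight y + ε)) =
        gaussWeight y / (gaussWeight y + ε) * F y := by ring
      rw [h1, norm_mul, Real.norm_of_nonneg (div_nonneg (gaussWeight_nonneg y) (hpos y).le)]
      have h2 : gaussWeight y / (gaussWeight y + ε) ≤ 1 := by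
        rw [div_le_one (hpos y)]; linarith
      nlinarith [norm_nonneg (F y)]
  have hi2 : Integrable (fun y => gaussWeight y * (ε / (gaussWeight y + ε))) m := by
    refine hW.mono' (by exact (continuous_gaussWeight.mul hcont2).aestronglyMeasurable)
      (.of_forall fun y => ?_)
    rw [norm_mul, Real.norm_of_nonneg (gaussWeight_nonneg y),
      Real.norm_of_nonneg (div_nonneg hε.le (hpos y).le)]
    have h2 : ε / (gaussWeight y + ε) ≤ 1 := by
      rw [div_le_one (hpos y)]; linarith [gaussWeight_nonneg y]
    nlinarith [gaussWeight_nonneg y]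
  rw [← integral_sub hFi hi1, ← integral_const_mul, ← integral_const_mul,
    ← integral_add (hG.const_mul κ) (hi2.const_mul κ⁻¹), ← Real.norm_eq_abs]
  refine norm_integral_le_of_norm_le ((hG.const_mul κ).add (hi2.const_mul κ⁻¹))
    (.of_forall fun y => ?_)
  set w := gaussWeight y with hw
  have hw0 : 0 ≤ w := gaussWeight_nonneg y
  set q := ε / (w + ε) with hq
  have hq0 : 0 ≤ q := div_nonneg hε.le (hpos y).le
  have hq1 : q ≤ 1 := by rw [hq, div_le_one (hpos y)]; linarith
  have e1 : F y - w * (F y / (w + ε)) = F y * q := by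
    rw [hq]; field_simp [(hpos y).ne']; ring
  rw [e1, Real.norm_eq_abs]
  have hb : 0 ≤ κ * G y + κ⁻¹ * (w * q) := by have := hG0 y; positivity
  refine abs_le_of_sq_le_sq ?_ hb
  have h1 := h y
  -- As `q ≤ 1`, `|F q| ≤ √(G · w q)`. The arithmetic-geometric inequality with parameter `κ` then
  -- separates the energy from the part that is small for small `ε`.
  have h2 : (F y * q) ^ 2 ≤ (w * q) * G y := by
    calc (F y * q) ^ 2 = F y ^ 2 * (q * q) := by ring
      _ ≤ (w * G y) * (q * 1) := by gcongr; exact mul_nonneg hw0 (hG0 y)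
      _ = _ := by ring
  have h3 : (κ * G y) * (κ⁻¹ * (w * q)) = (w * q) * G y := by field_simp
  have h4 : 0 ≤ κ * G y := mul_nonneg hκ.le (hG0 y)
  have h5 : 0 ≤ κ⁻¹ * (w * q) := by positivity
  nlinarith

/-- Dominated convergence along `ε = 1 / (k + 1)`: the integrand tends to `0` wherever the weight is
positive, that is, off the origin. -/
lemma IsLevyMeasure.exists_cutoff_lt {ℓ : Measure (EuclideanSpace ℝ (Fin n))}
    (hℓ : IsLevyMeasure ℓ) {δ : ℝ} (hδ : 0 < δ) :
    ∃ ε > 0, ∫ y, gaussWeight y * (ε / (gaussWeight y + ε)) ∂ℓ < δ := by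
  have hpos : ∀ (y : EuclideanSpace ℝ (Fin n)) (k : ℕ), 0 < gaussWeight y + 1 / ((k : ℝ) + 1) :=
    fun y k => by
      have := gaussWeight_nonneg y
      positivity
  have h : Tendsto (fun k : ℕ => ∫ y, gaussWeight y *
      ((1 / ((k : ℝ) + 1)) / (gaussWeight y + 1 / ((k : ℝ) + 1))) ∂ℓ) atTop
      (𝓝 (∫ y, (0 : ℝ) ∂ℓ)) := by
    refine tendsto_integral_of_dominated_convergence gaussWeight (fun k => ?_)
      hℓ.integrable_gaussWeight (fun k => .of_forall fun y => ?_) ?_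
    · have : Continuous fun y : EuclideanSpace ℝ (Fin n) =>
        gaussWeight y * ((1 / ((k : ℝ) + 1)) / (gaussWeight y + 1 / ((k : ℝ) + 1))) :=
        continuous_gaussWeight.mul (continuous_const.div (by fun_prop) fun y => (hpos y k).ne')
      exact this.aestronglyMeasurable
    · rw [norm_mul, Real.norm_of_nonneg (gaussWeight_nonneg y),
        Real.norm_of_nonneg (div_nonneg (by positivity) (hpos y k).le)]
      have h2 : (1 / ((k : ℝ) + 1)) / (gaussWeight y + 1 / ((k : ℝ) + 1)) ≤ 1 := by
        rw [div_le_one (hpos y k)]; linarith [gaussWeight_nonneg y]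
      nlinarith [gaussWeight_nonneg y]
    · filter_upwards [hℓ.ae_gaussWeight_pos] with y hy
      have h1 := tendsto_one_div_add_atTop_nhds_zero_nat (𝕜 := ℝ)
      have h2 := (h1.div (h1.const_add (gaussWeight y)) (by simpa using hy.ne')).const_mul
        (gaussWeight y)
      simpa using h2
  rw [integral_zero] at h
  obtain ⟨k, hk⟩ := (h.eventually (gt_mem_nhds hδ)).exists
  exact ⟨_, by positivity, hk⟩

variable {Ω : Type*} [MeasurableSpace Ω] {P : Measure Ω} [IsProbabilityMeasure P]
    {Z : ℝ≥0 → Ω → EuclideanSpace ℝ (Fin n)}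
    {ℓ : Measure (EuclideanSpace ℝ (Fin n))} {γ : EuclideanSpace ℝ (Fin n)}

lemma continuous_div_gaussWeight_add {G : EuclideanSpace ℝ (Fin n) → ℝ} (hG : Continuous G)
    {ε : ℝ} (hε : 0 < ε) : Continuous fun y => G y / (gaussWeight y + ε) :=
  hG.div (by fun_prop) fun y => by have := gaussWeight_nonneg y; positivity

lemma abs_div_gaussWeight_add_le {G : EuclideanSpace ℝ (Fin n) → ℝ} {B : ℝ}
    (hB : ∀ y, |G y| ≤ B) {ε : ℝ} (hε : 0 < ε) (y : EuclideanSpace ℝ (Fin n)) :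
    |G y / (gaussWeight y + ε)| ≤ B / ε := by
  have h0 := gaussWeight_nonneg y
  have hB0 : 0 ≤ B := (abs_nonneg _).trans (hB y)
  rw [abs_div, abs_of_pos (by positivity : 0 < gaussWeight y + ε)]
  gcongr
  · exact hB y
  · linarith

/-- Energies bounded along the semigroup are finite for the Lévy measure. -/
lemma IsLevyProcess.integrable_of_bounded (hZ : IsLevyProcess P Z)
    (hs : IsSymmetricProcess P Z) (h : HasGeneratingTriplet P Z 0 ℓ γ)
    {G : EuclideanSpace ℝ (Fin n) → ℝ} (hG : Continuous G) (hG0 : ∀ y, 0 ≤ G y)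
    {B : ℝ} (hB : ∀ y, |G y| ≤ B) {C : ℝ}
    (hC : ∀ᶠ t : ℝ≥0 in 𝓝[>] 0, (t : ℝ)⁻¹ * ∫ z, G z ∂(P.map (Z t)) ≤ C) :
    Integrable G ℓ ∧ ∫ y, G y ∂ℓ ≤ C := by
  have hℓ := h.isLevyMeasure
  have hpos : ∀ (y : EuclideanSpace ℝ (Fin n)) (k : ℕ), 0 < gaussWeight y + 1 / ((k : ℝ) + 1) :=
    fun y k => by
      have := gaussWeight_nonneg y
      positivity
  have hC0 : 0 ≤ C := by
    obtain ⟨t, ht⟩ := hC.exists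
    exact le_trans (mul_nonneg (by positivity) (integral_nonneg hG0)) ht
  have hk0 : ∀ (k : ℕ) y, 0 ≤ gaussWeight y * (G y / (gaussWeight y + 1 / ((k : ℝ) + 1))) :=
    fun k y => mul_nonneg (gaussWeight_nonneg y) (div_nonneg (hG0 y) (hpos y k).le)
  have hkle : ∀ (k : ℕ) y, gaussWeight y * (G y / (gaussWeight y + 1 / ((k : ℝ) + 1))) ≤ G y := by
    intro k y
    have h2 : gaussWeight y / (gaussWeight y + 1 / ((k : ℝ) + 1)) ≤ 1 := by
      rw [div_le_one (hpos y k)]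
      have : 0 < 1 / ((k : ℝ) + 1) := by positivity
      linarith
    calc _ = gaussWeight y / (gaussWeight y + 1 / ((k : ℝ) + 1)) * G y := by ring
      _ ≤ 1 * G y := by gcongr; exact hG0 y
      _ = G y := one_mul _
  -- After the cutoff the integrand is the weight times a bounded continuous function, so weak
  -- convergence applies and keeps the bound `C`.
  have hkint : ∀ k : ℕ, ∫ y, gaussWeight y * (G y / (gaussWeight y + 1 / ((k : ℝ) + 1))) ∂ℓ ≤ C := by
    intro k
    have hε : 0 < 1 / ((k : ℝ) + 1) := by positivity
    refine le_of_tendsto (hZ.tendsto_integral_gaussWeight_mul hs h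
      (continuous_div_gaussWeight_add hG hε) (abs_div_gaussWeight_add_le hB hε)) ?_
    filter_upwards [hC] with t ht
    refine le_trans ?_ ht
    have := hZ.isProbabilityMeasure_map t
    have hGt : Integrable G (P.map (Z t)) :=
      Integrable.of_bound hG.aestronglyMeasurable B (.of_forall hB)
    exact mul_le_mul_of_nonneg_left (integral_mono_of_nonneg (.of_forall (hk0 k)) hGt
      (.of_forall (hkle k))) (by positivity)
  have hki : ∀ k : ℕ, Integrable
      (fun y => gaussWeight y * (G y / (gaussWeight y + 1 / ((k : ℝ) + 1)))) ℓ := by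
    intro k
    have hε : 0 < 1 / ((k : ℝ) + 1) := by positivity
    refine hℓ.integrable_of_le (C := B / (1 / ((k : ℝ) + 1)))
      (continuous_gaussWeight.mul (continuous_div_gaussWeight_add hG hε)).aestronglyMeasurable
      fun y => ?_
    rw [norm_mul, Real.norm_of_nonneg (gaussWeight_nonneg y), mul_comm]
    exact mul_le_mul_of_nonneg_right (abs_div_gaussWeight_add_le hB hε y) (gaussWeight_nonneg y)
  have hlim : ∀ᵐ y ∂ℓ, Tendsto (fun k : ℕ =>
      gaussWeight y * (G y / (gaussWeight y + 1 / ((k : ℝ) + 1)))) atTop (𝓝 (G y)) := by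
    filter_upwards [hℓ.ae_gaussWeight_pos] with y hy
    have h1 := tendsto_one_div_add_atTop_nhds_zero_nat (𝕜 := ℝ)
    have h2 := ((tendsto_const_nhds (x := G y)).div (h1.const_add (gaussWeight y))
      (by simpa using hy.ne')).const_mul (gaussWeight y)
    have h3 : gaussWeight y * (G y / (gaussWeight y + 0)) = G y := by
      rw [add_zero]; field_simp
    rwa [h3] at h2
  -- Fatou's lemma removes the cutoff.
  have hle : ∫⁻ y, ENNReal.ofReal (G y) ∂ℓ ≤ ENNReal.ofReal C := by
    calc ∫⁻ y, ENNReal.ofReal (G y) ∂ℓ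
        = ∫⁻ y, liminf (fun k : ℕ => ENNReal.ofReal
            (gaussWeight y * (G y / (gaussWeight y + 1 / ((k : ℝ) + 1))))) atTop ∂ℓ := by
          refine lintegral_congr_ae ?_
          filter_upwards [hlim] with y hy
          exact ((ENNReal.continuous_ofReal.tendsto _).comp hy).liminf_eq.symm
      _ ≤ liminf (fun k : ℕ => ∫⁻ y, ENNReal.ofReal
            (gaussWeight y * (G y / (gaussWeight y + 1 / ((k : ℝ) + 1)))) ∂ℓ) atTop := by
          refine lintegral_liminf_le' fun k => ?_
          exact (hki k).aestronglyMeasurable.aemeasurable.ennreal_ofReal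
      _ ≤ ENNReal.ofReal C := by
          refine liminf_le_of_le (by isBoundedDefault) fun b hb => ?_
          obtain ⟨k, hk⟩ := hb.exists
          refine hk.trans ?_
          rw [← ofReal_integral_eq_lintegral_ofReal (hki k) (.of_forall (hk0 k))]
          exact ENNReal.ofReal_le_ofReal (hkint k)
  have hGi : Integrable G ℓ := by
    refine ⟨hG.aestronglyMeasurable, ?_⟩
    rw [hasFiniteIntegral_iff_ofReal (.of_forall hG0)]
    exact hle.trans_lt ENNReal.ofReal_lt_top
  refine ⟨hGi, ?_⟩
  rw [← ofReal_integral_eq_lintegral_ofReal hGi (.of_forall hG0)] at hle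
  exact (ENNReal.ofReal_le_ofReal_iff hC0).1 hle

/-- The small time asymptotics `t⁻¹ E F(Z_t) → ∫ F dℓ` for `F` controlled by the weight and by a
function of bounded energy. -/
lemma IsLevyProcess.tendsto_integral_of_sq_le (hZ : IsLevyProcess P Z)
    (hs : IsSymmetricProcess P Z) (h : HasGeneratingTriplet P Z 0 ℓ γ)
    {F G : EuclideanSpace ℝ (Fin n) → ℝ} (hF : Continuous F) (hG : Continuous G)
    (hG0 : ∀ y, 0 ≤ G y) {B : ℝ} (hB : ∀ y, |G y| ≤ B) {C : ℝ}
    (hC : ∀ᶠ t : ℝ≥0 in 𝓝[>] 0, (t : ℝ)⁻¹ * ∫ z, G z ∂(P.map (Z t)) ≤ C)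
    (hFG : ∀ y, F y ^ 2 ≤ gaussWeight y * G y) :
    Integrable F ℓ ∧
    Tendsto (fun t : ℝ≥0 => (t : ℝ)⁻¹ * ∫ z, F z ∂(P.map (Z t))) (𝓝[>] 0)
      (𝓝 (∫ y, F y ∂ℓ)) := by
  have hℓ := h.isLevyMeasure
  obtain ⟨hGi, hGC⟩ := hZ.integrable_of_bounded hs h hG hG0 hB hC
  have hC0 : 0 ≤ C := (integral_nonneg hG0).trans hGC
  refine ⟨integrable_of_sq_le_gaussWeight_mul hℓ.integrable_gaussWeight hF.aestronglyMeasurable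
    hGi hG0 hFG, ?_⟩
  have hFB : ∀ y, |F y| ≤ B + 1 := fun y => by
    have h1 := hFG y
    have h2 := gaussWeight_le_one y
    have h3 := gaussWeight_nonneg y
    have h4 := (le_abs_self _).trans (hB y)
    refine abs_le_of_sq_le_sq ?_ (by linarith [hG0 y])
    nlinarith [hG0 y]
  rw [Metric.tendsto_nhds]
  intro δ hδ
  -- `κ` makes the energy part of the cutoff error at most `δ / 8`; the `+ 1` allows `C = 0`. Then
  -- `ε` is chosen so that the remaining part is at most `δ / 8` too, both for `ℓ` and for the
  -- rescaled laws at small times.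
  set κ := δ / (8 * (C + 1)) with hκ
  have hκ0 : 0 < κ := by positivity
  have hκC : κ * C ≤ δ / 8 := by
    rw [hκ, div_mul_eq_mul_div, div_le_div_iff₀ (by positivity) (by positivity)]
    nlinarith
  obtain ⟨ε, hε, hεlt⟩ := hℓ.exists_cutoff_lt (δ := κ * δ / 8) (by positivity)
  have t1 := hZ.tendsto_integral_gaussWeight_mul hs h
    (continuous_div_gaussWeight_add hF hε) (abs_div_gaussWeight_add_le hFB hε)
  have t2 := hZ.tendsto_integral_gaussWeight_mul hs h
    (continuous_div_gaussWeight_add (continuous_const (y := ε)) hε)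
    (abs_div_gaussWeight_add_le (G := fun _ => ε) (B := |ε|) (fun _ => le_rfl) hε)
  rw [Metric.tendsto_nhds] at t1
  filter_upwards [t1 (δ / 4) (by positivity), t2.eventually (gt_mem_nhds hεlt), hC,
    self_mem_nhdsWithin] with t h1 h2 h3 ht
  have ht' : (0 : ℝ) < t := NNReal.coe_pos.2 ht
  have := hZ.isProbabilityMeasure_map t
  have hGt : Integrable G (P.map (Z t)) :=
    Integrable.of_bound hG.aestronglyMeasurable B (.of_forall hB)
  have e1 := abs_integral_sub_cutoff_le (m := P.map (Z t))
    (integrable_gaussWeight_of_isFiniteMeasure _) hF hGt hG0 hFG hε hκ0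
  have e2 := abs_integral_sub_cutoff_le hℓ.integrable_gaussWeight hF hGi hG0 hFG hε hκ0
  rw [Real.dist_eq] at h1 ⊢
  set a := ∫ z, F z ∂(P.map (Z t))
  set a' := ∫ y, gaussWeight y * (F y / (gaussWeight y + ε)) ∂(P.map (Z t))
  set g := ∫ z, G z ∂(P.map (Z t))
  set w := ∫ y, gaussWeight y * (ε / (gaussWeight y + ε)) ∂(P.map (Z t))
  set b := ∫ z, F z ∂ℓ
  set b' := ∫ y, gaussWeight y * (F y / (gaussWeight y + ε)) ∂ℓ
  set w' := ∫ y, gaussWeight y * (ε / (gaussWeight y + ε)) ∂ℓ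
  have e3 : |(t : ℝ)⁻¹ * a - (t : ℝ)⁻¹ * a'| ≤ δ / 4 := by
    rw [← mul_sub, abs_mul, abs_of_pos (inv_pos.2 ht')]
    calc (t : ℝ)⁻¹ * |a - a'| ≤ (t : ℝ)⁻¹ * (κ * g + κ⁻¹ * w) := by gcongr
      _ = κ * ((t : ℝ)⁻¹ * g) + κ⁻¹ * ((t : ℝ)⁻¹ * w) := by ring
      _ ≤ κ * C + κ⁻¹ * (κ * δ / 8) := by gcongr
      _ = κ * C + δ / 8 := by field_simp
      _ ≤ δ / 4 := by linarith
  have e4 : |b - b'| ≤ δ / 4 := by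
    calc |b - b'| ≤ κ * (∫ z, G z ∂ℓ) + κ⁻¹ * w' := e2
      _ ≤ κ * C + κ⁻¹ * (κ * δ / 8) := by gcongr
      _ = κ * C + δ / 8 := by field_simp
      _ ≤ δ / 4 := by linarith
  rw [abs_le] at e3 e4
  rw [abs_lt] at h1 ⊢
  constructor <;> linarith [h1.1, h1.2, e3.1, e3.2, e4.1, e4.2]

/-- The small time asymptotics `t⁻¹ E F(Z_t) → ∫ F dℓ` for `F` of second order at the origin. -/
lemma IsLevyProcess.tendsto_integral_of_le (hZ : IsLevyProcess P Z)
    (hs : IsSymmetricProcess P Z) (h : HasGeneratingTriplet P Z 0 ℓ γ)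
    {F : EuclideanSpace ℝ (Fin n) → ℝ} (hF : Continuous F) {C : ℝ}
    (hFC : ∀ y, |F y| ≤ C * gaussWeight y) :
    Tendsto (fun t : ℝ≥0 => (t : ℝ)⁻¹ * ∫ z, F z ∂(P.map (Z t))) (𝓝[>] 0)
      (𝓝 (∫ y, F y ∂ℓ)) := by
  have hW := hZ.tendsto_integral_gaussWeight_mul hs h (continuous_const (y := C ^ 2))
    (fun _ => le_rfl)
  -- With `G = C² w` one has `F² ≤ C² w² = w G`, and the energies of `G` are bounded because they
  -- converge.
  refine (hZ.tendsto_integral_of_sq_le hs h hF (G := fun y => gaussWeight y * C ^ 2)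
    (by fun_prop) (fun y => mul_nonneg (gaussWeight_nonneg y) (sq_nonneg C)) (B := C ^ 2)
    (fun y => ?_) (C := ∫ y, gaussWeight y * C ^ 2 ∂ℓ + 1) ?_ fun y => ?_).2
  · rw [abs_of_nonneg (mul_nonneg (gaussWeight_nonneg y) (sq_nonneg C))]
    nlinarith [gaussWeight_le_one y, sq_nonneg C]
  · exact (hW.eventually (gt_mem_nhds (lt_add_one _))).mono fun _ ht => ht.le
  · calc F y ^ 2 = |F y| ^ 2 := (sq_abs _).symm
      _ ≤ (C * gaussWeight y) ^ 2 := by gcongr; exact hFC y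
      _ = _ := by ring

end vague

/-! ### Translations on `L²` -/

section translation

variable {n : ℕ}

/-- Translation as an isometry of `L²(ℝⁿ)`. -/
def l2Translate (z : EuclideanSpace ℝ (Fin n)) :
    Lp ℝ 2 (volume : Measure (EuclideanSpace ℝ (Fin n))) →ₗᵢ[ℝ]
      Lp ℝ 2 (volume : Measure (EuclideanSpace ℝ (Fin n))) :=
  Lp.compMeasurePreservingₗᵢ ℝ (fun x => x + z) (measurePreserving_add_right volume z)

lemma coeFn_l2Translate (z : EuclideanSpace ℝ (Fin n))
    (g : Lp ℝ 2 (volume : Measure (EuclideanSpace ℝ (Fin n)))) :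
    l2Translate z g =ᵐ[volume] fun x => g (x + z) :=
  Lp.coeFn_compMeasurePreserving g (measurePreserving_add_right volume z)

lemma l2Translate_toLp (z : EuclideanSpace ℝ (Fin n)) {f : EuclideanSpace ℝ (Fin n) → ℝ}
    (hf : MemLp f 2 volume) :
    l2Translate z (hf.toLp f) =ᵐ[volume] fun x => f (x + z) := by
  refine (coeFn_l2Translate z _).trans ?_
  exact (measurePreserving_add_right volume z).quasiMeasurePreserving.ae_eq_comp hf.coeFn_toLp

lemma l2Translate_add (z w : EuclideanSpace ℝ (Fin n))
    (g : Lp ℝ 2 (volume : Measure (EuclideanSpace ℝ (Fin n)))) :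
    l2Translate (z + w) g = l2Translate z (l2Translate w g) := by
  refine Lp.ext ?_
  have h := (measurePreserving_add_right volume z).quasiMeasurePreserving.ae_eq_comp
    (coeFn_l2Translate w g)
  filter_upwards [coeFn_l2Translate (z + w) g, coeFn_l2Translate z (l2Translate w g), h]
    with x h1 h2 h3
  rw [h1, h2]
  simp only [Function.comp_apply] at h3
  rw [h3, add_assoc]

@[simp] lemma l2Translate_zero (g : Lp ℝ 2 (volume : Measure (EuclideanSpace ℝ (Fin n)))) :
    l2Translate 0 g = g := by
  refine Lp.ext ?_
  filter_upwards [coeFn_l2Translate 0 g] with x h1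
  rw [h1, add_zero]

lemma inner_l2Translate (z : EuclideanSpace ℝ (Fin n))
    (g h : Lp ℝ 2 (volume : Measure (EuclideanSpace ℝ (Fin n)))) :
    inner ℝ (l2Translate z g) h = inner ℝ g (l2Translate (-z) h) := by
  rw [← (l2Translate (-z)).inner_map_map, ← l2Translate_add, neg_add_cancel, l2Translate_zero]

/-- Joint continuity is needed because the product increments below translate a vector that itself
depends on `z`. -/
lemma Continuous.l2Translate {X : Type*} [TopologicalSpace X] {z : X → EuclideanSpace ℝ (Fin n)}
    {g : X → Lp ℝ 2 (volume : Measure (EuclideanSpace ℝ (Fin n)))} (hz : Continuous z)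
    (hg : Continuous g) : Continuous fun x => l2Translate (z x) (g x) := by
  let c : X → C(EuclideanSpace ℝ (Fin n), EuclideanSpace ℝ (Fin n)) := fun a =>
    ⟨fun x => x + z a, by fun_prop⟩
  have hc : Continuous c := ContinuousMap.continuous_of_continuous_uncurry _
    (by simp only [c, Function.uncurry_def, ContinuousMap.coe_mk]; fun_prop)
  exact hg.compMeasurePreservingLp hc (fun a => measurePreserving_add_right volume (z a))
    (by norm_num)

/-- This makes `φ(x + ζ(y))` jointly measurable, and insensitive to the representative of `φ`, when
`φ` is only measurable up to null sets. -/
lemma quasiMeasurePreserving_add_comp {Y : Type*} [MeasurableSpace Y] {m : Measure Y} [SFinite m]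
    {ζ : Y → EuclideanSpace ℝ (Fin n)} (hζ : Measurable ζ) :
    Measure.QuasiMeasurePreserving (fun p : EuclideanSpace ℝ (Fin n) × Y => p.1 + ζ p.2)
      (volume.prod m) volume :=
  QuasiMeasurePreserving.prod_of_left (by fun_prop) (.of_forall fun y =>
    (measurePreserving_add_right volume (ζ y)).quasiMeasurePreserving)

end translation

/-! ### Pointwise values of `L²`-valued integrals -/

section bochner

variable {n : ℕ} {Y : Type*} [MeasurableSpace Y] {m : Measure Y} [SigmaFinite m]
  {Φ : Y → Lp ℝ 2 (volume : Measure (EuclideanSpace ℝ (Fin n)))}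
  {k : EuclideanSpace ℝ (Fin n) → Y → ℝ}

/-- On a set `S` of finite measure the `L¹` norm is the pairing of `|Φ y|` with the indicator of
`S`, so it is bounded by a multiple of `‖Φ y‖`. Without the restriction an `L²` function need not be
integrable. -/
lemma integrable_restrict_prod_of_integrable_Lp (hΦ : Integrable Φ m)
    (hk : AEStronglyMeasurable (Function.uncurry k) (volume.prod m))
    (hΦk : ∀ y, Φ y =ᵐ[volume] fun x => k x y) {S : Set (EuclideanSpace ℝ (Fin n))}
    (hS : MeasurableSet S) (hS' : volume S < ∞) :
    Integrable (Function.uncurry k) ((volume.restrict S).prod m) := by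
  have hac : (volume.restrict S).prod m ≪ volume.prod m :=
    Measure.AbsolutelyContinuous.prod Measure.restrict_le_self.absolutelyContinuous
      Measure.AbsolutelyContinuous.rfl
  have hk' := hk.mono_ac hac
  have hnorm : ∀ y, ∫ x in S, ‖k x y‖ =
      inner ℝ (indicatorConstLp 2 hS hS'.ne (1 : ℝ)) |Φ y| := by
    intro y
    rw [L2.inner_indicatorConstLp_one hS hS'.ne]
    refine integral_congr_ae (ae_restrict_of_ae ?_)
    filter_upwards [hΦk y, Lp.coeFn_abs (Φ y)] with x h1 h2
    rw [h2, h1, Real.norm_eq_abs]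
  rw [integrable_prod_iff' hk']
  refine ⟨.of_forall fun y => ?_, ?_⟩
  · have h1 : IntegrableOn (Φ y) S volume :=
      integrableOn_Lp_of_measure_ne_top (Φ y) (by norm_num) hS'.ne
    exact h1.congr (ae_restrict_of_ae (hΦk y))
  · refine (hΦ.norm.const_mul ‖indicatorConstLp 2 hS hS'.ne (1 : ℝ)‖).mono'
      (hk'.norm.prod_swap.integral_prod_right') (.of_forall fun y => ?_)
    simp only [Function.uncurry_apply_pair]
    rw [hnorm, ← norm_abs_eq_norm (Φ y)]
    exact norm_inner_le_norm _ _

lemma ae_integrable_of_integrable_Lp (hΦ : Integrable Φ m)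
    (hk : AEStronglyMeasurable (Function.uncurry k) (volume.prod m))
    (hΦk : ∀ y, Φ y =ᵐ[volume] fun x => k x y) : ∀ᵐ x, Integrable (k x) m := by
  refine ae_of_forall_measure_lt_top_ae_restrict _ fun S hS hS' => ?_
  exact (integrable_restrict_prod_of_integrable_Lp hΦ hk hΦk hS hS').prod_right_ae

/-- Bochner integrals in `L²` are computed pointwise. -/
lemma coeFn_integral_Lp (hΦ : Integrable Φ m)
    (hk : AEStronglyMeasurable (Function.uncurry k) (volume.prod m))
    (hΦk : ∀ y, Φ y =ᵐ[volume] fun x => k x y) :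
    (∫ y, Φ y ∂m : Lp ℝ 2 (volume : Measure (EuclideanSpace ℝ (Fin n)))) =ᵐ[volume]
      fun x => ∫ y, k x y ∂m := by
  refine ae_eq_of_forall_setIntegral_eq_of_sigmaFinite (fun S hS hS' => ?_) (fun S hS hS' => ?_)
    fun S hS hS' => ?_
  · exact integrableOn_Lp_of_measure_ne_top _ (by norm_num) hS'.ne
  · exact (integrable_restrict_prod_of_integrable_Lp hΦ hk hΦk hS hS').integral_prod_left
  · have hi := integrable_restrict_prod_of_integrable_Lp hΦ hk hΦk hS hS'
    -- Integrating over `S` is a bounded functional on `L²`, so it commutes with the Bochner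
    -- integral; Fubini does the same for the pointwise one.
    rw [integral_integral_swap hi, ← L2.inner_indicatorConstLp_one hS hS'.ne,
      ← integral_inner hΦ]
    refine integral_congr_ae (.of_forall fun y => ?_)
    simp only
    rw [L2.inner_indicatorConstLp_one hS hS'.ne]
    exact integral_congr_ae (ae_restrict_of_ae (hΦk y))

end bochner

/-! ### The symmetric semigroup on `L²`; weak and strong generators -/

section semigroup

variable {n : ℕ} {Ω : Type*} [MeasurableSpace Ω]

/-- The transition semigroup as an operator on `L²(ℝⁿ)`. -/
def l2Semigroup (P : Measure Ω) (Z : ℝ≥0 → Ω → EuclideanSpace ℝ (Fin n)) (t : ℝ≥0)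
    (g : Lp ℝ 2 (volume : Measure (EuclideanSpace ℝ (Fin n)))) :
    Lp ℝ 2 (volume : Measure (EuclideanSpace ℝ (Fin n))) :=
  ∫ z, l2Translate z g ∂(P.map (Z t))

lemma continuous_l2Translate_apply (g : Lp ℝ 2 (volume : Measure (EuclideanSpace ℝ (Fin n)))) :
    Continuous fun z => l2Translate z g :=
  continuous_id.l2Translate continuous_const

lemma integrable_l2Translate (m : Measure (EuclideanSpace ℝ (Fin n))) [IsFiniteMeasure m]
    (g : Lp ℝ 2 (volume : Measure (EuclideanSpace ℝ (Fin n)))) :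
    Integrable (fun z => l2Translate z g) m :=
  Integrable.of_bound (continuous_l2Translate_apply g).aestronglyMeasurable ‖g‖
    (.of_forall fun z => ((l2Translate z).norm_map g).le)

lemma abs_inner_l2Translate_le (g h : Lp ℝ 2 (volume : Measure (EuclideanSpace ℝ (Fin n))))
    (z : EuclideanSpace ℝ (Fin n)) : |inner ℝ (l2Translate z g) h| ≤ ‖g‖ * ‖h‖ := by
  refine (abs_real_inner_le_norm _ _).trans ?_
  rw [LinearIsometry.norm_map]

variable {P : Measure Ω} {Z : ℝ≥0 → Ω → EuclideanSpace ℝ (Fin n)}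

lemma IsLevyProcess.integral_comp_neg (hZ : IsLevyProcess P Z) (hs : IsSymmetricProcess P Z)
    (t : ℝ≥0) (k : EuclideanSpace ℝ (Fin n) → ℝ) :
    ∫ z, k (-z) ∂(P.map (Z t)) = ∫ z, k z ∂(P.map (Z t)) := by
  conv_rhs => rw [← hZ.map_neg hs t]
  exact ((MeasurableEquiv.neg (EuclideanSpace ℝ (Fin n))).measurableEmbedding.integral_map k).symm

variable [IsProbabilityMeasure P]

lemma IsLevyProcess.inner_l2Semigroup (hZ : IsLevyProcess P Z) (t : ℝ≥0)
    (g h : Lp ℝ 2 (volume : Measure (EuclideanSpace ℝ (Fin n)))) :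
    inner ℝ (l2Semigroup P Z t g) h = ∫ z, inner ℝ (l2Translate z g) h ∂(P.map (Z t)) := by
  have := hZ.isProbabilityMeasure_map t
  unfold l2Semigroup
  rw [real_inner_comm, ← integral_inner (integrable_l2Translate _ g)]
  simp_rw [real_inner_comm]

lemma IsLevyProcess.inner_l2Semigroup_comm (hZ : IsLevyProcess P Z) (hs : IsSymmetricProcess P Z)
    (t : ℝ≥0) (g h : Lp ℝ 2 (volume : Measure (EuclideanSpace ℝ (Fin n)))) :
    inner ℝ (l2Semigroup P Z t g) h = inner ℝ g (l2Semigroup P Z t h) := by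
  rw [real_inner_comm (l2Semigroup P Z t h), hZ.inner_l2Semigroup, hZ.inner_l2Semigroup,
    ← hZ.integral_comp_neg hs]
  congr 1
  ext z
  rw [inner_l2Translate, neg_neg, real_inner_comm]

/-- The law of `Z_{s+t}` is a convolution; symmetry moves the time-`s` operator onto the second
vector. -/
lemma IsLevyProcess.inner_l2Semigroup_add (hZ : IsLevyProcess P Z) (hs : IsSymmetricProcess P Z)
    (s t : ℝ≥0) (g h : Lp ℝ 2 (volume : Measure (EuclideanSpace ℝ (Fin n)))) :
    inner ℝ (l2Semigroup P Z (s + t) g) h =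
      inner ℝ (l2Semigroup P Z t g) (l2Semigroup P Z s h) := by
  have := hZ.isProbabilityMeasure_map t
  have := hZ.isProbabilityMeasure_map s
  rw [hZ.inner_l2Semigroup, hZ.map_add, integral_conv]
  · rw [real_inner_comm, hZ.inner_l2Semigroup, ← hZ.integral_comp_neg hs]
    congr 1
    ext z
    conv_rhs => rw [real_inner_comm, hZ.inner_l2Semigroup]
    congr 1
    ext y
    rw [l2Translate_add, inner_l2Translate, neg_neg]
  · exact Integrable.of_bound ((continuous_l2Translate_apply g).inner
      continuous_const).aestronglyMeasurable _ (.of_forall (abs_inner_l2Translate_le g h))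

lemma IsLevyProcess.continuous_inner_l2Semigroup (hZ : IsLevyProcess P Z)
    (g h : Lp ℝ 2 (volume : Measure (EuclideanSpace ℝ (Fin n)))) :
    Continuous fun t => inner ℝ (l2Semigroup P Z t g) h := by
  simp_rw [hZ.inner_l2Semigroup]
  exact hZ.continuous_integral ((continuous_l2Translate_apply g).inner continuous_const)
    (abs_inner_l2Translate_le g h)

@[simp] lemma IsLevyProcess.l2Semigroup_zero (hZ : IsLevyProcess P Z)
    (g : Lp ℝ 2 (volume : Measure (EuclideanSpace ℝ (Fin n)))) : l2Semigroup P Z 0 g = g := by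
  unfold l2Semigroup
  rw [hZ.map_zero, integral_dirac, l2Translate_zero]

lemma IsLevyProcess.l2Semigroup_sub_self (hZ : IsLevyProcess P Z) (t : ℝ≥0)
    (g : Lp ℝ 2 (volume : Measure (EuclideanSpace ℝ (Fin n)))) :
    l2Semigroup P Z t g - g = ∫ z, (l2Translate z g - g) ∂(P.map (Z t)) := by
  have := hZ.isProbabilityMeasure_map t
  rw [integral_sub (integrable_l2Translate _ g) (integrable_const _)]
  simp [l2Semigroup]

/-- `‖T_t g - g‖ ≤ E ‖τ_{Z_t} g - g‖`, and the integrand is bounded, continuous and zero at the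
origin. -/
lemma IsLevyProcess.tendsto_l2Semigroup (hZ : IsLevyProcess P Z)
    (g : Lp ℝ 2 (volume : Measure (EuclideanSpace ℝ (Fin n)))) :
    Tendsto (fun t => l2Semigroup P Z t g) (𝓝 0) (𝓝 g) := by
  rw [tendsto_iff_norm_sub_tendsto_zero]
  have hc : Continuous fun z => ‖l2Translate z g - g‖ :=
    ((continuous_l2Translate_apply g).sub continuous_const).norm
  have h1 := (hZ.continuous_integral hc (C := 2 * ‖g‖) fun z => ?_).tendsto 0
  · simp only [hZ.map_zero, integral_dirac, l2Translate_zero, sub_self, norm_zero] at h1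
    refine squeeze_zero (fun _ => norm_nonneg _) (fun t => ?_) h1
    rw [hZ.l2Semigroup_sub_self]
    exact norm_integral_le_integral_norm _
  · rw [abs_of_nonneg (norm_nonneg _)]
    refine (norm_sub_le _ _).trans ?_
    rw [LinearIsometry.norm_map]; linarith

/-- A weak generator of the transition semigroup is a strong generator. -/
theorem IsLevyProcess.tendsto_of_weak (hZ : IsLevyProcess P Z) (hs : IsSymmetricProcess P Z)
    {ψ g : Lp ℝ 2 (volume : Measure (EuclideanSpace ℝ (Fin n)))}
    (hw : ∀ h, Tendsto (fun t : ℝ≥0 => (t : ℝ)⁻¹ * inner ℝ (l2Semigroup P Z t ψ - ψ) h) (𝓝[>] 0)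
      (𝓝 (inner ℝ g h))) :
    Tendsto (fun t : ℝ≥0 => (t : ℝ)⁻¹ • (l2Semigroup P Z t ψ - ψ)) (𝓝[>] 0) (𝓝 g) := by
  -- Replacing the test vector `h` by `T_s h` moves the weak derivative from time `0` to time `s`:
  -- the right derivative of `⟨T_s ψ, h⟩` is `⟨T_s g, h⟩`.
  have hderiv : ∀ (h : Lp ℝ 2 (volume : Measure (EuclideanSpace ℝ (Fin n)))) (s : ℝ), 0 ≤ s →
      HasDerivWithinAt (fun r : ℝ => inner ℝ (l2Semigroup P Z r.toNNReal ψ) h - r * inner ℝ g h)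
        (inner ℝ (l2Semigroup P Z s.toNNReal g - g) h) (Set.Ici s) s := by
    intro h s hs0
    rw [inner_sub_left]
    refine HasDerivWithinAt.sub ?_ ?_
    · rw [← hasDerivWithinAt_Ioi_iff_Ici, hasDerivWithinAt_iff_tendsto_slope' (by simp)]
      have hm : Tendsto (fun r : ℝ => (r - s).toNNReal) (𝓝[>] s) (𝓝[>] 0) := by
        refine tendsto_nhdsWithin_iff.2 ⟨?_, ?_⟩
        · exact ((by fun_prop : Continuous fun r : ℝ => (r - s).toNNReal).tendsto' s 0
            (by simp)).mono_left nhdsWithin_le_nhds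
        · filter_upwards [self_mem_nhdsWithin] with r hr
          simpa using hr
      have h1 := (hw (l2Semigroup P Z s.toNNReal h)).comp hm
      rw [← hZ.inner_l2Semigroup_comm hs] at h1
      refine h1.congr' ?_
      filter_upwards [self_mem_nhdsWithin] with r hr
      have hr' : s < r := hr
      have e : r.toNNReal = s.toNNReal + (r - s).toNNReal := by
        rw [← Real.toNNReal_add hs0 (by linarith)]; congr 1; ring
      simp only [Function.comp_apply, slope_def_field]
      rw [e, hZ.inner_l2Semigroup_add hs, inner_sub_left, ← hZ.inner_l2Semigroup_comm hs _ ψ h,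
        Real.coe_toNNReal _ (by linarith), div_eq_inv_mul]
    · simpa using ((hasDerivAt_id s).mul_const (inner ℝ g h)).hasDerivWithinAt
  rw [Metric.tendsto_nhds]
  intro ε hε
  have h1 := (Metric.tendsto_nhds.1 (hZ.tendsto_l2Semigroup g)) (ε / 2) (by positivity)
  obtain ⟨δ, hδ, hδ'⟩ := Metric.eventually_nhds_iff.1 h1
  have h2 : ∀ᶠ t : ℝ≥0 in 𝓝[>] 0, t < δ.toNNReal :=
    nhdsWithin_le_nhds (gt_mem_nhds (by simpa using hδ))
  filter_upwards [h2, self_mem_nhdsWithin] with t ht ht0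
  have ht' : (0 : ℝ) < t := NNReal.coe_pos.2 ht0
  -- The error itself serves as test vector: the mean value inequality yields `‖v‖² ≤ (ε / 2) t
  -- ‖v‖`, hence a norm bound.
  set v := l2Semigroup P Z t ψ - ψ - (t : ℝ) • g with hv
  have hb := norm_image_sub_le_of_norm_deriv_right_le_segment (a := (0 : ℝ)) (b := t)
    (C := ε / 2 * ‖v‖)
    (f := fun r : ℝ => inner ℝ (l2Semigroup P Z r.toNNReal ψ) v - r * inner ℝ g v)
    (f' := fun s => inner ℝ (l2Semigroup P Z s.toNNReal g - g) v)
    (Continuous.continuousOn ?_) (fun s hs' => hderiv v s hs'.1) (fun s hs' => ?_) t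
    (Set.right_mem_Icc.2 ht'.le)
  · simp only [Real.toNNReal_coe, Real.toNNReal_zero, hZ.l2Semigroup_zero, zero_mul, sub_zero] at hb
    have e : inner ℝ (l2Semigroup P Z t ψ) v - t * inner ℝ g v - inner ℝ ψ v = ‖v‖ ^ 2 := by
      rw [← real_inner_self_eq_norm_sq]
      conv_rhs => enter [2]; rw [hv]
      rw [inner_sub_left, inner_sub_left, inner_smul_left]
      simp; ring
    rw [e, Real.norm_of_nonneg (by positivity)] at hb
    have hv2 : ‖v‖ ≤ ε / 2 * t := by
      rcases (norm_nonneg v).eq_or_lt with h0 | h0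
      · rw [← h0]; positivity
      · nlinarith
    have e2 : (t : ℝ)⁻¹ • (l2Semigroup P Z t ψ - ψ) - g = (t : ℝ)⁻¹ • v := by
      rw [hv, smul_sub (t : ℝ)⁻¹ _ ((t : ℝ) • g), smul_smul, inv_mul_cancel₀ ht'.ne', one_smul]
    rw [dist_eq_norm, e2, norm_smul, Real.norm_of_nonneg (by positivity)]
    calc (t : ℝ)⁻¹ * ‖v‖ ≤ (t : ℝ)⁻¹ * (ε / 2 * t) := by gcongr
      _ = ε / 2 := by field_simp
      _ < ε := by linarith
  · exact ((hZ.continuous_inner_l2Semigroup ψ v).comp (by fun_prop)).sub (by fun_prop)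
  · refine (norm_inner_le_norm _ _).trans ?_
    gcongr
    rw [← dist_eq_norm]
    refine (hδ' ?_).le
    rw [NNReal.dist_eq]
    simp only [NNReal.coe_zero, sub_zero]
    rw [abs_of_nonneg (by positivity), Real.coe_toNNReal _ hs'.1]
    have : (t : ℝ) < δ := by
      have := NNReal.coe_lt_coe.2 ht
      rwa [Real.coe_toNNReal _ hδ.le] at this
    exact hs'.2.trans this

end semigroup

/-! ### Translation between functions and `L²` classes -/

section generatorPair

variable {n : ℕ} {Ω : Type*} [MeasurableSpace Ω] {P : Measure Ω}
  {Z : ℝ≥0 → Ω → EuclideanSpace ℝ (Fin n)} {φ g : EuclideanSpace ℝ (Fin n) → ℝ}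

lemma generator_spec (h : φ ∈ generatorDomain P Z) : IsGeneratorPair P Z φ (generator P Z φ) := by
  have h' : ∃ g, IsGeneratorPair P Z φ g := h
  unfold generator
  rw [dif_pos h']
  exact h'.choose_spec

variable [IsProbabilityMeasure P]

lemma IsLevyProcess.transitionOp_ae_eq (hZ : IsLevyProcess P Z) (t : ℝ≥0)
    (hφ : MemLp φ 2 volume) :
    transitionOp P Z t φ =ᵐ[volume] l2Semigroup P Z t (hφ.toLp φ) := by
  have h1 : l2Semigroup P Z t (hφ.toLp φ) = ∫ ω, l2Translate (Z t ω) (hφ.toLp φ) ∂P :=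
    integral_map (hZ.measurable t).aemeasurable
      (continuous_l2Translate_apply _).aestronglyMeasurable
  have := hZ.isProbabilityMeasure_map t
  have h2 : Integrable (fun ω => l2Translate (Z t ω) (hφ.toLp φ)) P :=
    (integrable_l2Translate (P.map (Z t)) (hφ.toLp φ)).comp_measurable (hZ.measurable t)
  rw [h1]
  refine (coeFn_integral_Lp h2 (k := fun x ω => φ (x + Z t ω)) ?_
    fun ω => l2Translate_toLp (Z t ω) hφ).symm
  exact hφ.1.comp_quasiMeasurePreserving (quasiMeasurePreserving_add_comp (hZ.measurable t))

lemma IsLevyProcess.isGeneratorPair_iff (hZ : IsLevyProcess P Z) (hφ : MemLp φ 2 volume)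
    (hg : MemLp g 2 volume) :
    IsGeneratorPair P Z φ g ↔
      Tendsto (fun t : ℝ≥0 => (t : ℝ)⁻¹ • (l2Semigroup P Z t (hφ.toLp φ) - hφ.toLp φ)) (𝓝[>] 0)
        (𝓝 (hg.toLp g)) := by
  have key : ∀ t : ℝ≥0,
      eLpNorm (fun x => (t : ℝ)⁻¹ * (transitionOp P Z t φ x - φ x) - g x) 2 volume =
        edist ((t : ℝ)⁻¹ • (l2Semigroup P Z t (hφ.toLp φ) - hφ.toLp φ)) (hg.toLp g) := by
    intro t
    rw [Lp.edist_def]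
    refine eLpNorm_congr_ae ?_
    filter_upwards [hZ.transitionOp_ae_eq t hφ, hφ.coeFn_toLp, hg.coeFn_toLp,
      Lp.coeFn_smul (t : ℝ)⁻¹ (l2Semigroup P Z t (hφ.toLp φ) - hφ.toLp φ),
      Lp.coeFn_sub (l2Semigroup P Z t (hφ.toLp φ)) (hφ.toLp φ)] with x h1 h2 h3 h4 h5
    rw [Pi.sub_apply, h4, Pi.smul_apply, h5, Pi.sub_apply, h1, h2, h3, smul_eq_mul]
  rw [tendsto_iff_edist_tendsto_0]
  simp_rw [← key]
  exact ⟨fun h => h.2.2, fun h => ⟨hφ, hg, h⟩⟩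

/-- `generator` picks its value by choice; uniqueness of limits in `L²` fixes it up to null sets. -/
lemma IsLevyProcess.generator_ae_eq (hZ : IsLevyProcess P Z) (h : IsGeneratorPair P Z φ g) :
    generator P Z φ =ᵐ[volume] g := by
  have h1 := generator_spec (P := P) (Z := Z) (φ := φ) ⟨g, h⟩
  have h2 := (hZ.isGeneratorPair_iff h1.1 h1.2.1).1 h1
  have h3 := (hZ.isGeneratorPair_iff h.1 h.2.1).1 h
  exact (MemLp.toLp_eq_toLp_iff h1.2.1 h.2.1).1 (tendsto_nhds_unique h2 h3)

end generatorPair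

/-! ### Energy bounds on the domain of the generator -/

section energy

variable {n : ℕ} {Ω : Type*} [MeasurableSpace Ω] {P : Measure Ω} [IsProbabilityMeasure P]
  {Z : ℝ≥0 → Ω → EuclideanSpace ℝ (Fin n)}
  {ℓ : Measure (EuclideanSpace ℝ (Fin n))} {γ : EuclideanSpace ℝ (Fin n)}
  {u g : Lp ℝ 2 (volume : Measure (EuclideanSpace ℝ (Fin n)))}

lemma continuous_l2Translate_sub (u : Lp ℝ 2 (volume : Measure (EuclideanSpace ℝ (Fin n)))) :
    Continuous fun z => l2Translate z u - u :=
  (continuous_l2Translate_apply u).sub continuous_const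

lemma norm_l2Translate_sub_le (u : Lp ℝ 2 (volume : Measure (EuclideanSpace ℝ (Fin n))))
    (z : EuclideanSpace ℝ (Fin n)) : ‖l2Translate z u - u‖ ≤ 2 * ‖u‖ := by
  refine (norm_sub_le _ _).trans ?_
  rw [LinearIsometry.norm_map]; linarith

/-- The approximating energies of an element of the domain of the generator are bounded. -/
lemma IsLevyProcess.exists_energy_le (hZ : IsLevyProcess P Z)
    (hg : Tendsto (fun t : ℝ≥0 => (t : ℝ)⁻¹ • (l2Semigroup P Z t u - u)) (𝓝[>] 0) (𝓝 g)) :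
    ∃ C, ∀ᶠ t : ℝ≥0 in 𝓝[>] 0,
      (t : ℝ)⁻¹ * ∫ z, ‖l2Translate z u - u‖ ^ 2 ∂(P.map (Z t)) ≤ C := by
  have h1 : Tendsto (fun t : ℝ≥0 => -2 * inner ℝ ((t : ℝ)⁻¹ • (l2Semigroup P Z t u - u)) u)
      (𝓝[>] 0) (𝓝 (-2 * inner ℝ g u)) := (hg.inner tendsto_const_nhds).const_mul _
  refine ⟨-2 * inner ℝ g u + 1, ?_⟩
  filter_upwards [h1.eventually (gt_mem_nhds (lt_add_one _))] with t ht
  refine le_trans (le_of_eq ?_) ht.le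
  have := hZ.isProbabilityMeasure_map t
  -- This uses that translation is isometric. Integrated, it writes the energy as `-2⟨t⁻¹(T_t u -
  -- u), u⟩`, which converges.
  have e : ∀ z, ‖l2Translate z u - u‖ ^ 2 = -2 * inner ℝ (l2Translate z u - u) u := by
    intro z
    rw [norm_sub_sq_real, LinearIsometry.norm_map, inner_sub_left, real_inner_self_eq_norm_sq]
    ring
  have hi : Integrable (fun z => l2Translate z u - u) (P.map (Z t)) :=
    (integrable_l2Translate _ u).sub (integrable_const _)
  simp_rw [e]
  rw [integral_const_mul, hZ.l2Semigroup_sub_self, inner_smul_left, real_inner_comm,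
    ← integral_inner hi]
  simp_rw [real_inner_comm u]
  simp; ring

/-- The energy of an element of the domain of the generator is finite. -/
lemma IsLevyProcess.integrable_energy (hZ : IsLevyProcess P Z) (hs : IsSymmetricProcess P Z)
    (hT : HasGeneratingTriplet P Z 0 ℓ γ)
    (hg : Tendsto (fun t : ℝ≥0 => (t : ℝ)⁻¹ • (l2Semigroup P Z t u - u)) (𝓝[>] 0) (𝓝 g)) :
    Integrable (fun z => ‖l2Translate z u - u‖ ^ 2) ℓ := by
  obtain ⟨C, hC⟩ := hZ.exists_energy_le hg
  refine (hZ.integrable_of_bounded hs hT ((continuous_l2Translate_sub u).norm.pow 2)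
    (fun z => sq_nonneg _) (B := (2 * ‖u‖) ^ 2) (fun z => ?_) hC).1
  rw [abs_of_nonneg (sq_nonneg _)]
  exact pow_le_pow_left₀ (norm_nonneg _) (norm_l2Translate_sub_le u z) 2

variable {Φ : EuclideanSpace ℝ (Fin n) → Lp ℝ 2 (volume : Measure (EuclideanSpace ℝ (Fin n)))}

lemma IsLevyProcess.integrable_of_norm_sq_le (hZ : IsLevyProcess P Z)
    (hs : IsSymmetricProcess P Z) (hT : HasGeneratingTriplet P Z 0 ℓ γ)
    (hg : Tendsto (fun t : ℝ≥0 => (t : ℝ)⁻¹ • (l2Semigroup P Z t u - u)) (𝓝[>] 0) (𝓝 g))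
    (hΦ : AEStronglyMeasurable Φ ℓ) {K : ℝ} (hK : 0 ≤ K)
    (h : ∀ z, ‖Φ z‖ ^ 2 ≤ K * gaussWeight z * ‖l2Translate z u - u‖ ^ 2) : Integrable Φ ℓ := by
  rw [← integrable_norm_iff hΦ]
  refine integrable_of_sq_le_gaussWeight_mul hT.isLevyMeasure.integrable_gaussWeight hΦ.norm
    ((hZ.integrable_energy hs hT hg).const_mul K) (fun z => by positivity) fun z => ?_
  refine (h z).trans (le_of_eq ?_)
  ring

/-- By Cauchy-Schwarz, the scalar function `⟨Φ z, h⟩` has square at most the weight times a multiple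
of the energy density of `u`, so the scalar asymptotics apply. This handles `δu δf`. -/
lemma IsLevyProcess.tendsto_inner_of_norm_sq_le (hZ : IsLevyProcess P Z)
    (hs : IsSymmetricProcess P Z) (hT : HasGeneratingTriplet P Z 0 ℓ γ)
    (hg : Tendsto (fun t : ℝ≥0 => (t : ℝ)⁻¹ • (l2Semigroup P Z t u - u)) (𝓝[>] 0) (𝓝 g))
    (hΦ : Continuous Φ) {K : ℝ} (hK : 0 ≤ K)
    (hΦK : ∀ z, ‖Φ z‖ ^ 2 ≤ K * gaussWeight z * ‖l2Translate z u - u‖ ^ 2)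
    (h : Lp ℝ 2 (volume : Measure (EuclideanSpace ℝ (Fin n)))) :
    Tendsto (fun t : ℝ≥0 => (t : ℝ)⁻¹ * ∫ z, inner ℝ (Φ z) h ∂(P.map (Z t))) (𝓝[>] 0)
      (𝓝 (inner ℝ (∫ z, Φ z ∂ℓ) h)) := by
  obtain ⟨C, hC⟩ := hZ.exists_energy_le hg
  have hi := hZ.integrable_of_norm_sq_le hs hT hg hΦ.aestronglyMeasurable hK hΦK
  have e : inner ℝ (∫ z, Φ z ∂ℓ) h = ∫ z, inner ℝ (Φ z) h ∂ℓ := by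
    rw [real_inner_comm, ← integral_inner hi]
    simp_rw [real_inner_comm]
  rw [e]
  refine (hZ.tendsto_integral_of_sq_le hs hT (hΦ.inner continuous_const)
    (G := fun z => (K * ‖h‖ ^ 2) * ‖l2Translate z u - u‖ ^ 2)
    (((continuous_l2Translate_sub u).norm.pow 2).const_mul _) (fun z => by positivity)
    (B := (K * ‖h‖ ^ 2) * (2 * ‖u‖) ^ 2) (fun z => ?_) (C := (K * ‖h‖ ^ 2) * C) ?_
    fun z => ?_).2
  · rw [abs_of_nonneg (by positivity)]
    gcongr
    exact norm_l2Translate_sub_le u z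
  · filter_upwards [hC] with t ht
    rw [integral_const_mul]
    calc _ = (K * ‖h‖ ^ 2) * ((t : ℝ)⁻¹ * ∫ z, ‖l2Translate z u - u‖ ^ 2 ∂(P.map (Z t))) := by ring
      _ ≤ _ := by gcongr
  · calc (inner ℝ (Φ z) h) ^ 2 ≤ (‖Φ z‖ * ‖h‖) ^ 2 :=
          sq_le_sq.2 ((abs_real_inner_le_norm _ _).trans (le_abs_self _))
      _ = ‖Φ z‖ ^ 2 * ‖h‖ ^ 2 := by ring
      _ ≤ (K * gaussWeight z * ‖l2Translate z u - u‖ ^ 2) * ‖h‖ ^ 2 := by gcongr; exact hΦK z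
      _ = _ := by ring

lemma IsLevyProcess.tendsto_inner_of_norm_le (hZ : IsLevyProcess P Z)
    (hs : IsSymmetricProcess P Z) (hT : HasGeneratingTriplet P Z 0 ℓ γ)
    (hΦ : Continuous Φ) {K : ℝ} (hΦK : ∀ z, ‖Φ z‖ ≤ K * gaussWeight z)
    (h : Lp ℝ 2 (volume : Measure (EuclideanSpace ℝ (Fin n)))) :
    Tendsto (fun t : ℝ≥0 => (t : ℝ)⁻¹ * ∫ z, inner ℝ (Φ z) h ∂(P.map (Z t))) (𝓝[>] 0)
      (𝓝 (inner ℝ (∫ z, Φ z ∂ℓ) h)) := by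
  have hi := hT.isLevyMeasure.integrable_of_le hΦ.aestronglyMeasurable hΦK
  have e : inner ℝ (∫ z, Φ z ∂ℓ) h = ∫ z, inner ℝ (Φ z) h ∂ℓ := by
    rw [real_inner_comm, ← integral_inner hi]
    simp_rw [real_inner_comm]
  rw [e]
  refine hZ.tendsto_integral_of_le hs hT (hΦ.inner continuous_const) (C := K * ‖h‖) fun z => ?_
  refine (abs_real_inner_le_norm _ _).trans ?_
  calc ‖Φ z‖ * ‖h‖ ≤ (K * gaussWeight z) * ‖h‖ := by gcongr; exact hΦK z
    _ = _ := by ring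

end energy

/-! ### Multiplication operators -/

section multiplication

variable {n : ℕ}

lemma memLp_bounded_mul (f : BoundedContinuousFunction (EuclideanSpace ℝ (Fin n)) ℝ)
    {g : EuclideanSpace ℝ (Fin n) → ℝ} (hg : MemLp g 2 volume) :
    MemLp (fun x => f x * g x) 2 volume :=
  hg.of_le_mul (f.continuous.aestronglyMeasurable.mul hg.1) (c := ‖f‖) (.of_forall fun x => by
    rw [norm_mul]; gcongr; exact f.norm_coe_le_norm x)

/-- Multiplication by a bounded continuous function as an operator on `L²(ℝⁿ)`. -/
def l2Mul (f : BoundedContinuousFunction (EuclideanSpace ℝ (Fin n)) ℝ) :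
    Lp ℝ 2 (volume : Measure (EuclideanSpace ℝ (Fin n))) →L[ℝ]
      Lp ℝ 2 (volume : Measure (EuclideanSpace ℝ (Fin n))) :=
  LinearMap.mkContinuous
    { toFun := fun g => (memLp_bounded_mul f (Lp.memLp g)).toLp _
      map_add' := fun g h => by
        refine Lp.ext ?_
        filter_upwards [(memLp_bounded_mul f (Lp.memLp (g + h))).coeFn_toLp,
          (memLp_bounded_mul f (Lp.memLp g)).coeFn_toLp,
          (memLp_bounded_mul f (Lp.memLp h)).coeFn_toLp, Lp.coeFn_add g h,
          Lp.coeFn_add ((memLp_bounded_mul f (Lp.memLp g)).toLp _)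
            ((memLp_bounded_mul f (Lp.memLp h)).toLp _)] with x h1 h2 h3 h4 h5
        rw [h1, h5, Pi.add_apply, h2, h3, h4, Pi.add_apply, mul_add]
      map_smul' := fun c g => by
        refine Lp.ext ?_
        filter_upwards [(memLp_bounded_mul f (Lp.memLp (c • g))).coeFn_toLp,
          (memLp_bounded_mul f (Lp.memLp g)).coeFn_toLp, Lp.coeFn_smul c g,
          Lp.coeFn_smul c ((memLp_bounded_mul f (Lp.memLp g)).toLp _)] with x h1 h2 h3 h4
        rw [h1, RingHom.id_apply, h4, Pi.smul_apply, h2, h3, Pi.smul_apply, smul_eq_mul,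
          smul_eq_mul]
        ring } ‖f‖ fun g => by
      refine Lp.norm_le_mul_norm_of_ae_le_mul ?_
      filter_upwards [(memLp_bounded_mul f (Lp.memLp g)).coeFn_toLp] with x h1
      simp only [LinearMap.coe_mk, AddHom.coe_mk]
      rw [h1, norm_mul]
      gcongr
      exact f.norm_coe_le_norm x

lemma coeFn_l2Mul (f : BoundedContinuousFunction (EuclideanSpace ℝ (Fin n)) ℝ)
    (g : Lp ℝ 2 (volume : Measure (EuclideanSpace ℝ (Fin n)))) :
    l2Mul f g =ᵐ[volume] fun x => f x * g x :=
  (memLp_bounded_mul f (Lp.memLp g)).coeFn_toLp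

end multiplication

/-! ### Increment estimates for test functions -/

section testFunctions

variable {n : ℕ} {f : EuclideanSpace ℝ (Fin n) → ℝ}

lemma continuous_of_mem_testFunctions (hf : f ∈ testFunctions n) : Continuous f :=
  hf.1.continuous

lemma memLp_of_mem_testFunctions (hf : f ∈ testFunctions n) : MemLp f 2 volume :=
  hf.1.continuous.memLp_of_hasCompactSupport hf.2

lemma differentiable_of_mem_testFunctions (hf : f ∈ testFunctions n) : Differentiable ℝ f :=
  hf.1.differentiable (by simp)

lemma exists_abs_le_of_mem_testFunctions (hf : f ∈ testFunctions n) :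
    ∃ C, 0 ≤ C ∧ ∀ x, |f x| ≤ C := by
  obtain ⟨C, hC⟩ := hf.1.continuous.bounded_above_of_compact_support hf.2
  exact ⟨C, (norm_nonneg _).trans (hC 0), hC⟩

/-- The Lipschitz bound serves for `‖y‖ ≤ 1`, the sup bound for `‖y‖ ≥ 1`. -/
lemma exists_increment_sq_le (hf : f ∈ testFunctions n) :
    ∃ K, 0 ≤ K ∧ ∀ x y, (f (x + y) - f x) ^ 2 ≤ K * gaussWeight y := by
  obtain ⟨C, hC0, hC⟩ := exists_abs_le_of_mem_testFunctions hf
  obtain ⟨L, hL⟩ := (hf.1.of_le (m := 1) (by simp)).lipschitzWith_of_hasCompactSupport hf.2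
    one_ne_zero
  refine ⟨3 * L ^ 2 + 12 * C ^ 2, by positivity, fun x y => ?_⟩
  have h0 := gaussWeight_nonneg y
  rcases le_total ‖y‖ 1 with hy | hy
  · have h1 : |f (x + y) - f x| ≤ L * ‖y‖ := by
      have := hL.dist_le_mul (x + y) x
      rwa [Real.dist_eq, dist_eq_norm, add_sub_cancel_left] at this
    have h2 := sq_le_gaussWeight hy
    calc (f (x + y) - f x) ^ 2 = |f (x + y) - f x| ^ 2 := (sq_abs _).symm
      _ ≤ (L * ‖y‖) ^ 2 := by gcongr
      _ = L ^ 2 * ‖y‖ ^ 2 := by ring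
      _ ≤ L ^ 2 * (3 * gaussWeight y) := by gcongr
      _ ≤ _ := by nlinarith [mul_nonneg (sq_nonneg C) h0]
  · have h1 : |f (x + y) - f x| ≤ 2 * C := by
      refine (abs_sub _ _).trans ?_
      linarith [hC (x + y), hC x]
    have h2 := one_le_gaussWeight hy
    calc (f (x + y) - f x) ^ 2 = |f (x + y) - f x| ^ 2 := (sq_abs _).symm
      _ ≤ (2 * C) ^ 2 := by gcongr
      _ = 4 * C ^ 2 * 1 := by ring
      _ ≤ 4 * C ^ 2 * (3 * gaussWeight y) := by gcongr
      _ ≤ _ := by nlinarith [mul_nonneg (sq_nonneg (L : ℝ)) h0]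

/-- A quadratic Taylor estimate. -/
lemma exists_taylor_le (hf : f ∈ testFunctions n) :
    ∃ K, 0 ≤ K ∧ ∀ x y, |f (x + y) - f x - fderiv ℝ f x y| ≤ K * ‖y‖ ^ 2 := by
  have hd : ContDiff ℝ 1 (fderiv ℝ f) := hf.1.fderiv_right (by norm_cast)
  obtain ⟨L, hL⟩ := hd.lipschitzWith_of_hasCompactSupport (hf.2.fderiv ℝ) one_ne_zero
  refine ⟨L, L.2, fun x y => ?_⟩
  have h := (convex_segment x (x + y)).norm_image_sub_le_of_norm_fderiv_le' (𝕜 := ℝ)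
    (f := f) (φ := fderiv ℝ f x) (C := L * ‖y‖)
    (fun z _ => (differentiable_of_mem_testFunctions hf) z) (fun z hz => ?_)
    (left_mem_segment ℝ x (x + y)) (right_mem_segment ℝ x (x + y))
  · rw [add_sub_cancel_left, Real.norm_eq_abs] at h
    refine h.trans (le_of_eq ?_)
    ring
  · have h1 := hL.dist_le_mul z x
    rw [dist_eq_norm, dist_eq_norm] at h1
    refine h1.trans ?_
    gcongr
    obtain ⟨θ, hθ, rfl⟩ := (segment_eq_image' ℝ x (x + y)) ▸ hz
    rw [add_sub_cancel_left, add_sub_cancel_left, norm_smul, Real.norm_of_nonneg hθ.1]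
    exact mul_le_of_le_one_left (norm_nonneg _) hθ.2

/-- The symmetrized increment `(f(x + y) + f(x - y) - 2 f(x)) / 2`. -/
def symmIncrement (f : EuclideanSpace ℝ (Fin n) → ℝ) (y x : EuclideanSpace ℝ (Fin n)) : ℝ :=
  (1 / 2) * (f (x + y) + f (x + -y) - 2 * f x)

lemma symmIncrement_eq (f : EuclideanSpace ℝ (Fin n) → ℝ) (y x : EuclideanSpace ℝ (Fin n)) :
    symmIncrement f y x = (1 / 2) * ((f (x + y) - f x - fderiv ℝ f x y) +
      (f (x + -y) - f x - fderiv ℝ f x (-y))) := by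
  unfold symmIncrement
  rw [map_neg]; ring

lemma exists_abs_symmIncrement_le_sq (hf : f ∈ testFunctions n) :
    ∃ K, 0 ≤ K ∧ ∀ x y, |symmIncrement f y x| ≤ K * ‖y‖ ^ 2 := by
  obtain ⟨K, hK, h⟩ := exists_taylor_le hf
  refine ⟨K, hK, fun x y => ?_⟩
  have h1 := h x y
  have h2 := h x (-y)
  rw [norm_neg] at h2
  rw [symmIncrement_eq]
  rw [abs_le] at *
  constructor <;> linarith [h1.1, h1.2, h2.1, h2.2]

lemma exists_abs_symmIncrement_le (hf : f ∈ testFunctions n) :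
    ∃ K, 0 ≤ K ∧ ∀ x y, |symmIncrement f y x| ≤ K * gaussWeight y := by
  obtain ⟨C, hC0, hC⟩ := exists_abs_le_of_mem_testFunctions hf
  obtain ⟨K, hK, h⟩ := exists_abs_symmIncrement_le_sq hf
  refine ⟨3 * K + 6 * C, by positivity, fun x y => ?_⟩
  have h0 := gaussWeight_nonneg y
  rcases le_total ‖y‖ 1 with hy | hy
  · have h1 := h x y
    have h2 := mul_le_mul_of_nonneg_left (sq_le_gaussWeight hy) hK
    nlinarith
  · have h2 := mul_le_mul_of_nonneg_left (one_le_gaussWeight hy) hC0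
    have h3 : |symmIncrement f y x| ≤ 2 * C := by
      have a1 := abs_le.1 (hC x)
      have a2 := abs_le.1 (hC (x + y))
      have a3 := abs_le.1 (hC (x + -y))
      unfold symmIncrement
      rw [abs_le]
      constructor <;> linarith [a1.1, a1.2, a2.1, a2.2, a3.1, a3.2]
    nlinarith [mul_nonneg hK h0]

/-- The integrand `f(x + y) - f(x) - 1_{|y| ≤ 1} y⬝∇f(x)`. -/
def compensatedIncrement (f : EuclideanSpace ℝ (Fin n) → ℝ) (y x : EuclideanSpace ℝ (Fin n)) : ℝ :=
  f (x + y) - f x - (Metric.closedBall (0 : EuclideanSpace ℝ (Fin n)) 1).indicator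
    (fun y => fderiv ℝ f x y) y

lemma exists_abs_compensatedIncrement_le (hf : f ∈ testFunctions n) :
    ∃ K, 0 ≤ K ∧ ∀ x y, |compensatedIncrement f y x| ≤ K * gaussWeight y := by
  obtain ⟨C, hC0, hC⟩ := exists_abs_le_of_mem_testFunctions hf
  obtain ⟨K, hK, h⟩ := exists_taylor_le hf
  refine ⟨3 * K + 6 * C, by positivity, fun x y => ?_⟩
  have h0 := gaussWeight_nonneg y
  unfold compensatedIncrement
  by_cases hy : ‖y‖ ≤ 1
  · rw [Set.indicator_of_mem (by simpa using hy)]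
    have h1 := h x y
    have h2 := mul_le_mul_of_nonneg_left (sq_le_gaussWeight hy) hK
    nlinarith
  · rw [Set.indicator_of_notMem (by simpa using hy), sub_zero]
    have h2 := mul_le_mul_of_nonneg_left (one_le_gaussWeight (not_le.1 hy).le) hC0
    have h3 : |f (x + y) - f x| ≤ 2 * C := by
      refine (abs_sub _ _).trans ?_
      linarith [hC (x + y), hC x]
    nlinarith [mul_nonneg hK h0]

/-- The symmetrized increment as an element of `L²`. -/
def l2SymmIncrement (u : Lp ℝ 2 (volume : Measure (EuclideanSpace ℝ (Fin n))))
    (y : EuclideanSpace ℝ (Fin n)) : Lp ℝ 2 (volume : Measure (EuclideanSpace ℝ (Fin n))) :=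
  (1 / 2 : ℝ) • (l2Translate y u + l2Translate (-y) u - (2 : ℝ) • u)

lemma continuous_l2SymmIncrement (u : Lp ℝ 2 (volume : Measure (EuclideanSpace ℝ (Fin n)))) :
    Continuous (l2SymmIncrement u) := by
  unfold l2SymmIncrement
  exact Continuous.const_smul (((continuous_l2Translate_apply u).add
    ((continuous_l2Translate_apply u).comp continuous_neg)).sub continuous_const) (1 / 2 : ℝ)

lemma l2SymmIncrement_toLp (hf : MemLp f 2 volume) (y : EuclideanSpace ℝ (Fin n)) :
    l2SymmIncrement (hf.toLp f) y =ᵐ[volume] symmIncrement f y := by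
  unfold l2SymmIncrement
  filter_upwards [l2Translate_toLp y hf, l2Translate_toLp (-y) hf, hf.coeFn_toLp,
    Lp.coeFn_smul (1 / 2 : ℝ)
      (l2Translate y (hf.toLp f) + l2Translate (-y) (hf.toLp f) - (2 : ℝ) • hf.toLp f),
    Lp.coeFn_sub (l2Translate y (hf.toLp f) + l2Translate (-y) (hf.toLp f)) ((2 : ℝ) • hf.toLp f),
    Lp.coeFn_add (l2Translate y (hf.toLp f)) (l2Translate (-y) (hf.toLp f)),
    Lp.coeFn_smul (2 : ℝ) (hf.toLp f)] with x h1 h2 h3 h4 h5 h6 h7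
  rw [h4, Pi.smul_apply, h5, Pi.sub_apply, h6, Pi.add_apply, h7, Pi.smul_apply, h1, h2, h3]
  simp [symmIncrement]

/-- For `‖y‖ ≤ 1` the symmetrized increment lives on the compact 1-thickening of the support, where
the uniform quadratic bound gives an `L²` bound. For larger `y` the isometry of translations
suffices. -/
lemma exists_norm_l2SymmIncrement_le (hf : f ∈ testFunctions n) :
    ∃ K, 0 ≤ K ∧ ∀ y,
      ‖l2SymmIncrement ((memLp_of_mem_testFunctions hf).toLp f) y‖ ≤ K * gaussWeight y := by
  obtain ⟨K, hK, h⟩ := exists_abs_symmIncrement_le_sq hf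
  have hc : IsCompact (Metric.cthickening 1 (tsupport f)) := hf.2.isCompact.cthickening
  set u := (memLp_of_mem_testFunctions hf).toLp f with hu
  set v := indicatorConstLp 2 hc.measurableSet (hc.measure_ne_top (μ := volume)) (1 : ℝ) with hv
  refine ⟨3 * K * ‖v‖ + 6 * ‖u‖, by positivity, fun y => ?_⟩
  have h0 := gaussWeight_nonneg y
  rcases le_total ‖y‖ 1 with hy | hy
  · have h1 : ‖l2SymmIncrement u y‖ ≤ (K * ‖y‖ ^ 2) * ‖v‖ := by
      refine Lp.norm_le_mul_norm_of_ae_le_mul ?_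
      filter_upwards [l2SymmIncrement_toLp (memLp_of_mem_testFunctions hf) y,
        indicatorConstLp_coeFn (p := 2) (hs := hc.measurableSet) (hμs := hc.measure_ne_top (μ := volume))
          (c := (1 : ℝ))] with x h1 h2
      rw [h1, h2]
      by_cases hx : x ∈ Metric.cthickening 1 (tsupport f)
      · rw [Set.indicator_of_mem hx, norm_one, mul_one]
        exact h x y
      · rw [Set.indicator_of_notMem hx, norm_zero, mul_zero]
        have hz : ∀ w, ‖w‖ ≤ 1 → f (x + w) = 0 := by
          intro w hw
          by_contra hne
          refine hx (Metric.mem_cthickening_of_dist_le x (x + w) 1 _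
            (subset_tsupport f hne) ?_)
          simpa [dist_eq_norm] using hw
        have e0 := hz 0 (by simp)
        rw [add_zero] at e0
        rw [symmIncrement, hz y hy, hz (-y) (by simpa using hy), e0]
        simp
    have h2 := mul_le_mul_of_nonneg_left (sq_le_gaussWeight hy)
      (mul_nonneg hK (norm_nonneg v))
    nlinarith [mul_nonneg (norm_nonneg u) h0]
  · have h1 : ‖l2SymmIncrement u y‖ ≤ 2 * ‖u‖ := by
      unfold l2SymmIncrement
      rw [norm_smul]
      have a1 := norm_sub_le (l2Translate y u + l2Translate (-y) u) ((2 : ℝ) • u)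
      have a2 := norm_add_le (l2Translate y u) (l2Translate (-y) u)
      rw [LinearIsometry.norm_map, LinearIsometry.norm_map] at a2
      rw [norm_smul] at a1
      norm_num at a1 ⊢
      linarith
    have h2 := mul_le_mul_of_nonneg_left (one_le_gaussWeight hy) (norm_nonneg u)
    nlinarith [mul_nonneg (mul_nonneg hK (norm_nonneg v)) h0]

end testFunctions

/-! ### The product rule in `L²` -/

section productRule

variable {n : ℕ} (F : BoundedContinuousFunction (EuclideanSpace ℝ (Fin n)) ℝ)
  (u : Lp ℝ 2 (volume : Measure (EuclideanSpace ℝ (Fin n))))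

/-- The product of increments `δ_z u δ_z F` as an element of `L²`. -/
def l2IncrementMul (z : EuclideanSpace ℝ (Fin n)) :
    Lp ℝ 2 (volume : Measure (EuclideanSpace ℝ (Fin n))) :=
  -- The first term is `F(x + z)(u(x + z) - u(x))`. Using only translations and multiplication by a
  -- fixed `F` makes continuity in `z` immediate.
  l2Translate z (l2Mul F (u - l2Translate (-z) u)) - l2Mul F (l2Translate z u - u)

/-- The product `u δ_z F` as an element of `L²`. -/
def l2MulIncrement (z : EuclideanSpace ℝ (Fin n)) :
    Lp ℝ 2 (volume : Measure (EuclideanSpace ℝ (Fin n))) :=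
  l2Translate z (l2Mul F (l2Translate (-z) u)) - l2Mul F u

/-- The product of `u` with the symmetrized increment of `F` as an element of `L²`. -/
def l2MulSymmIncrement (z : EuclideanSpace ℝ (Fin n)) :
    Lp ℝ 2 (volume : Measure (EuclideanSpace ℝ (Fin n))) :=
  (1 / 2 : ℝ) • (l2MulIncrement F u z + l2MulIncrement F u (-z))

/-- The discrete Leibniz rule: three terms with separate small-time limits. -/
lemma l2Translate_l2Mul_sub (z : EuclideanSpace ℝ (Fin n)) :
    l2Translate z (l2Mul F u) - l2Mul F u =
      l2Mul F (l2Translate z u - u) + l2MulIncrement F u z + l2IncrementMul F u z := by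
  unfold l2MulIncrement l2IncrementMul
  simp only [map_sub]
  abel

lemma continuous_l2IncrementMul : Continuous (l2IncrementMul F u) := by
  have h1 : Continuous fun z => l2Translate (-z) u :=
    (continuous_l2Translate_apply u).comp continuous_neg
  exact (continuous_id.l2Translate ((l2Mul F).continuous.comp (continuous_const.sub h1))).sub
    ((l2Mul F).continuous.comp (continuous_l2Translate_sub u))

lemma continuous_l2MulIncrement : Continuous (l2MulIncrement F u) := by
  have h1 : Continuous fun z => l2Translate (-z) u :=
    (continuous_l2Translate_apply u).comp continuous_neg
  exact (continuous_id.l2Translate ((l2Mul F).continuous.comp h1)).sub continuous_const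

lemma continuous_l2MulSymmIncrement : Continuous (l2MulSymmIncrement F u) :=
  Continuous.const_smul ((continuous_l2MulIncrement F u).add
    ((continuous_l2MulIncrement F u).comp continuous_neg)) (1 / 2 : ℝ)

lemma coeFn_l2Translate_neg_comp (z : EuclideanSpace ℝ (Fin n)) :
    ∀ᵐ x, l2Translate (-z) u (x + z) = u x := by
  have h := (measurePreserving_add_right volume z).quasiMeasurePreserving.ae_eq_comp
    (coeFn_l2Translate (-z) u)
  filter_upwards [h] with x hx
  simpa using hx

lemma coeFn_l2IncrementMul (z : EuclideanSpace ℝ (Fin n)) :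
    l2IncrementMul F u z =ᵐ[volume] fun x => (u (x + z) - u x) * (F (x + z) - F x) := by
  have hq := (measurePreserving_add_right (volume : Measure (EuclideanSpace ℝ (Fin n)))
    z).quasiMeasurePreserving
  have h1 := hq.ae_eq_comp (coeFn_l2Mul F (u - l2Translate (-z) u))
  have h2 := hq.ae_eq_comp (Lp.coeFn_sub u (l2Translate (-z) u))
  unfold l2IncrementMul
  filter_upwards [h1, h2, coeFn_l2Translate_neg_comp u z,
    Lp.coeFn_sub (l2Translate z (l2Mul F (u - l2Translate (-z) u)))
      (l2Mul F (l2Translate z u - u)),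
    coeFn_l2Translate z (l2Mul F (u - l2Translate (-z) u)), coeFn_l2Mul F (l2Translate z u - u),
    Lp.coeFn_sub (l2Translate z u) u, coeFn_l2Translate z u] with x h1 h2 h3 h4 h5 h6 h7 h8
  simp only [Function.comp_apply, Pi.sub_apply] at h1 h2 h4 h7
  rw [h4, h5, h1, h2, h3, h6, h7, h8]
  ring

lemma coeFn_l2MulIncrement (z : EuclideanSpace ℝ (Fin n)) :
    l2MulIncrement F u z =ᵐ[volume] fun x => u x * (F (x + z) - F x) := by
  have hq := (measurePreserving_add_right (volume : Measure (EuclideanSpace ℝ (Fin n)))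
    z).quasiMeasurePreserving
  have h1 := hq.ae_eq_comp (coeFn_l2Mul F (l2Translate (-z) u))
  unfold l2MulIncrement
  filter_upwards [h1, coeFn_l2Translate_neg_comp u z,
    Lp.coeFn_sub (l2Translate z (l2Mul F (l2Translate (-z) u))) (l2Mul F u),
    coeFn_l2Translate z (l2Mul F (l2Translate (-z) u)), coeFn_l2Mul F u] with x h1 h2 h3 h4 h5
  simp only [Function.comp_apply, Pi.sub_apply] at h1 h3
  rw [h3, h4, h1, h2, h5]
  ring

lemma coeFn_l2MulSymmIncrement (z : EuclideanSpace ℝ (Fin n)) :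
    l2MulSymmIncrement F u z =ᵐ[volume] fun x => u x * symmIncrement F z x := by
  unfold l2MulSymmIncrement
  filter_upwards [coeFn_l2MulIncrement F u z, coeFn_l2MulIncrement F u (-z),
    Lp.coeFn_smul (1 / 2 : ℝ) (l2MulIncrement F u z + l2MulIncrement F u (-z)),
    Lp.coeFn_add (l2MulIncrement F u z) (l2MulIncrement F u (-z))] with x h1 h2 h3 h4
  rw [h3, Pi.smul_apply, h4, Pi.add_apply, h1, h2, smul_eq_mul, symmIncrement]
  ring

variable {F}

lemma norm_l2IncrementMul_sq_le {K : ℝ} (hK : 0 ≤ K)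
    (hF : ∀ x y, (F (x + y) - F x) ^ 2 ≤ K * gaussWeight y) (z : EuclideanSpace ℝ (Fin n)) :
    ‖l2IncrementMul F u z‖ ^ 2 ≤ K * gaussWeight z * ‖l2Translate z u - u‖ ^ 2 := by
  have h0 : 0 ≤ K * gaussWeight z := mul_nonneg hK (gaussWeight_nonneg z)
  have h : ‖l2IncrementMul F u z‖ ≤ √(K * gaussWeight z) * ‖l2Translate z u - u‖ := by
    refine Lp.norm_le_mul_norm_of_ae_le_mul ?_
    filter_upwards [coeFn_l2IncrementMul F u z, Lp.coeFn_sub (l2Translate z u) u,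
      coeFn_l2Translate z u] with x h1 h2 h3
    rw [h1, h2, Pi.sub_apply, h3, norm_mul, mul_comm]
    gcongr
    exact Real.abs_le_sqrt (hF x z)
  calc ‖l2IncrementMul F u z‖ ^ 2 ≤ (√(K * gaussWeight z) * ‖l2Translate z u - u‖) ^ 2 := by gcongr
    _ = _ := by rw [mul_pow, Real.sq_sqrt h0]

lemma norm_l2MulSymmIncrement_le {K : ℝ}
    (hF : ∀ x y, |symmIncrement F y x| ≤ K * gaussWeight y) (z : EuclideanSpace ℝ (Fin n)) :
    ‖l2MulSymmIncrement F u z‖ ≤ (K * ‖u‖) * gaussWeight z := by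
  have h : ‖l2MulSymmIncrement F u z‖ ≤ (K * gaussWeight z) * ‖u‖ := by
    refine Lp.norm_le_mul_norm_of_ae_le_mul ?_
    filter_upwards [coeFn_l2MulSymmIncrement F u z] with x h1
    rw [h1, norm_mul, mul_comm]
    gcongr
    exact hF x z
  linarith

variable {u} {Ω : Type*} [MeasurableSpace Ω] {P : Measure Ω} [IsProbabilityMeasure P]
  {Z : ℝ≥0 → Ω → EuclideanSpace ℝ (Fin n)}
  {ℓ : Measure (EuclideanSpace ℝ (Fin n))} {γ : EuclideanSpace ℝ (Fin n)}
  {g : Lp ℝ 2 (volume : Measure (EuclideanSpace ℝ (Fin n)))}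

lemma IsLevyProcess.integrable_inner (hZ : IsLevyProcess P Z) (t : ℝ≥0)
    {Φ : EuclideanSpace ℝ (Fin n) → Lp ℝ 2 (volume : Measure (EuclideanSpace ℝ (Fin n)))}
    (hΦ : Continuous Φ) {B : ℝ} (hB : ∀ z, ‖Φ z‖ ≤ B)
    (h : Lp ℝ 2 (volume : Measure (EuclideanSpace ℝ (Fin n)))) :
    Integrable (fun z => inner ℝ (Φ z) h) (P.map (Z t)) := by
  have := hZ.isProbabilityMeasure_map t
  refine Integrable.of_bound (hΦ.inner continuous_const).aestronglyMeasurable (B * ‖h‖)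
    (.of_forall fun z => (norm_inner_le_norm _ _).trans ?_)
  gcongr
  exact hB z

lemma norm_l2MulIncrement_le (z : EuclideanSpace ℝ (Fin n)) :
    ‖l2MulIncrement F u z‖ ≤ 2 * (‖l2Mul F‖ * ‖u‖) := by
  unfold l2MulIncrement
  refine (norm_sub_le _ _).trans ?_
  rw [LinearIsometry.norm_map]
  have h1 := (l2Mul F).le_opNorm (l2Translate (-z) u)
  have h2 := (l2Mul F).le_opNorm u
  rw [LinearIsometry.norm_map] at h1
  linarith

lemma norm_l2IncrementMul_le (z : EuclideanSpace ℝ (Fin n)) :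
    ‖l2IncrementMul F u z‖ ≤ 2 * (‖l2Mul F‖ * (2 * ‖u‖)) := by
  unfold l2IncrementMul
  refine (norm_sub_le _ _).trans ?_
  rw [LinearIsometry.norm_map]
  have h1 := (l2Mul F).le_opNorm (u - l2Translate (-z) u)
  have h2 := (l2Mul F).le_opNorm (l2Translate z u - u)
  have h3 := norm_l2Translate_sub_le u z
  have h4 := norm_l2Translate_sub_le u (-z)
  rw [norm_sub_rev] at h4
  have h5 := mul_le_mul_of_nonneg_left h3 (norm_nonneg (l2Mul F))
  have h6 := mul_le_mul_of_nonneg_left h4 (norm_nonneg (l2Mul F))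
  linarith

/-- The product rule for the generator, in `L²`. -/
theorem IsLevyProcess.tendsto_l2Mul (hZ : IsLevyProcess P Z) (hs : IsSymmetricProcess P Z)
    (hT : HasGeneratingTriplet P Z 0 ℓ γ)
    (hg : Tendsto (fun t : ℝ≥0 => (t : ℝ)⁻¹ • (l2Semigroup P Z t u - u)) (𝓝[>] 0) (𝓝 g))
    {K₁ : ℝ} (hK₁ : 0 ≤ K₁) (hF₁ : ∀ x y, (F (x + y) - F x) ^ 2 ≤ K₁ * gaussWeight y)
    {K₂ : ℝ} (hF₂ : ∀ x y, |symmIncrement F y x| ≤ K₂ * gaussWeight y) :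
    Tendsto (fun t : ℝ≥0 => (t : ℝ)⁻¹ • (l2Semigroup P Z t (l2Mul F u) - l2Mul F u)) (𝓝[>] 0)
      (𝓝 (l2Mul F g + ∫ z, l2MulSymmIncrement F u z ∂ℓ + ∫ z, l2IncrementMul F u z ∂ℓ)) := by
  -- Weak convergence suffices, so each Leibniz term is tested against a fixed `h`.
  refine hZ.tendsto_of_weak hs fun h => ?_
  have t1 : Tendsto (fun t : ℝ≥0 =>
      inner ℝ (l2Mul F ((t : ℝ)⁻¹ • (l2Semigroup P Z t u - u))) h) (𝓝[>] 0)
      (𝓝 (inner ℝ (l2Mul F g) h)) :=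
    (((l2Mul F).continuous.tendsto g).comp hg).inner tendsto_const_nhds
  have t2 := hZ.tendsto_inner_of_norm_le hs hT (continuous_l2MulSymmIncrement F u)
    (norm_l2MulSymmIncrement_le u hF₂) h
  have t3 := hZ.tendsto_inner_of_norm_sq_le hs hT hg (continuous_l2IncrementMul F u) hK₁
    (norm_l2IncrementMul_sq_le u hK₁ hF₁) h
  rw [inner_add_left, inner_add_left]
  refine ((t1.add t2).add t3).congr fun t => ?_
  have := hZ.isProbabilityMeasure_map t
  have i0 : Integrable (fun z => l2Translate z u - u) (P.map (Z t)) :=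
    (integrable_l2Translate _ u).sub (integrable_const _)
  have i0' : Integrable (fun z => l2Translate z (l2Mul F u) - l2Mul F u) (P.map (Z t)) :=
    (integrable_l2Translate _ (l2Mul F u)).sub (integrable_const _)
  have i1 : Integrable (fun z => inner ℝ (l2Mul F (l2Translate z u - u)) h) (P.map (Z t)) :=
    ((l2Mul F).integrable_comp i0).inner_const h
  have i2 := hZ.integrable_inner t (continuous_l2MulIncrement F u) norm_l2MulIncrement_le h
  have i2' : Integrable (fun z => inner ℝ (l2MulIncrement F u (-z)) h) (P.map (Z t)) :=
    hZ.integrable_inner t ((continuous_l2MulIncrement F u).comp continuous_neg)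
    (fun z => norm_l2MulIncrement_le (-z)) h
  have i3 := hZ.integrable_inner t (continuous_l2IncrementMul F u) norm_l2IncrementMul_le h
  have e1 : inner ℝ (l2Mul F ((t : ℝ)⁻¹ • (l2Semigroup P Z t u - u))) h =
      (t : ℝ)⁻¹ * ∫ z, inner ℝ (l2Mul F (l2Translate z u - u)) h ∂(P.map (Z t)) := by
    rw [map_smul, inner_smul_left, hZ.l2Semigroup_sub_self,
      ← (l2Mul F).integral_comp_comm i0, real_inner_comm,
      ← integral_inner ((l2Mul F).integrable_comp i0)]
    simp_rw [real_inner_comm h]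
    simp
  -- The law of `Z_t` is symmetric, so the first-order term `u δF` may be replaced by its
  -- second-order symmetrization.
  have e2 : ∫ z, inner ℝ (l2MulSymmIncrement F u z) h ∂(P.map (Z t)) =
      ∫ z, inner ℝ (l2MulIncrement F u z) h ∂(P.map (Z t)) := by
    have e3 : ∀ z, inner ℝ (l2MulSymmIncrement F u z) h =
        (1 / 2) * (inner ℝ (l2MulIncrement F u z) h + inner ℝ (l2MulIncrement F u (-z)) h) := by
      intro z
      unfold l2MulSymmIncrement
      rw [inner_smul_left, inner_add_left]
      simp
    simp_rw [e3]
    rw [integral_const_mul, integral_add i2 i2',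
      hZ.integral_comp_neg hs t fun z => inner ℝ (l2MulIncrement F u z) h]
    ring
  have e4 : inner ℝ (l2Semigroup P Z t (l2Mul F u) - l2Mul F u) h =
      ∫ z, inner ℝ (l2Translate z (l2Mul F u) - l2Mul F u) h ∂(P.map (Z t)) := by
    rw [hZ.l2Semigroup_sub_self, real_inner_comm, ← integral_inner i0']
    simp_rw [real_inner_comm h]
  have i12 : Integrable (fun z => inner ℝ (l2Mul F (l2Translate z u - u)) h +
    inner ℝ (l2MulIncrement F u z) h) (P.map (Z t)) := i1.add i2
  rw [e1, e2, e4, ← mul_add, ← mul_add, ← integral_add i1 i2, ← integral_add i12 i3]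
  congr 2
  ext z
  rw [l2Translate_l2Mul_sub, inner_add_left, inner_add_left]

/-- The symmetrized difference quotients of the semigroup converge in `L²`. -/
theorem IsLevyProcess.tendsto_l2SymmIncrement (hZ : IsLevyProcess P Z)
    (hs : IsSymmetricProcess P Z) (hT : HasGeneratingTriplet P Z 0 ℓ γ) {K : ℝ}
    (hK : ∀ y, ‖l2SymmIncrement u y‖ ≤ K * gaussWeight y) :
    Tendsto (fun t : ℝ≥0 => (t : ℝ)⁻¹ • (l2Semigroup P Z t u - u)) (𝓝[>] 0)
      (𝓝 (∫ z, l2SymmIncrement u z ∂ℓ)) := by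
  refine hZ.tendsto_of_weak hs fun h => ?_
  refine (hZ.tendsto_inner_of_norm_le hs hT (continuous_l2SymmIncrement u) hK h).congr fun t => ?_
  have := hZ.isProbabilityMeasure_map t
  have i0 : Integrable (fun z => l2Translate z u - u) (P.map (Z t)) :=
    (integrable_l2Translate _ u).sub (integrable_const _)
  have i1 : Integrable (fun z => inner ℝ (l2Translate z u - u) h) (P.map (Z t)) := i0.inner_const h
  have i2 : Integrable (fun z => inner ℝ (l2Translate (-z) u - u) h) (P.map (Z t)) :=
    hZ.integrable_inner t ((continuous_l2Translate_sub u).comp continuous_neg)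
    (fun z => norm_l2Translate_sub_le u (-z)) h
  -- Both halves have the same expectation by symmetry of the law, so symmetrizing leaves `⟨T_t u -
  -- u, h⟩` unchanged.
  have e3 : ∀ z, inner ℝ (l2SymmIncrement u z) h =
      (1 / 2) * (inner ℝ (l2Translate z u - u) h + inner ℝ (l2Translate (-z) u - u) h) := by
    intro z
    unfold l2SymmIncrement
    rw [inner_smul_left, ← inner_add_left, two_smul]
    have : l2Translate z u + l2Translate (-z) u - (u + u) =
      l2Translate z u - u + (l2Translate (-z) u - u) := by abel
    rw [this]
    simp
  simp_rw [e3]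
  rw [integral_const_mul, integral_add i1 i2,
    hZ.integral_comp_neg hs t fun z => inner ℝ (l2Translate z u - u) h,
    hZ.l2Semigroup_sub_self, real_inner_comm, ← integral_inner i0]
  simp_rw [real_inner_comm h]
  ring

end productRule

/-! ### Pointwise formulas for the generator -/

section pointwise

variable {n : ℕ} {Ω : Type*} [MeasurableSpace Ω] {P : Measure Ω} [IsProbabilityMeasure P]
  {Z : ℝ≥0 → Ω → EuclideanSpace ℝ (Fin n)}
  {ℓ : Measure (EuclideanSpace ℝ (Fin n))} {γ : EuclideanSpace ℝ (Fin n)}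
  {φ f g : EuclideanSpace ℝ (Fin n) → ℝ}

lemma IsLevyProcess.isGeneratorPair_of_tendsto (hZ : IsLevyProcess P Z) (hφ : MemLp φ 2 volume)
    {G : Lp ℝ 2 (volume : Measure (EuclideanSpace ℝ (Fin n)))}
    (h : Tendsto (fun t : ℝ≥0 => (t : ℝ)⁻¹ • (l2Semigroup P Z t (hφ.toLp φ) - hφ.toLp φ)) (𝓝[>] 0)
      (𝓝 G)) (hG : G =ᵐ[volume] g) : IsGeneratorPair P Z φ g := by
  have hg : MemLp g 2 volume := (Lp.memLp G).ae_eq hG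
  have e : hg.toLp g = G := Lp.ext (hg.coeFn_toLp.trans hG.symm)
  rw [hZ.isGeneratorPair_iff hφ hg, e]
  exact h

lemma aestronglyMeasurable_comp_add (ℓ : Measure (EuclideanSpace ℝ (Fin n))) [SFinite ℓ]
    (hφ : AEStronglyMeasurable φ volume) :
    AEStronglyMeasurable (fun p : EuclideanSpace ℝ (Fin n) × EuclideanSpace ℝ (Fin n) =>
      φ (p.1 + p.2)) (volume.prod ℓ) :=
  hφ.comp_quasiMeasurePreserving (quasiMeasurePreserving_add_comp measurable_id)

lemma aestronglyMeasurable_increment (ℓ : Measure (EuclideanSpace ℝ (Fin n))) [SFinite ℓ]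
    (hφ : AEStronglyMeasurable φ volume) :
    AEStronglyMeasurable (fun p : EuclideanSpace ℝ (Fin n) × EuclideanSpace ℝ (Fin n) =>
      increment φ p.2 p.1) (volume.prod ℓ) :=
  (aestronglyMeasurable_comp_add ℓ hφ).sub hφ.comp_fst

lemma continuous_symmIncrement (hf : Continuous f) :
    Continuous fun p : EuclideanSpace ℝ (Fin n) × EuclideanSpace ℝ (Fin n) =>
      symmIncrement f p.2 p.1 := by
  unfold symmIncrement
  fun_prop

/-- Test functions are in the domain of the generator. -/
theorem IsLevyProcess.isGeneratorPair_testFunction (hZ : IsLevyProcess P Z)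
    (hs : IsSymmetricProcess P Z) (hT : HasGeneratingTriplet P Z 0 ℓ γ) (hf : f ∈ testFunctions n) :
    IsGeneratorPair P Z f fun x => ∫ y, symmIncrement f y x ∂ℓ := by
  have := hT.isLevyMeasure.sigmaFinite
  obtain ⟨K, hK0, hK⟩ := exists_norm_l2SymmIncrement_le hf
  refine hZ.isGeneratorPair_of_tendsto (memLp_of_mem_testFunctions hf)
    (hZ.tendsto_l2SymmIncrement hs hT hK) ?_
  exact coeFn_integral_Lp (hT.isLevyMeasure.integrable_of_le
    (continuous_l2SymmIncrement _).aestronglyMeasurable hK)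
    (k := fun x y => symmIncrement f y x)
    (continuous_symmIncrement (continuous_of_mem_testFunctions hf)).aestronglyMeasurable
    (l2SymmIncrement_toLp _)

/-- Averaging the compensated increment over `y` and `-y` cancels the odd gradient term, and `ℓ` is
symmetric. -/
lemma integral_symmIncrement_eq (hZ : IsLevyProcess P Z) (hs : IsSymmetricProcess P Z)
    (hT : HasGeneratingTriplet P Z 0 ℓ γ) (hf : f ∈ testFunctions n)
    (x : EuclideanSpace ℝ (Fin n)) :
    Integrable (fun y => compensatedIncrement f y x) ℓ ∧
    ∫ y, symmIncrement f y x ∂ℓ = ∫ y, compensatedIncrement f y x ∂ℓ := by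
  obtain ⟨K, hK0, hK⟩ := exists_abs_compensatedIncrement_le hf
  have hm : Measurable fun y => compensatedIncrement f y x := by
    have h1 := (continuous_of_mem_testFunctions hf).measurable
    unfold compensatedIncrement
    exact (by fun_prop : Measurable _).sub
      ((by fun_prop : Measurable _).indicator Metric.isClosed_closedBall.measurableSet)
  have hi : Integrable (fun y => compensatedIncrement f y x) ℓ :=
    hT.isLevyMeasure.integrable_of_le hm.aestronglyMeasurable (hK x)
  refine ⟨hi, ?_⟩
  have hmp := hZ.measurePreserving_neg hs hT
  have hi' : Integrable (fun y => compensatedIncrement f (-y) x) ℓ :=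
    hmp.integrable_comp_of_integrable hi
  have e1 : ∀ y, symmIncrement f y x =
      (1 / 2) * (compensatedIncrement f y x + compensatedIncrement f (-y) x) := by
    intro y
    unfold symmIncrement compensatedIncrement
    by_cases hy : y ∈ Metric.closedBall (0 : EuclideanSpace ℝ (Fin n)) 1
    · rw [Set.indicator_of_mem hy, Set.indicator_of_mem (by simpa using hy), map_neg]
      ring
    · rw [Set.indicator_of_notMem hy, Set.indicator_of_notMem (by simpa using hy)]
      ring
  have e2 : ∫ y, compensatedIncrement f (-y) x ∂ℓ = ∫ y, compensatedIncrement f y x ∂ℓ :=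
    hmp.integral_comp (MeasurableEquiv.neg (EuclideanSpace ℝ (Fin n))).measurableEmbedding
      (fun y => compensatedIncrement f y x)
  simp_rw [e1]
  rw [integral_const_mul, integral_add hi hi', e2]
  ring

/-- The product rule for the generator. -/
theorem IsLevyProcess.isGeneratorPair_mul (hZ : IsLevyProcess P Z)
    (hs : IsSymmetricProcess P Z) (hT : HasGeneratingTriplet P Z 0 ℓ γ)
    (hφ : IsGeneratorPair P Z φ g) (hf : f ∈ testFunctions n) :
    (∀ᵐ x, Integrable (fun y => increment φ y x * increment f y x) ℓ) ∧
    IsGeneratorPair P Z (fun x => φ x * f x) fun x =>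
      f x * g x + φ x * ∫ y, symmIncrement f y x ∂ℓ
        + ∫ y, increment φ y x * increment f y x ∂ℓ := by
  have := hT.isLevyMeasure.sigmaFinite
  have hg := (hZ.isGeneratorPair_iff hφ.1 hφ.2.1).1 hφ
  obtain ⟨C, hC0, hC⟩ := exists_abs_le_of_mem_testFunctions hf
  have hfc := continuous_of_mem_testFunctions hf
  obtain ⟨K₁, hK₁, hF₁⟩ := exists_increment_sq_le hf
  obtain ⟨K₂, hK₂, hF₂⟩ := exists_abs_symmIncrement_le hf
  set F : BoundedContinuousFunction (EuclideanSpace ℝ (Fin n)) ℝ :=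
    BoundedContinuousFunction.ofNormedAddCommGroup f hfc C hC with hF
  have hFf : (F : EuclideanSpace ℝ (Fin n) → ℝ) = f := rfl
  set u := hφ.1.toLp φ with hu
  have hlim := hZ.tendsto_l2Mul (F := F) hs hT hg hK₁ hF₁ hF₂
  have hΦ : Integrable (l2IncrementMul F u) ℓ :=
    hZ.integrable_of_norm_sq_le hs hT hg (continuous_l2IncrementMul F u).aestronglyMeasurable hK₁
      (norm_l2IncrementMul_sq_le u hK₁ hF₁)
  have hΦk : ∀ y, l2IncrementMul F u y =ᵐ[volume] fun x => increment φ y x * increment f y x := by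
    intro y
    have hq := (measurePreserving_add_right (volume : Measure (EuclideanSpace ℝ (Fin n)))
      y).quasiMeasurePreserving.ae_eq_comp hφ.1.coeFn_toLp
    filter_upwards [coeFn_l2IncrementMul F u y, hφ.1.coeFn_toLp, hq] with x h1 h2 h3
    simp only [Function.comp_apply] at h3
    rw [h1, h3, h2, hFf]
    rfl
  have hk : AEStronglyMeasurable (Function.uncurry fun x y => increment φ y x * increment f y x)
      (volume.prod ℓ) :=
    (aestronglyMeasurable_increment ℓ hφ.1.1).mul
      (aestronglyMeasurable_increment ℓ hfc.aestronglyMeasurable)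
  refine ⟨ae_integrable_of_integrable_Lp hΦ hk hΦk, ?_⟩
  have hS : Integrable (l2MulSymmIncrement F u) ℓ :=
    hT.isLevyMeasure.integrable_of_le (continuous_l2MulSymmIncrement F u).aestronglyMeasurable
      (norm_l2MulSymmIncrement_le u hF₂)
  have hSk : ∀ y, l2MulSymmIncrement F u y =ᵐ[volume] fun x => φ x * symmIncrement f y x := by
    intro y
    filter_upwards [coeFn_l2MulSymmIncrement F u y, hφ.1.coeFn_toLp] with x h1 h2
    rw [h1, h2, hFf]
  have hkS : AEStronglyMeasurable (Function.uncurry fun x y => φ x * symmIncrement f y x)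
      (volume.prod ℓ) :=
    (hφ.1.1.comp_fst).mul (continuous_symmIncrement hfc).aestronglyMeasurable
  have hmem : MemLp (fun x => φ x * f x) 2 volume := by
    refine (memLp_bounded_mul F hφ.1).ae_eq (.of_forall fun x => ?_)
    simp only [hFf]; ring
  have hmul : hmem.toLp _ = l2Mul F u := by
    refine Lp.ext ?_
    filter_upwards [hmem.coeFn_toLp, coeFn_l2Mul F u, hφ.1.coeFn_toLp] with x h1 h2 h3
    rw [h1, h2, h3, hFf, mul_comm]
  refine hZ.isGeneratorPair_of_tendsto hmem (by rw [hmul]; exact hlim) ?_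
  filter_upwards [coeFn_integral_Lp hΦ hk hΦk, coeFn_integral_Lp hS hkS hSk,
    Lp.coeFn_add (l2Mul F (hφ.2.1.toLp g) + ∫ z, l2MulSymmIncrement F u z ∂ℓ)
      (∫ z, l2IncrementMul F u z ∂ℓ),
    Lp.coeFn_add (l2Mul F (hφ.2.1.toLp g)) (∫ z, l2MulSymmIncrement F u z ∂ℓ),
    coeFn_l2Mul F (hφ.2.1.toLp g), hφ.2.1.coeFn_toLp] with x h1 h2 h3 h4 h5 h6
  rw [h3, Pi.add_apply, h4, Pi.add_apply, h1, h2, h5, h6, hFf, integral_const_mul]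

end pointwise

/-! ### The Doob transform as a Lévy-type operator -/

section doob

variable {n : ℕ} {ℓ : Measure (EuclideanSpace ℝ (Fin n))}
  {φ f : EuclideanSpace ℝ (Fin n) → ℝ}

/-- `φ` is positive at `x` and `ℓ`-almost everywhere positive and measurable around `x`. -/
structure IsPositivePoint (φ : EuclideanSpace ℝ (Fin n) → ℝ)
    (ℓ : Measure (EuclideanSpace ℝ (Fin n))) (x : EuclideanSpace ℝ (Fin n)) : Prop where
  pos : 0 < φ x
  ae_pos : ∀ᵐ y ∂ℓ, 0 < φ (x + y)
  aemeasurable : AEMeasurable (fun y => φ (x + y)) ℓ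

/-- By Fubini, for almost every `x` the exceptional null set of `φ` is missed by `x + y` for
`ℓ`-almost every `y`, even if `ℓ` is singular. -/
lemma ae_isPositivePoint [SFinite ℓ] (hφ : AEStronglyMeasurable φ volume)
    (hpos : ∀ᵐ x, 0 < φ x) : ∀ᵐ x, IsPositivePoint φ ℓ x := by
  have h1 : ∀ᵐ p ∂((volume : Measure (EuclideanSpace ℝ (Fin n))).prod ℓ), 0 < φ (p.1 + p.2) :=
    (quasiMeasurePreserving_add_comp (m := ℓ) measurable_id).ae hpos
  filter_upwards [hpos, Measure.ae_ae_of_ae_prod h1,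
    (aestronglyMeasurable_comp_add ℓ hφ).prodMk_left] with x h1 h2 h3
  exact ⟨h1, h2, h3.aemeasurable⟩

namespace IsPositivePoint

variable {x : EuclideanSpace ℝ (Fin n)} {k : EuclideanSpace ℝ (Fin n) → ℝ}

lemma smul_ae_eq (h : IsPositivePoint φ ℓ x) :
    (fun y => (ENNReal.ofReal (φ (x + y) / φ x)).toReal • k y) =ᵐ[ℓ]
      fun y => φ (x + y) / φ x * k y := by
  filter_upwards [h.ae_pos] with y hy
  rw [ENNReal.toReal_ofReal (div_pos hy h.pos).le, smul_eq_mul]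

lemma aemeasurable_density (h : IsPositivePoint φ ℓ x) :
    AEMeasurable (fun y => ENNReal.ofReal (φ (x + y) / φ x)) ℓ :=
  (h.aemeasurable.div_const _).ennreal_ofReal

lemma integrable_jumpKernel_iff (h : IsPositivePoint φ ℓ x) :
    Integrable k (jumpKernel φ ℓ x) ↔ Integrable (fun y => φ (x + y) / φ x * k y) ℓ := by
  unfold jumpKernel
  rw [integrable_withDensity_iff_integrable_smul₀' h.aemeasurable_density
    (.of_forall fun _ => ENNReal.ofReal_lt_top)]
  exact integrable_congr h.smul_ae_eq

lemma integral_jumpKernel (h : IsPositivePoint φ ℓ x) :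
    ∫ y, k y ∂(jumpKernel φ ℓ x) = ∫ y, φ (x + y) / φ x * k y ∂ℓ := by
  unfold jumpKernel
  rw [integral_withDensity_eq_integral_toReal_smul₀ h.aemeasurable_density
    (.of_forall fun _ => ENNReal.ofReal_lt_top)]
  exact integral_congr_ae h.smul_ae_eq

/-- The cutoff is made to cancel the density, leaving the plain indicator of the unit ball; the rest
is `φ(x+y)/φ(x) = 1 + δ_yφ(x)/φ(x)`. -/
lemma density_mul_cutoff_ae_eq (h : IsPositivePoint φ ℓ x) :
    (fun y => φ (x + y) / φ x * (f (x + y) - f x - jumpCutoff φ x y * fderiv ℝ f x y)) =ᵐ[ℓ]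
      fun y => compensatedIncrement f y x + (φ x)⁻¹ * (increment φ y x * increment f y x) := by
  filter_upwards [h.ae_pos] with y hy
  have h0 := h.pos.ne'
  have h1 := hy.ne'
  unfold jumpCutoff compensatedIncrement increment
  by_cases hb : y ∈ Metric.closedBall (0 : EuclideanSpace ℝ (Fin n)) 1
  · rw [Set.indicator_of_mem hb, Set.indicator_of_mem hb]
    field_simp
    ring
  · rw [Set.indicator_of_notMem hb, Set.indicator_of_notMem hb]
    field_simp
    ring

end IsPositivePoint

/-- The drift `∫_{|y| ≤ 1} (φ(x + y) - φ(x)) / φ(x) y ℓ(dy)` of the Doob transform. -/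
def doobDrift (φ : EuclideanSpace ℝ (Fin n) → ℝ) (ℓ : Measure (EuclideanSpace ℝ (Fin n)))
    (x : EuclideanSpace ℝ (Fin n)) : EuclideanSpace ℝ (Fin n) :=
  ∫ y, (increment φ y x / φ x) •
    (Metric.closedBall (0 : EuclideanSpace ℝ (Fin n)) 1).indicator id y ∂ℓ

lemma aestronglyMeasurable_doobDrift_integrand [SFinite ℓ]
    (hφ : AEStronglyMeasurable φ volume) :
    AEStronglyMeasurable (fun p : EuclideanSpace ℝ (Fin n) × EuclideanSpace ℝ (Fin n) =>
      (increment φ p.2 p.1 / φ p.1) •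
        (Metric.closedBall (0 : EuclideanSpace ℝ (Fin n)) 1).indicator id p.2)
      (volume.prod ℓ) := by
  have h1 : AEStronglyMeasurable
      (fun p : EuclideanSpace ℝ (Fin n) × EuclideanSpace ℝ (Fin n) =>
        increment φ p.2 p.1 / φ p.1) (volume.prod ℓ) :=
    ((aestronglyMeasurable_increment ℓ hφ).aemeasurable.div
      hφ.comp_fst.aemeasurable).aestronglyMeasurable
  have h2 : AEStronglyMeasurable
      (fun p : EuclideanSpace ℝ (Fin n) × EuclideanSpace ℝ (Fin n) =>
        (Metric.closedBall (0 : EuclideanSpace ℝ (Fin n)) 1).indicator id p.2)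
      (volume.prod ℓ) :=
    ((measurable_id.indicator Metric.isClosed_closedBall.measurableSet).comp
      measurable_snd).aestronglyMeasurable
  exact h1.smul h2

lemma aemeasurable_doobDrift [SFinite ℓ] (hφ : AEStronglyMeasurable φ volume) :
    AEMeasurable (doobDrift φ ℓ) volume :=
  (aestronglyMeasurable_doobDrift_integrand hφ).integral_prod_right'.aemeasurable

lemma aemeasurable_jumpKernel [SFinite ℓ] (hφ : AEStronglyMeasurable φ volume)
    {B : Set (EuclideanSpace ℝ (Fin n))} (hB : MeasurableSet B) :
    AEMeasurable (fun x => jumpKernel φ ℓ x B) volume := by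
  unfold jumpKernel
  simp_rw [withDensity_apply _ hB]
  have h : AEMeasurable (fun p : EuclideanSpace ℝ (Fin n) × EuclideanSpace ℝ (Fin n) =>
      ENNReal.ofReal (φ (p.1 + p.2) / φ p.1)) (volume.prod (ℓ.restrict B)) :=
    ((aestronglyMeasurable_comp_add (ℓ.restrict B) hφ).aemeasurable.div
      hφ.comp_fst.aemeasurable).ennreal_ofReal
  exact h.lintegral_prod_right'

/-- Since `‖τ_y φ‖ = ‖φ‖`, the function `min(1, |y|²) τ_y φ` is Bochner integrable in `L²`, so its
pointwise integrals are finite almost everywhere. -/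
lemma ae_isLevyMeasure_jumpKernel (hℓ : IsLevyMeasure ℓ) (hφ : MemLp φ 2 volume)
    (hpos : ∀ᵐ x, 0 < φ x) : ∀ᵐ x, IsLevyMeasure (jumpKernel φ ℓ x) := by
  have := hℓ.sigmaFinite
  have hc : Continuous fun y : EuclideanSpace ℝ (Fin n) => min 1 (‖y‖ ^ 2) := by fun_prop
  have hn : ∀ y : EuclideanSpace ℝ (Fin n), 0 ≤ min 1 (‖y‖ ^ 2) := fun y => by positivity
  have hΦ : Integrable (fun y => min 1 (‖y‖ ^ 2) • l2Translate y (hφ.toLp φ)) ℓ := by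
    refine hℓ.integrable_of_le (C := 3 * ‖hφ.toLp φ‖)
      (hc.smul (continuous_l2Translate_apply _)).aestronglyMeasurable fun y => ?_
    rw [norm_smul, Real.norm_of_nonneg (hn y), LinearIsometry.norm_map]
    have := mul_le_mul_of_nonneg_right (min_one_sq_le_gaussWeight y) (norm_nonneg (hφ.toLp φ))
    linarith
  have hk := ae_integrable_of_integrable_Lp hΦ (k := fun x y => min 1 (‖y‖ ^ 2) * φ (x + y))
    ((hc.comp continuous_snd).aestronglyMeasurable.mul (aestronglyMeasurable_comp_add ℓ hφ.1))
    fun y => by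
      filter_upwards [Lp.coeFn_smul (min 1 (‖y‖ ^ 2)) (l2Translate y (hφ.toLp φ)),
        l2Translate_toLp y hφ] with x h1 h2
      rw [h1, Pi.smul_apply, h2, smul_eq_mul]
  filter_upwards [hk, ae_isPositivePoint (ℓ := ℓ) hφ.1 hpos] with x h1 h2
  refine ⟨withDensity_absolutelyContinuous _ _ hℓ.zero, ?_⟩
  have h3 : Integrable (fun y : EuclideanSpace ℝ (Fin n) => min 1 (‖y‖ ^ 2)) (jumpKernel φ ℓ x) := by
    rw [h2.integrable_jumpKernel_iff]
    refine (h1.const_mul (φ x)⁻¹).congr (.of_forall fun y => ?_)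
    simp only
    ring
  exact h3.lintegral_lt_top

variable {Ω : Type*} [MeasurableSpace Ω] {P : Measure Ω}
  {Z : ℝ≥0 → Ω → EuclideanSpace ℝ (Fin n)} {γ : EuclideanSpace ℝ (Fin n)}

/-- The density `φ²` cancels the squared denominator, leaving an `L²(dx)` numerator. -/
lemma memLp_doobOp (hφ : φ ∈ generatorDomain P Z) (hpos : ∀ᵐ x, 0 < φ x)
    (hφf : (fun x => φ x * f x) ∈ generatorDomain P Z) (hf : f ∈ testFunctions n) :
    MemLp (doobOp P Z φ f) 2 (volume.withDensity fun x => ENNReal.ofReal (φ x ^ 2)) := by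
  have hp := generator_spec hφ
  have hq := generator_spec hφf
  obtain ⟨C, hC0, hC⟩ := exists_abs_le_of_mem_testFunctions hf
  have hfc := continuous_of_mem_testFunctions hf
  have hfg : MemLp (fun x => f x * generator P Z φ x) 2 volume :=
    hp.2.1.of_le_mul (hfc.aestronglyMeasurable.mul hp.2.1.1) (c := C) (.of_forall fun x => by
      rw [norm_mul]; gcongr; exact hC x)
  have hnum : MemLp (fun x => generator P Z (fun z => φ z * f z) x - f x * generator P Z φ x) 2
      volume := hq.2.1.sub hfg
  have hm : AEStronglyMeasurable (doobOp P Z φ f) volume :=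
    (hnum.1.aemeasurable.div hp.1.1.aemeasurable).aestronglyMeasurable
  rw [memLp_two_iff_integrable_sq (hm.mono_ac (withDensity_absolutelyContinuous _ _)),
    integrable_withDensity_iff_integrable_smul₀'
      (hp.1.1.aemeasurable.pow_const 2).ennreal_ofReal
      (.of_forall fun _ => ENNReal.ofReal_lt_top)]
  refine hnum.integrable_sq.congr ?_
  filter_upwards [hpos] with x hx
  rw [ENNReal.toReal_ofReal (sq_nonneg _), smul_eq_mul]
  unfold doobOp
  field_simp

variable [IsProbabilityMeasure P]

/-- On the unit ball `|y|²` is at most `3` times the weight, so finite energy makes `|y| (τ_y φ -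
φ)` Bochner integrable there. -/
lemma IsLevyProcess.ae_integrable_doobDrift (hZ : IsLevyProcess P Z)
    (hs : IsSymmetricProcess P Z) (hT : HasGeneratingTriplet P Z 0 ℓ γ)
    (hφ : φ ∈ generatorDomain P Z) :
    ∀ᵐ x, Integrable (fun y => (increment φ y x / φ x) •
      (Metric.closedBall (0 : EuclideanSpace ℝ (Fin n)) 1).indicator id y) ℓ := by
  have := hT.isLevyMeasure.sigmaFinite
  have hp := generator_spec hφ
  have hg := (hZ.isGeneratorPair_iff hp.1 hp.2.1).1 hp
  set u := hp.1.toLp φ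
  set w : EuclideanSpace ℝ (Fin n) → ℝ := fun y =>
    ‖(Metric.closedBall (0 : EuclideanSpace ℝ (Fin n)) 1).indicator id y‖ with hw
  have hwm : Measurable w :=
    (measurable_id.indicator Metric.isClosed_closedBall.measurableSet).norm
  have hw0 : ∀ y, 0 ≤ w y := fun y => norm_nonneg _
  have hwle : ∀ y, w y ^ 2 ≤ 3 * gaussWeight y := by
    intro y
    simp only [hw]
    by_cases hb : y ∈ Metric.closedBall (0 : EuclideanSpace ℝ (Fin n)) 1
    · rw [Set.indicator_of_mem hb]
      exact sq_le_gaussWeight (by simpa using hb)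
    · rw [Set.indicator_of_notMem hb]
      have := gaussWeight_nonneg y
      simp; exact this
  have hΦ : Integrable (fun y => w y • (l2Translate y u - u)) ℓ := by
    refine hZ.integrable_of_norm_sq_le hs hT hg (K := 3)
      (hwm.aestronglyMeasurable.smul (continuous_l2Translate_sub u).aestronglyMeasurable)
      (by norm_num) fun y => ?_
    rw [norm_smul, Real.norm_of_nonneg (hw0 y), mul_pow]
    gcongr
    exact hwle y
  have hk := ae_integrable_of_integrable_Lp hΦ (k := fun x y => w y * increment φ y x)
    ((hwm.comp measurable_snd).aestronglyMeasurable.mul (aestronglyMeasurable_increment ℓ hp.1.1))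
    fun y => by
      filter_upwards [Lp.coeFn_smul (w y) (l2Translate y u - u), l2Translate_toLp y hp.1,
        Lp.coeFn_sub (l2Translate y u) u, hp.1.coeFn_toLp] with x h1 h2 h3 h4
      rw [h1, Pi.smul_apply, h3, Pi.sub_apply, h2, h4, smul_eq_mul]
      rfl
  filter_upwards [hk, (aestronglyMeasurable_doobDrift_integrand (ℓ := ℓ) hp.1.1).prodMk_left]
    with x h1 h2
  refine ((h1.norm.const_mul |(φ x)⁻¹|)).mono' h2 (.of_forall fun y => ?_)
  rw [norm_smul, norm_mul, Real.norm_of_nonneg (hw0 y), div_eq_mul_inv, norm_mul, Real.norm_eq_abs,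
    Real.norm_eq_abs]
  refine le_of_eq ?_
  simp only [hw]
  ring

/-- The Doob transform on test functions. -/
lemma IsLevyProcess.doobOp_ae_eq (hZ : IsLevyProcess P Z) (hs : IsSymmetricProcess P Z)
    (hT : HasGeneratingTriplet P Z 0 ℓ γ) (hφ : φ ∈ generatorDomain P Z)
    (hpos : ∀ᵐ x, 0 < φ x) (hf : f ∈ testFunctions n) :
    ∀ᵐ x, Integrable (fun y => compensatedIncrement f y x +
        (φ x)⁻¹ * (increment φ y x * increment f y x)) ℓ ∧
      doobOp P Z φ f x = ∫ y, (compensatedIncrement f y x +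
        (φ x)⁻¹ * (increment φ y x * increment f y x)) ∂ℓ := by
  obtain ⟨h1, h2⟩ := hZ.isGeneratorPair_mul hs hT (generator_spec hφ) hf
  filter_upwards [h1, hZ.generator_ae_eq h2, hpos] with x h3 h4 h5
  obtain ⟨h6, h7⟩ := integral_symmIncrement_eq hZ hs hT hf x
  have h8 := h3.const_mul (φ x)⁻¹
  refine ⟨h6.add h8, ?_⟩
  rw [integral_add h6 h8, integral_const_mul]
  unfold doobOp
  rw [h4, h7]
  field_simp
  ring

/-- The Doob transform is a Lévy-type operator. -/
theorem IsLevyProcess.isLevyTypeOperator_doobOp (hZ : IsLevyProcess P Z)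
    (hs : IsSymmetricProcess P Z) (hT : HasGeneratingTriplet P Z 0 ℓ γ)
    (hφ : φ ∈ generatorDomain P Z) (hpos : ∀ᵐ x, 0 < φ x) :
    IsLevyTypeOperator (doobOp P Z φ) (fun _ => 0) (doobDrift φ ℓ) (jumpKernel φ ℓ) := by
  have := hT.isLevyMeasure.sigmaFinite
  have hp := generator_spec hφ
  refine ⟨fun i j => by simp, aemeasurable_doobDrift hp.1.1,
    fun B hB => aemeasurable_jumpKernel hp.1.1 hB, .of_forall fun x => Matrix.PosSemidef.zero,
    ae_isLevyMeasure_jumpKernel hT.isLevyMeasure hp.1 hpos, fun f hf => ?_⟩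
  filter_upwards [hZ.doobOp_ae_eq hs hT hφ hpos hf, hZ.ae_integrable_doobDrift hs hT hφ,
    ae_isPositivePoint (ℓ := ℓ) hp.1.1 hpos] with x h1 h2 h3
  obtain ⟨h4, h5⟩ := h1
  have h6 := (fderiv ℝ f x).integrable_comp h2
  -- Passing from `jumpCutoff` to the indicator of the unit ball costs a gradient term with
  -- coefficient `δ_yφ(x)/φ(x)`; its integral is the drift.
  have e : ∀ y, φ (x + y) / φ x * (f (x + y) - f x -
      (Metric.closedBall (0 : EuclideanSpace ℝ (Fin n)) 1).indicator
        (fun y => fderiv ℝ f x y) y) =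
      (compensatedIncrement f y x + (φ x)⁻¹ * (increment φ y x * increment f y x)) -
      fderiv ℝ f x ((increment φ y x / φ x) •
        (Metric.closedBall (0 : EuclideanSpace ℝ (Fin n)) 1).indicator id y) := by
    intro y
    have h0 := h3.pos.ne'
    rw [_root_.map_smul, smul_eq_mul]
    unfold compensatedIncrement increment
    by_cases hb : y ∈ Metric.closedBall (0 : EuclideanSpace ℝ (Fin n)) 1
    · rw [Set.indicator_of_mem hb, Set.indicator_of_mem hb, id]
      field_simp
      ring
    · rw [Set.indicator_of_notMem hb, Set.indicator_of_notMem hb, _root_.map_zero]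
      field_simp
      ring
  rw [h3.integral_jumpKernel]
  simp_rw [e]
  rw [integral_sub h4 h6, h5, doobDrift, ← (fderiv ℝ f x).integral_comp_comm h2]
  simp

end doob

end

theorem proposition7p1 {n : ℕ} {Ω : Type*} [MeasurableSpace Ω] (P : Measure Ω)
    [IsProbabilityMeasure P] (Z : ℝ≥0 → Ω → EuclideanSpace ℝ (Fin n))
    (ℓ : Measure (EuclideanSpace ℝ (Fin n))) (γ : EuclideanSpace ℝ (Fin n))
    (hZ : IsLevyProcess P Z) (hsymm : IsSymmetricProcess P Z)
    (hjump : HasGeneratingTriplet P Z 0 ℓ γ)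
    (φ : EuclideanSpace ℝ (Fin n) → ℝ) (hφ : φ ∈ generatorDomain P Z) :
    (∀ f ∈ testFunctions n,
      f ∈ generatorDomain P Z ∧
      (fun x => φ x * f x) ∈ generatorDomain P Z ∧
      (∀ᵐ x, Integrable (fun y => increment φ y x * increment f y x) ℓ) ∧
      generator P Z (fun x => φ x * f x) =ᵐ[volume] fun x =>
        f x * generator P Z φ x + φ x * generator P Z f x
          + ∫ y, increment φ y x * increment f y x ∂ℓ) ∧
    ((∀ᵐ x, 0 < φ x) →
      (∀ f ∈ testFunctions n,
        MemLp (doobOp P Z φ f) 2 (volume.withDensity fun x => ENNReal.ofReal (φ x ^ 2))) ∧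
      (∀ f ∈ testFunctions n, ∀ᵐ x,
        Integrable (fun y => f (x + y) - f x - jumpCutoff φ x y * fderiv ℝ f x y)
          (jumpKernel φ ℓ x) ∧
        doobOp P Z φ f x =
          ∫ y, (f (x + y) - f x - jumpCutoff φ x y * fderiv ℝ f x y) ∂(jumpKernel φ ℓ x)) ∧
      ∃ b : EuclideanSpace ℝ (Fin n) → EuclideanSpace ℝ (Fin n),
        IsLevyTypeOperator (doobOp P Z φ) (fun _ => 0) b (jumpKernel φ ℓ)) := by
  have hφg := generator_spec hφ
  have := hjump.isLevyMeasure.sigmaFinite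
  refine ⟨fun f hf => ?_, fun hpos => ⟨fun f hf => ?_, fun f hf => ?_, doobDrift φ ℓ,
    hZ.isLevyTypeOperator_doobOp hsymm hjump hφ hpos⟩⟩
  · have hfg := hZ.isGeneratorPair_testFunction hsymm hjump hf
    obtain ⟨h1, h2⟩ := hZ.isGeneratorPair_mul hsymm hjump hφg hf
    refine ⟨⟨_, hfg⟩, ⟨_, h2⟩, h1, ?_⟩
    filter_upwards [hZ.generator_ae_eq h2, hZ.generator_ae_eq hfg] with x h3 h4
    rw [h3, h4]
  · exact memLp_doobOp hφ hpos ⟨_, (hZ.isGeneratorPair_mul hsymm hjump hφg hf).2⟩ hf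
  · filter_upwards [hZ.doobOp_ae_eq hsymm hjump hφ hpos hf,
      ae_isPositivePoint (ℓ := ℓ) hφg.1.1 hpos] with x h1 h2
    rw [h2.integrable_jumpKernel_iff, h2.integral_jumpKernel,
      integrable_congr h2.density_mul_cutoff_ae_eq, integral_congr_ae h2.density_mul_cutoff_ae_eq]
    exact h1
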